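/- Let $\Omega\subset\mathbb R^d$ be open, let $Q:=(0,T)\times\Omega\subset\mathbb R\times\mathbb R^d=\mathbb R^{d+1}$, and let $p\in C(\mathbb R)$ with $p(0)=0$. Let $\rho\in L^\infty(Q)$, $\rho\ge 0$ a.e. (vacuum allowed), $u\in L^\infty(Q;\mathbb R^d)$ and $f\in L^1(Q;\mathbb R^d)$ solve, in the sense of distributions on $Q$, the isentropic compressible Euler system $$\partial_t(\rho u)+\operatorname{div}(\rho u\otimes u)+\nabla p(\rho)=\rho f,\qquad \partial_t\rho+\operatorname{div}(\rho u)=0 .$$ Set $\mathcal P(r):=r\int_1^r \frac{p(s)}{s^2}\,ds$ for $r>0$, $\mathcal P(0):=0$, and suppose that the distribution $\mathrm D$ on $Q$ given by $$-\mathrm D:=\partial_t\Big(\tfrac{\rho|u|^2}{2}+\mathcal P(\rho)\Big)+\operatorname{div}\Big(u\big(\tfrac{\rho|u|^2}{2}+p(\rho)+\mathcal P(\rho)\big)\Big)-\rho f\cdot u$$ is a (signed, locally finite) Radon measure on $Q$. Let $\mathcal H^d$ be the Hausdorff measure on $\mathbb R^{d+1}$ normalised so that it is Lebesgue measure on $\mathbb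 R^d$. Let $\Sigma\subset Q$ be $\mathcal H^d$-countably rectifiable, i.e. $\mathcal H^d$-measurable and covered, up to an $\mathcal H^d$-null set, by countably many Lipschitz images of $\mathbb R^d$, and let $\Sigma$ be oriented by an $\mathcal H^d$-measurable unit normal $n=(n_t,n_x)\in\mathbb R\times\mathbb R^d$. A function $g$ has blow up $v$ at $x$ if $\int_{B_1}|g(x+\ell z)-v(z)|\,dz\to0$ as $\ell\to0^+$. For scalar $g$, the point $x$ is a Lebesgue point if this holds with $v$ constant, and a jump point if it holds with $v=a\,\mathbf 1_{\{z\cdot\nu\ge0\}}+b\,\mathbf 1_{\{z\cdot\nu<0\}}$ for some $a\ne b$ and some unit vector $\nu$. Assume that $\rho$ and $u$ have bilateral traces at $\Sigma$: for $\rho$ and for each component of $u$, $\mathcal H^d$-a.e. point of $\Sigma$ is a Lebesgue point or a jump point. Then there are one-sided traces $\rho^\pm,u^\pm$ on $\Sigma$ with respect to $n$, that is, for $g=\rho$ and $g=u$ and for $\mathcal H^d$-a.e. $x\in\Sigma$, $g$ has at $x$ the blow up $g^+(x)\mathbf 1_{\{z\cdot n(x)\ge0\}}+g^-(x)\mathbf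 1_{\{z\cdot n(x)<0\}}$. For any such $\rho^\pm,u^\pm$, with $u_n^\pm:=u^\pm\cdot n_x$, $$\mathrm D\llcorner\Sigma=-(u_n^+-u_n^-)\,\Pi(\rho^+,\rho^-)\,\mathcal H^d\llcorner\Sigma$$ as Radon measures on $Q$ (in particular the density on the right is $\mathcal H^d$-integrable on $\Sigma\cap K$ for each compact $K\subset Q$), where $$\Pi(a,b):=\begin{cases}\dfrac{p(a)+p(b)}2-\dfrac{ab}{a-b}\displaystyle\int_b^a\frac{p(s)}{s^2}\,ds&\text{if }a>0,\ b>0,\ a\ne b,\\[2mm]\dfrac{p(a)+p(b)}2&\text{if }a=0\text{ or }b=0,\\[1mm]0&\text{if }a=b\ge0.\end{cases}$$ (The last two cases agree at $a=b=0$, since $p(0)=0$.) -/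

import Mathlib

open Set Filter Topology MeasureTheory
open scoped ContDiff InnerProductSpace

noncomputable section

namespace CompressibleEuler

/-- Physical space `ℝᵈ` with the Euclidean norm. -/
abbrev Space (d : ℕ) : Type := EuclideanSpace ℝ (Fin d)

/-- Space-time `ℝ × ℝᵈ` with the Euclidean norm: coordinate `0` is time, coordinates
`1, …, d` are space. -/
abbrev SpaceTime (d : ℕ) : Type := EuclideanSpace ℝ (Fin (d + 1))

/-- The spatial part `z_x ∈ ℝᵈ` of a space-time vector `z = (z_t, z_x)`. -/
def spacePart {d : ℕ} (z : SpaceTime d) : Space d := WithLp.toLp 2 fun i => z i.succ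

/-- The space-time domain `(0,T) × Ω`. -/
def domain {d : ℕ} (T : ℝ) (Ω : Set (Space d)) : Set (SpaceTime d) :=
  {z | 0 < z 0 ∧ z 0 < T ∧ spacePart z ∈ Ω}

/-! ### Distributions -/

/-- Real-valued test functions of class `C_c^∞(Q)`. -/
structure IsTestFunction {d : ℕ} (Q : Set (SpaceTime d)) (φ : SpaceTime d → ℝ) : Prop where
  smooth : ContDiff ℝ ∞ φ
  compact_support : HasCompactSupport φ
  support_subset : tsupport φ ⊆ Q

/-- The time derivative `∂_t φ`. -/
def timeDeriv {d : ℕ} (φ : SpaceTime d → ℝ) (z : SpaceTime d) : ℝ :=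
  fderiv ℝ φ z (EuclideanSpace.single 0 1)

/-- The spatial gradient `∇φ`. -/
def spaceGrad {d : ℕ} (φ : SpaceTime d → ℝ) (z : SpaceTime d) : Space d :=
  WithLp.toLp 2 fun i => fderiv ℝ φ z (EuclideanSpace.single i.succ 1)

/-- `(ρ, u)` with `ρ ≥ 0` solves, in the sense of distributions on `Q`,
`∂_t (ρ u) + div (ρ u ⊗ u) + ∇ p(ρ) = ρ f` and `∂_t ρ + div (ρ u) = 0`. -/
structure IsWeakSolution {d : ℕ} (Q : Set (SpaceTime d)) (p : ℝ → ℝ) (ρ : SpaceTime d → ℝ)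
    (u f : SpaceTime d → Space d) : Prop where
  density_nonneg : ∀ᵐ z ∂(volume.restrict Q), 0 ≤ ρ z
  momentum : ∀ φ, IsTestFunction Q φ → ∀ i : Fin d,
    ∫ z in Q, (ρ z * u z i * timeDeriv φ z + ρ z * u z i * ⟪u z, spaceGrad φ z⟫_ℝ
      + p (ρ z) * spaceGrad φ z i + ρ z * f z i * φ z) = 0
  continuity : ∀ φ, IsTestFunction Q φ →
    ∫ z in Q, (ρ z * timeDeriv φ z + ρ z * ⟪u z, spaceGrad φ z⟫_ℝ) = 0

/-- The internal energy `𝒫(r) = r ∫_1^r p(s)/s² ds` for `r > 0`, and `𝒫(0) = 0`. -/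
def internalEnergy (p : ℝ → ℝ) (r : ℝ) : ℝ :=
  if 0 < r then r * ∫ s in (1 : ℝ)..r, p s / s ^ 2 else 0

/-- The energy density `ρ |u|² / 2 + 𝒫(ρ)`. -/
def energyDensity {d : ℕ} (p : ℝ → ℝ) (r : ℝ) (v : Space d) : ℝ :=
  r * ‖v‖ ^ 2 / 2 + internalEnergy p r

/-- The pairing `⟨D, φ⟩` of the dissipation with a test function, where
`-D = ∂_t (ρ|u|²/2 + 𝒫(ρ)) + div (u (ρ|u|²/2 + p(ρ) + 𝒫(ρ))) - ρ f · u` as distributions. -/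
def dissipation {d : ℕ} (Q : Set (SpaceTime d)) (p : ℝ → ℝ) (ρ : SpaceTime d → ℝ)
    (u f : SpaceTime d → Space d) (φ : SpaceTime d → ℝ) : ℝ :=
  ∫ z in Q, (energyDensity p (ρ z) (u z) * timeDeriv φ z
    + (energyDensity p (ρ z) (u z) + p (ρ z)) * ⟪u z, spaceGrad φ z⟫_ℝ
    + ρ z * ⟪f z, u z⟫_ℝ * φ z)

/-! ### Signed Radon measures -/

/-- A real-valued Radon measure on `Q`, that is locally finite but possibly of infinite total
variation, given by its Jordan decomposition `pos - neg`. -/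
structure SignedRadonMeasure {d : ℕ} (Q : Set (SpaceTime d)) where
  /-- The positive part. -/
  pos : Measure (SpaceTime d)
  /-- The negative part. -/
  neg : Measure (SpaceTime d)
  pos_compl : pos Qᶜ = 0
  neg_compl : neg Qᶜ = 0
  pos_lt_top : ∀ K, IsCompact K → K ⊆ Q → pos K < ⊤
  neg_lt_top : ∀ K, IsCompact K → K ⊆ Q → neg K < ⊤
  mutuallySingular : pos ⟂ₘ neg

/-- The value of the measure on a set contained in a compact subset of `Q`. -/
def SignedRadonMeasure.val {d : ℕ} {Q : Set (SpaceTime d)} (μ : SignedRadonMeasure Q)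
    (A : Set (SpaceTime d)) : ℝ :=
  (μ.pos A).toReal - (μ.neg A).toReal

/-- The distribution `L` on `Q` is the Radon measure `μ`. -/
def SignedRadonMeasure.Represents {d : ℕ} {Q : Set (SpaceTime d)} (μ : SignedRadonMeasure Q)
    (L : (SpaceTime d → ℝ) → ℝ) : Prop :=
  ∀ φ, IsTestFunction Q φ → (∫ z, φ z ∂μ.pos) - (∫ z, φ z ∂μ.neg) = L φ

/-- The equality `μ ⌞ S = g ℋᵈ ⌞ S` of Radon measures on `Q`: on each Borel set `B` which is
relatively compact in `Q`, the density `g` is `ℋᵈ`-integrable on `B ∩ S` and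
`μ (B ∩ S) = ∫_{B ∩ S} g dℋᵈ`. Here `ℋᵈ` is normalised to be Lebesgue measure on `ℝᵈ`. -/
def SignedRadonMeasure.RestrictEq {d : ℕ} {Q : Set (SpaceTime d)} (μ : SignedRadonMeasure Q)
    (S : Set (SpaceTime d)) (g : SpaceTime d → ℝ) : Prop :=
  ∀ B K : Set (SpaceTime d), MeasurableSet B → IsCompact K → K ⊆ Q → B ⊆ K →
    IntegrableOn g (B ∩ S) μHE[d] ∧ μ.val (B ∩ S) = ∫ x in B ∩ S, g x ∂μHE[d]

/-! ### Rectifiable sets of codimension one -/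

/-- `S` is `ℋᵈ`-measurable and, up to an `ℋᵈ`-null set, is covered by countably many Lipschitz
images of `ℝᵈ`. -/
structure IsRectifiableSet {d : ℕ} (S : Set (SpaceTime d)) : Prop where
  nullMeasurable : NullMeasurableSet S μHE[d]
  cover : ∃ F : ℕ → Space d → SpaceTime d, (∀ i, ∃ C, LipschitzWith C (F i)) ∧
    μHE[d] (S \ ⋃ i, range (F i)) = 0

/-- `n` is an `ℋᵈ`-measurable unit normal field on the rectifiable set `S`: for each Lipschitz
parametrization `F` of a part of `S`, it is orthogonal at almost every parameter to the tangent
space `range (DF)`. Parameters where `DF` is not injective have an `ℋᵈ`-null image. -/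
structure IsUnitNormal {d : ℕ} (S : Set (SpaceTime d)) (n : SpaceTime d → SpaceTime d) :
    Prop where
  aemeasurable : AEMeasurable n (μHE[d].restrict S)
  norm_eq_one : ∀ᵐ x ∂μHE[d], x ∈ S → ‖n x‖ = 1
  orthogonal : ∀ (F : Space d → SpaceTime d) (C : NNReal), LipschitzWith C F →
    ∀ᵐ y, F y ∈ S → Function.Injective (fderiv ℝ F y) → ∀ w, ⟪n (F y), fderiv ℝ F y w⟫_ℝ = 0

/-! ### Blow ups and traces -/

/-- `v` is the blow up of `g` at `x`: `∫_{B_1} |g(x + ℓ z) - v(z)| dz → 0` as `ℓ → 0⁺`. -/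
def HasBlowUp {d : ℕ} {F : Type*} [NormedAddCommGroup F] (g : SpaceTime d → F) (x : SpaceTime d)
    (v : SpaceTime d → F) : Prop :=
  Tendsto (fun l : ℝ => ∫⁻ z in Metric.ball (0 : SpaceTime d) 1, ‖g (x + l • z) - v z‖ₑ)
    (𝓝[>] 0) (𝓝 0)

/-- The function equal to `a` on the side `⟨z, ν⟩ ≥ 0` and to `b` on the other side. -/
def jumpProfile {d : ℕ} {F : Type*} (ν : SpaceTime d) (a b : F) (z : SpaceTime d) : F :=
  if 0 ≤ ⟪z, ν⟫_ℝ then a else b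

/-- The scalar function `g` has a constant blow up at `x`. -/
def IsLebesguePoint {d : ℕ} (g : SpaceTime d → ℝ) (x : SpaceTime d) : Prop :=
  ∃ a : ℝ, HasBlowUp g x fun _ => a

/-- `x` is a jump point of the scalar function `g`. -/
def IsJumpPoint {d : ℕ} (g : SpaceTime d → ℝ) (x : SpaceTime d) : Prop :=
  ∃ (a b : ℝ) (ν : SpaceTime d), a ≠ b ∧ ‖ν‖ = 1 ∧ HasBlowUp g x (jumpProfile ν a b)

/-- The scalar function `g` has bilateral traces at `S`: `ℋᵈ`-a.e. point of `S` is a Lebesgue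
point or a jump point of `g`. -/
def HasBilateralTraces {d : ℕ} (g : SpaceTime d → ℝ) (S : Set (SpaceTime d)) : Prop :=
  ∀ᵐ x ∂μHE[d], x ∈ S → IsLebesguePoint g x ∨ IsJumpPoint g x

/-- A vector field has bilateral traces at `S`: `ℋᵈ`-a.e. point of `S` is, for every component,
a Lebesgue point or a jump point. -/
def HasBilateralTracesVec {d : ℕ} (v : SpaceTime d → Space d) (S : Set (SpaceTime d)) : Prop :=
  ∀ᵐ x ∂μHE[d], x ∈ S → ∀ i, IsLebesguePoint (fun z => v z i) x ∨ IsJumpPoint (fun z => v z i) x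

/-- `gp` and `gm` are the one-sided traces `g⁺` and `g⁻` of `g` on `S` oriented by `n`, where
`g⁺` is the limit from the side to which `n` points. -/
def AreTraces {d : ℕ} {F : Type*} [NormedAddCommGroup F] (S : Set (SpaceTime d))
    (n : SpaceTime d → SpaceTime d) (g gp gm : SpaceTime d → F) : Prop :=
  ∀ᵐ x ∂μHE[d], x ∈ S → HasBlowUp g x (jumpProfile (n x) (gp x) (gm x))

/-- The function `Π(a, b)` of the density traces `a = ρ⁺`, `b = ρ⁻`. -/
def bigPi (p : ℝ → ℝ) (a b : ℝ) : ℝ :=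
  if 0 < a ∧ 0 < b ∧ a ≠ b then
    (p a + p b) / 2 - a * b / (a - b) * ∫ s in b..a, p s / s ^ 2
  else if a = 0 ∨ b = 0 then (p a + p b) / 2
  else 0

end CompressibleEuler

end

/-!
The dissipation `D` is the negative divergence, in space-time, of the bounded energy flux
`Z = (E, (E + p(ρ)) u)` with `E = ρ|u|²/2 + 𝒫(ρ)`, up to an integrable source. The theorem is the
jump formula for such divergences, followed by an algebraic elimination.

*Traces.* The jump direction of a scalar function is orthogonal to any Lipschitz surface at almost
all jump points on it: where two nearby points have good blow ups with nearly the same one-sided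
values, each lies close to the jump hyperplane of the other (`abs_inner_sub_le_of_jumpError_le`),
and at density points of the parameter set this constrains the derivative of the parametrization
(`ae_inner_fderiv_jump_eq_zero`). Hence the jump direction is `±n`, and bilateral traces are
one-sided traces with respect to `n` (`HasBilateralTraces.exists_traces`,
`HasBilateralTracesVec.exists_traces`).

*Absolute continuity.* The positive and negative parts of the divergence of a bounded field do not
charge `ℋᵈ`-null sets (`IsBalance.measure_eq_zero`): a compact null set has test functions that are
bounded below on it and whose gradients are small in `L¹`.

*Jump formula.* `IsBalance.ae_jump` identifies the density of `D` on a rectifiable set with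
`-⟨Z⁺ - Z⁻, n⟩`. The balance is tested with a radial bump `φ((z - x)/r)` and multiplied by `r⁻ᵈ`. By
the blow up the flux term tends to the integral of `∇φ` against a jump profile, which by Gauss'
theorem is `-(Z⁺ - Z⁻) · n` times the integral of `φ` over a hyperplane
(`integral_fderiv_jumpProfile`); the source term is of lower order. The measure term is computed by
differentiation of measures on a Lipschitz graph of small constant `ε`
(`ae_tendsto_integral_bumpAt_sub`), which the bump sees as a hyperplane up to an error of order `ε`
(`exists_forall_abs_integral_bumpAt_sub_le`). Rectifiable sets are covered by such graphs for every
`ε` (`IsRectifiableSet.exists_graph_cover`). Neither an area formula nor approximate tangent planes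
are needed.

*Elimination.* The same formula applied to the mass and momentum equations gives the
Rankine–Hugoniot conditions (`ae_inner_trace_sub_eq_zero`): with `m = ρ (n_t + u_n)` on either side,
`[m] = 0` and `m [u] + [p] n_x = 0`. They reduce the jump of the energy flux to
`[u_n] (p⁺ + p⁻)/2 + [𝒫(ρ) (n_t + u_n)]`, and where there is no vacuum the last term is
`m ∫ p(s)/s² ds` with `m = -[u_n] ρ⁺ρ⁻/(ρ⁺ - ρ⁻)`; if one side is vacuum, then `m = 0` and the term
vanishes (`internalEnergy_jump`, `energy_jump`).
-/

noncomputable section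

namespace CompressibleEuler

/-! ### Coordinates in space-time -/

/-- The space-time vector with time coordinate `s` and spatial part `y`. -/
def stack {d : ℕ} (s : ℝ) (y : Space d) : SpaceTime d :=
  WithLp.toLp 2 (Fin.cons s y : Fin (d + 1) → ℝ)

@[simp] lemma stack_zero {d : ℕ} (s : ℝ) (y : Space d) : stack s y 0 = s := rfl

@[simp] lemma stack_succ {d : ℕ} (s : ℝ) (y : Space d) (i : Fin d) : stack s y i.succ = y i := rfl

@[simp] lemma spacePart_apply {d : ℕ} (z : SpaceTime d) (i : Fin d) :
    spacePart z i = z i.succ := rfl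

@[simp] lemma spacePart_stack {d : ℕ} (s : ℝ) (y : Space d) : spacePart (stack s y) = y := by
  ext i; simp

@[simp] lemma stack_spacePart {d : ℕ} (z : SpaceTime d) : stack (z 0) (spacePart z) = z := by
  ext i; refine Fin.cases ?_ (fun j => ?_) i <;> simp

lemma spacePart_sub {d : ℕ} (z w : SpaceTime d) :
    spacePart (z - w) = spacePart z - spacePart w := by ext i; simp

lemma inner_eq_coord {d : ℕ} (z w : SpaceTime d) :
    ⟪z, w⟫_ℝ = z 0 * w 0 + ⟪spacePart z, spacePart w⟫_ℝ := by
  simp [PiLp.inner_apply, Fin.sum_univ_succ, mul_comm]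

lemma inner_stack {d : ℕ} (s t : ℝ) (y w : Space d) :
    ⟪stack s y, stack t w⟫_ℝ = s * t + ⟪y, w⟫_ℝ := by
  rw [inner_eq_coord]; simp

lemma norm_sq_eq_coord {d : ℕ} (z : SpaceTime d) : ‖z‖ ^ 2 = z 0 ^ 2 + ‖spacePart z‖ ^ 2 := by
  rw [← real_inner_self_eq_norm_sq, inner_eq_coord, real_inner_self_eq_norm_sq]; ring

lemma norm_stack_sq {d : ℕ} (s : ℝ) (y : Space d) : ‖stack s y‖ ^ 2 = s ^ 2 + ‖y‖ ^ 2 := by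
  rw [norm_sq_eq_coord]; simp

lemma norm_spacePart_le {d : ℕ} (z : SpaceTime d) : ‖spacePart z‖ ≤ ‖z‖ := by
  refine le_of_sq_le_sq ?_ (norm_nonneg _)
  rw [norm_sq_eq_coord]; nlinarith [sq_nonneg (z 0)]

lemma stack_sub {d : ℕ} (s t : ℝ) (y w : Space d) :
    stack s y - stack t w = stack (s - t) (y - w) := by
  ext i; refine Fin.cases ?_ (fun j => ?_) i <;> simp

lemma stack_smul {d : ℕ} (c s : ℝ) (y : Space d) :
    c • stack s y = stack (c * s) (c • y) := by
  ext i; refine Fin.cases ?_ (fun j => ?_) i <;> simp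

lemma continuous_stack {d : ℕ} : Continuous fun p : ℝ × Space d => stack p.1 p.2 := by
  refine (PiLp.continuous_toLp 2 _).comp (continuous_pi fun i => ?_)
  refine Fin.cases ?_ (fun j => ?_) i
  · simpa using continuous_fst
  · simp only [Fin.cons_succ]; fun_prop

lemma continuous_spacePart {d : ℕ} : Continuous (spacePart : SpaceTime d → Space d) := by
  unfold spacePart; fun_prop

/-- Lebesgue measure on space-time is the product of the Lebesgue measures on time and space. -/
lemma measurePreserving_stack {d : ℕ} :
    MeasurePreserving (fun p : ℝ × Space d => stack p.1 p.2) volume volume := by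
  have h1 := (volume_preserving_piFinSuccAbove (fun _ : Fin (d + 1) => ℝ) 0).symm
  have h2 : MeasurePreserving (Prod.map id (WithLp.ofLp : Space d → (Fin d → ℝ)))
      (volume : Measure (ℝ × Space d)) volume :=
    (MeasurePreserving.id volume).prod (PiLp.volume_preserving_ofLp (Fin d))
  have h3 := (PiLp.volume_preserving_toLp (Fin (d + 1))).comp (h1.comp h2)
  have heq : (fun p : ℝ × Space d => stack p.1 p.2) = WithLp.toLp 2 ∘
      (MeasurableEquiv.piFinSuccAbove (fun _ : Fin (d + 1) => ℝ) 0).symm ∘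
        Prod.map id WithLp.ofLp := by
    funext p
    ext i
    simp only [MeasurableEquiv.piFinSuccAbove, Function.comp_apply]
    refine Fin.cases ?_ (fun j => ?_) i <;> simp
  rw [heq]
  exact h3

lemma measurableEmbedding_stack {d : ℕ} :
    MeasurableEmbedding (fun p : ℝ × Space d => stack p.1 p.2) := by
  refine Continuous.measurableEmbedding continuous_stack fun p q h => ?_
  have h0 := congrArg (fun z : SpaceTime d => z 0) h
  have h1 := congrArg spacePart h
  simp only [stack_zero, spacePart_stack] at h0 h1
  exact Prod.ext h0 h1

/-- A linear isometry of space-time that takes the time direction to a given unit vector. -/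
lemma exists_isometry_map_single {d : ℕ} (e : SpaceTime d) (he : ‖e‖ = 1) :
    ∃ L : SpaceTime d ≃ₗᵢ[ℝ] SpaceTime d, L (stack 1 0) = e := by
  have hv : Orthonormal ℝ (({0} : Set (Fin (d + 1))).domRestrict fun _ => e) := by
    refine ⟨fun i => he, fun i j hij => (hij (Subsingleton.elim _ _)).elim⟩
  obtain ⟨b, hb⟩ := hv.exists_orthonormalBasis_extension_of_card_eq (by simp)
  refine ⟨b.repr.symm, ?_⟩
  have : (stack 1 0 : SpaceTime d) = EuclideanSpace.single 0 1 := by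
    ext i; refine Fin.cases ?_ (fun j => ?_) i <;> simp
  rw [this, OrthonormalBasis.repr_symm_single]
  exact hb 0 rfl

lemma isometry_symm_apply_zero {d : ℕ} (L : SpaceTime d ≃ₗᵢ[ℝ] SpaceTime d) (z : SpaceTime d) :
    (L.symm z) 0 = ⟪z, L (stack 1 0)⟫_ℝ := by
  have h := L.inner_map_map (L.symm z) (stack 1 0)
  rw [L.apply_symm_apply] at h
  rw [h, inner_eq_coord]; simp [inner_zero_right]

/-! ### A radial test function and its integrals over half spaces -/

section RadialBump

variable {E : Type*} [NormedAddCommGroup E]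

/-- A smooth radial bump, positive on the open unit ball and zero elsewhere. -/
def radialBump (z : E) : ℝ := Real.smoothTransition (1 - ‖z‖ ^ 2)

/-- The radial factor of the derivative of `radialBump`. -/
def radialFactor (t : ℝ) : ℝ := -2 * deriv Real.smoothTransition (1 - t)

lemma radialFactor_of_one_le {t : ℝ} (ht : 1 ≤ t) : radialFactor t = 0 := by
  have hmin : IsLocalMin Real.smoothTransition (1 - t) := by
    refine Eventually.of_forall fun s => ?_
    rw [Real.smoothTransition.zero_of_nonpos (by linarith : 1 - t ≤ 0)]
    exact Real.smoothTransition.nonneg s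
  simp [radialFactor, hmin.deriv_eq_zero]

lemma radialBump_nonneg (z : E) : 0 ≤ radialBump z := Real.smoothTransition.nonneg _

lemma radialBump_le_one (z : E) : radialBump z ≤ 1 := Real.smoothTransition.le_one _

lemma radialBump_zero : radialBump (0 : E) = 1 := by simp [radialBump]

lemma radialBump_of_one_le {z : E} (hz : 1 ≤ ‖z‖) : radialBump z = 0 :=
  Real.smoothTransition.zero_of_nonpos (by nlinarith)

lemma support_radialBump_subset : Function.support (radialBump : E → ℝ) ⊆ Metric.ball 0 1 := by
  intro z hz
  by_contra h
  exact hz (radialBump_of_one_le (by simpa using h))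

lemma tsupport_radialBump_subset : tsupport (radialBump : E → ℝ) ⊆ Metric.closedBall 0 1 :=
  closure_minimal (support_radialBump_subset.trans Metric.ball_subset_closedBall)
    Metric.isClosed_closedBall

variable [InnerProductSpace ℝ E]

lemma contDiff_radialBump : ContDiff ℝ ∞ (radialBump : E → ℝ) :=
  (Real.smoothTransition.contDiff (n := ⊤)).comp (contDiff_const.sub (contDiff_norm_sq ℝ))

lemma continuous_radialBump : Continuous (radialBump : E → ℝ) := contDiff_radialBump.continuous

lemma hasCompactSupport_radialBump [FiniteDimensional ℝ E] :
    HasCompactSupport (radialBump : E → ℝ) :=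
  (isCompact_closedBall (0 : E) 1).of_isClosed_subset (isClosed_tsupport _)
    tsupport_radialBump_subset

lemma fderiv_radialBump (z v : E) :
    fderiv ℝ radialBump z v = radialFactor (‖z‖ ^ 2) * ⟪z, v⟫_ℝ := by
  have h1 : HasDerivAt Real.smoothTransition
      (deriv Real.smoothTransition (1 - ‖z‖ ^ 2)) (1 - ‖z‖ ^ 2) :=
    ((Real.smoothTransition.contDiff (n := 1)).differentiable (by simp) _).hasDerivAt
  have h2 : HasFDerivAt (fun z : E => 1 - ‖z‖ ^ 2) (-(2 • innerSL ℝ z)) z :=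
    (hasStrictFDerivAt_norm_sq z).hasFDerivAt.const_sub 1
  have h3 := h1.comp_hasFDerivAt z h2
  have h4 : (Real.smoothTransition ∘ fun z : E => 1 - ‖z‖ ^ 2) = radialBump := rfl
  rw [h4] at h3
  rw [h3.fderiv]
  simp [radialFactor]; ring

lemma continuous_fderiv_radialBump : Continuous (fderiv ℝ (radialBump : E → ℝ)) :=
  contDiff_radialBump.continuous_fderiv (by simp)

lemma fderiv_radialBump_of_one_le {z : E} (hz : 1 ≤ ‖z‖) : fderiv ℝ radialBump z = 0 := by
  ext v
  rw [fderiv_radialBump, radialFactor_of_one_le (by nlinarith)]; simp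

lemma hasCompactSupport_fderiv_radialBump [FiniteDimensional ℝ E] :
    HasCompactSupport (fderiv ℝ (radialBump : E → ℝ)) := hasCompactSupport_radialBump.fderiv ℝ

end RadialBump

/-- The integral of the radial bump over `ℝᵈ`. -/
def bumpMass (d : ℕ) : ℝ := ∫ y : Space d, radialBump y

lemma integrable_radialBump {d : ℕ} : Integrable (radialBump : Space d → ℝ) :=
  continuous_radialBump.integrable_of_hasCompactSupport hasCompactSupport_radialBump

lemma bumpMass_pos (d : ℕ) : 0 < bumpMass d :=
  integral_pos_of_integrable_nonneg_nonzero (x := 0) continuous_radialBump integrable_radialBump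
    (fun z => radialBump_nonneg z) (by simp [radialBump_zero])

lemma integrable_fderiv_radialBump {d : ℕ} (v : SpaceTime d) :
    Integrable fun z : SpaceTime d => fderiv ℝ radialBump z v := by
  refine Continuous.integrable_of_hasCompactSupport
    (continuous_fderiv_radialBump.clm_apply continuous_const) ?_
  exact hasCompactSupport_fderiv_radialBump.comp_left (g := fun A : SpaceTime d →L[ℝ] ℝ => A v) rfl

/-- Gauss' theorem on the half space `z_t ≥ 0`, for the time component. -/
lemma setIntegral_halfSpace_fderiv_time {d : ℕ} :
    ∫ z in {z : SpaceTime d | 0 ≤ z 0}, fderiv ℝ radialBump z (stack 1 0) = -bumpMass d := by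
  have hpre : (fun p : ℝ × Space d => stack p.1 p.2) ⁻¹' {z : SpaceTime d | 0 ≤ z 0}
      = Ici (0 : ℝ) ×ˢ univ := by ext p; simp
  have hint : IntegrableOn (fun p : ℝ × Space d => fderiv ℝ radialBump (stack p.1 p.2) (stack 1 0))
      (Ici (0 : ℝ) ×ˢ univ) := by
    have := (measurePreserving_stack (d := d)).integrable_comp_emb measurableEmbedding_stack
      |>.2 (integrable_fderiv_radialBump (stack 1 0))
    exact this.integrableOn
  rw [← (measurePreserving_stack (d := d)).setIntegral_preimage_emb measurableEmbedding_stack, hpre]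
  rw [Measure.volume_eq_prod] at hint ⊢
  rw [← Measure.prod_restrict, Measure.restrict_univ]
  rw [IntegrableOn, ← Measure.prod_restrict, Measure.restrict_univ] at hint
  rw [integral_prod_symm _ hint, bumpMass, ← integral_neg]
  congr 1
  ext y
  rw [integral_Ici_eq_integral_Ioi]
  have hder : ∀ s : ℝ, HasDerivAt (fun s : ℝ => radialBump (stack s y))
      (fderiv ℝ radialBump (stack s y) (stack 1 0)) s := by
    intro s
    have h1 : HasDerivAt (fun s : ℝ => stack 0 y + s • stack 1 (0 : Space d)) (stack 1 0) s := by
      simpa using ((hasDerivAt_id s).smul_const (stack 1 (0 : Space d))).const_add (stack 0 y)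
    have h2 : ∀ s : ℝ, stack 0 y + s • stack 1 (0 : Space d) = stack s y := by
      intro s; ext i; refine Fin.cases ?_ (fun j => ?_) i <;> simp
    have h3 := ((contDiff_radialBump (E := SpaceTime d)).differentiable (by simp)
      (stack 0 y + s • stack 1 (0 : Space d))).hasFDerivAt.comp_hasDerivAt s h1
    simpa [Function.comp_def, h2] using h3
  have hzero : ∀ s : ℝ, 1 < s → radialBump (stack s y) = 0 := by
    intro s hs
    refine radialBump_of_one_le ?_
    have := norm_stack_sq s y
    nlinarith [norm_nonneg (stack s y), sq_nonneg ‖y‖]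
  rw [integral_Ioi_of_hasDerivAt_of_tendsto' (m := 0) (fun s _ => hder s)]
  · have : radialBump (stack 0 y) = radialBump y := by
      simp only [radialBump, norm_stack_sq]; simp
    simp [this]
  · have hc : Continuous fun s : ℝ => fderiv ℝ radialBump (stack s y) (stack 1 0) :=
      (continuous_fderiv_radialBump.comp
        (continuous_stack.comp (continuous_id.prodMk continuous_const))).clm_apply continuous_const
    refine (hc.integrable_of_hasCompactSupport ?_).integrableOn
    refine HasCompactSupport.of_support_subset_isCompact (isCompact_Icc (a := (-1 : ℝ)) (b := 1)) ?_
    intro s hs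
    by_contra h
    refine hs ?_
    change fderiv ℝ radialBump (stack s y) (stack 1 0) = 0
    rw [fderiv_radialBump, radialFactor_of_one_le, zero_mul]
    rw [norm_stack_sq]
    have : 1 < s ^ 2 := by
      rw [mem_Icc, not_and_or, not_le, not_le] at h
      rcases h with h | h <;> nlinarith
    nlinarith [sq_nonneg ‖y‖]
  · refine tendsto_const_nhds.congr' ?_
    filter_upwards [eventually_gt_atTop 1] with s hs using (hzero s hs).symm

/-- The tangential components do not contribute, by the reflection `(t, x) ↦ (t, -x)`. -/
lemma setIntegral_halfSpace_fderiv_space {d : ℕ} (w : Space d) :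
    ∫ z in {z : SpaceTime d | 0 ≤ z 0}, fderiv ℝ radialBump z (stack 0 w) = 0 := by
  have hpre : (fun p : ℝ × Space d => stack p.1 p.2) ⁻¹' {z : SpaceTime d | 0 ≤ z 0}
      = Ici (0 : ℝ) ×ˢ univ := by ext p; simp
  rw [← (measurePreserving_stack (d := d)).setIntegral_preimage_emb measurableEmbedding_stack, hpre]
  have hmp : MeasurePreserving (Prod.map id Neg.neg : ℝ × Space d → ℝ × Space d) volume volume :=
    (MeasurePreserving.id volume).prod (Measure.measurePreserving_neg (volume : Measure (Space d)))
  have hemb : MeasurableEmbedding (Prod.map id Neg.neg : ℝ × Space d → ℝ × Space d) :=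
    MeasurableEmbedding.id.prodMap (MeasurableEquiv.neg (Space d)).measurableEmbedding
  have h := hmp.setIntegral_preimage_emb hemb
    (fun p : ℝ × Space d => fderiv ℝ radialBump (stack p.1 p.2) (stack 0 w)) (Ici (0 : ℝ) ×ˢ univ)
  have hpre2 : (Prod.map id Neg.neg : ℝ × Space d → ℝ × Space d) ⁻¹' (Ici (0 : ℝ) ×ˢ univ)
      = Ici (0 : ℝ) ×ˢ univ := by ext p; simp
  rw [hpre2] at h
  have hodd : ∀ p : ℝ × Space d,
      fderiv ℝ radialBump (stack (Prod.map id Neg.neg p : ℝ × Space d).1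
        (Prod.map id Neg.neg p : ℝ × Space d).2) (stack 0 w)
      = -fderiv ℝ radialBump (stack p.1 p.2) (stack 0 w) := by
    intro p
    simp [fderiv_radialBump, norm_stack_sq, inner_stack]
  simp only [hodd, integral_neg] at h
  linarith

/-- Gauss' theorem on a half space with unit normal `n`, for the radial bump. -/
lemma setIntegral_halfSpace_fderiv {d : ℕ} (n v : SpaceTime d) (hn : ‖n‖ = 1) :
    ∫ z in {z : SpaceTime d | 0 ≤ ⟪z, n⟫_ℝ}, fderiv ℝ radialBump z v
      = -(bumpMass d * ⟪v, n⟫_ℝ) := by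
  obtain ⟨L, rfl⟩ := exists_isometry_map_single n hn
  have hemb : MeasurableEmbedding L := L.toHomeomorph.measurableEmbedding
  rw [← L.measurePreserving.setIntegral_preimage_emb hemb]
  have hpre : L ⁻¹' {z : SpaceTime d | 0 ≤ ⟪z, L (stack 1 0)⟫_ℝ} = {z | 0 ≤ z 0} := by
    ext z
    simp only [mem_preimage, mem_ofPred_eq, L.inner_map_map]
    rw [inner_eq_coord]; simp
  rw [hpre]
  set w := L.symm v with hw
  have hv : v = L w := by simp [hw]
  have hfd : ∀ z, fderiv ℝ radialBump (L z) v
      = w 0 * fderiv ℝ radialBump z (stack 1 0)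
        + fderiv ℝ radialBump z (stack 0 (spacePart w)) := by
    intro z
    have : w = w 0 • stack 1 0 + stack 0 (spacePart w) := by
      ext i; refine Fin.cases ?_ (fun j => ?_) i <;> simp
    have h2 : fderiv ℝ radialBump (L z) v = fderiv ℝ radialBump z w := by
      rw [hv, fderiv_radialBump, fderiv_radialBump, L.norm_map, L.inner_map_map]
    rw [h2]
    conv_lhs => rw [this]
    simp
  simp only [hfd]
  rw [integral_add ((integrable_fderiv_radialBump _).integrableOn.const_mul _)
    (integrable_fderiv_radialBump _).integrableOn, integral_const_mul,
    setIntegral_halfSpace_fderiv_time, setIntegral_halfSpace_fderiv_space, hw,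
    isometry_symm_apply_zero]
  ring

lemma integral_fderiv_radialBump {d : ℕ} (v : SpaceTime d) :
    ∫ z : SpaceTime d, fderiv ℝ radialBump z v = 0 := by
  have h := integral_neg_eq_self (fun z : SpaceTime d => fderiv ℝ radialBump z v) volume
  have hodd : ∀ z : SpaceTime d, fderiv ℝ radialBump (-z) v = -fderiv ℝ radialBump z v := by
    intro z; simp [fderiv_radialBump]
  simp only [hodd, integral_neg] at h
  linarith

lemma measurableSet_halfSpace {d : ℕ} (n : SpaceTime d) :
    MeasurableSet {z : SpaceTime d | 0 ≤ ⟪z, n⟫_ℝ} :=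
  (isClosed_le continuous_const (by fun_prop)).measurableSet

/-- The pairing of the gradient of the radial bump with a jump profile: only the normal component
of the jump is seen, with a factor independent of the normal. -/
lemma integral_fderiv_jumpProfile {d : ℕ} (n a b : SpaceTime d) (hn : ‖n‖ = 1) :
    ∫ z : SpaceTime d, fderiv ℝ radialBump z (jumpProfile n a b z)
      = -(bumpMass d * ⟪a - b, n⟫_ℝ) := by
  have h : ∀ z : SpaceTime d, fderiv ℝ radialBump z (jumpProfile n a b z)
      = {z : SpaceTime d | 0 ≤ ⟪z, n⟫_ℝ}.indicator (fun z => fderiv ℝ radialBump z (a - b)) z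
        + fderiv ℝ radialBump z b := by
    intro z
    by_cases hz : 0 ≤ ⟪z, n⟫_ℝ <;> simp [jumpProfile, indicator, hz]
  simp only [h]
  rw [integral_add ((integrable_fderiv_radialBump _).indicator (measurableSet_halfSpace n))
    (integrable_fderiv_radialBump _), integral_indicator (measurableSet_halfSpace n),
    integral_fderiv_radialBump, setIntegral_halfSpace_fderiv n _ hn, add_zero]

/-! ### Differentiation of measures tested with rescaled bumps -/

/-- The radial bump transplanted to the ball of radius `r` around `x`. -/
def bumpAt {d : ℕ} (x : SpaceTime d) (r : ℝ) (z : SpaceTime d) : ℝ :=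
  radialBump (r⁻¹ • (z - x))

lemma contDiff_bumpAt {d : ℕ} (x : SpaceTime d) (r : ℝ) : ContDiff ℝ ∞ (bumpAt x r) := by
  have := contDiff_radialBump (E := SpaceTime d)
  unfold bumpAt; fun_prop

lemma continuous_bumpAt {d : ℕ} (x : SpaceTime d) (r : ℝ) : Continuous (bumpAt x r) :=
  (contDiff_bumpAt x r).continuous

lemma bumpAt_nonneg {d : ℕ} (x : SpaceTime d) (r : ℝ) (z : SpaceTime d) : 0 ≤ bumpAt x r z :=
  radialBump_nonneg _

lemma bumpAt_le_one {d : ℕ} (x : SpaceTime d) (r : ℝ) (z : SpaceTime d) : bumpAt x r z ≤ 1 :=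
  radialBump_le_one _

lemma support_bumpAt_subset {d : ℕ} (x : SpaceTime d) {r : ℝ} (hr : 0 < r) :
    Function.support (bumpAt x r) ⊆ Metric.closedBall x r := by
  intro z hz
  by_contra h
  refine hz (radialBump_of_one_le ?_)
  rw [Metric.mem_closedBall, dist_eq_norm, not_le] at h
  rw [norm_smul, norm_inv, Real.norm_of_nonneg hr.le, inv_mul_eq_div, le_div_iff₀ hr]
  linarith

lemma tsupport_bumpAt_subset {d : ℕ} (x : SpaceTime d) {r : ℝ} (hr : 0 < r) :
    tsupport (bumpAt x r) ⊆ Metric.closedBall x r :=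
  closure_minimal (support_bumpAt_subset x hr) Metric.isClosed_closedBall

lemma isTestFunction_bumpAt {d : ℕ} {Q : Set (SpaceTime d)} (x : SpaceTime d) {r : ℝ} (hr : 0 < r)
    (hQ : Metric.closedBall x r ⊆ Q) : IsTestFunction Q (bumpAt x r) where
  smooth := contDiff_bumpAt x r
  compact_support := (isCompact_closedBall x r).of_isClosed_subset (isClosed_tsupport _)
    (tsupport_bumpAt_subset x hr)
  support_subset := (tsupport_bumpAt_subset x hr).trans hQ

lemma fderiv_bumpAt {d : ℕ} (x : SpaceTime d) (r : ℝ) (z v : SpaceTime d) :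
    fderiv ℝ (bumpAt x r) z v = r⁻¹ * fderiv ℝ radialBump (r⁻¹ • (z - x)) v := by
  have h1 : HasFDerivAt (fun z : SpaceTime d => r⁻¹ • (z - x))
      (r⁻¹ • ContinuousLinearMap.id ℝ (SpaceTime d)) z :=
    ((hasFDerivAt_id z).sub_const x).const_smul r⁻¹
  have h2 := ((contDiff_radialBump (E := SpaceTime d)).differentiable (by simp)
    (r⁻¹ • (z - x))).hasFDerivAt.comp z h1
  have h3 : radialBump ∘ (fun z : SpaceTime d => r⁻¹ • (z - x)) = bumpAt x r := rfl
  rw [h3] at h2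
  rw [h2.fderiv]; simp

/-- A quantity of lower order than `ν r`, where `ν r ≤ C r ^ k`, is of lower order than `r ^ k`. -/
lemma tendsto_rescaled_of_div_tendsto_zero {ν F : ℝ → ENNReal} (k : ℕ) (C : ℝ)
    (hν : ∀ r, 0 < r → ν r ≤ ENNReal.ofReal (C * r ^ k))
    (hF : Tendsto (fun r => F r / ν r) (𝓝[>] 0) (𝓝 0)) :
    Tendsto (fun r => (r ^ k)⁻¹ * (F r).toReal) (𝓝[>] 0) (𝓝 0) := by
  have h0 : Tendsto (fun r => (F r / ν r).toReal * |C|) (𝓝[>] 0) (𝓝 0) := by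
    have := ((ENNReal.tendsto_toReal ENNReal.zero_ne_top).comp hF).mul_const |C|
    simpa using this
  refine squeeze_zero' ?_ ?_ h0
  · filter_upwards [self_mem_nhdsWithin] with r hr
    have : (0 : ℝ) < r := hr
    positivity
  · filter_upwards [self_mem_nhdsWithin, hF.eventually (gt_mem_nhds zero_lt_one)]
      with r hr hlt
    have hr0 : (0 : ℝ) < r := hr
    have hfin : ν r ≠ ⊤ := ((hν r hr0).trans_lt ENNReal.ofReal_lt_top).ne
    -- where `ν r = 0`, the quotient is `⊤` unless `F r = 0` as well
    have hFe : F r = F r / ν r * ν r := by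
      by_cases hz : ν r = 0
      · by_cases hz' : F r = 0
        · simp [hz']
        · rw [hz, ENNReal.div_zero hz'] at hlt; simp at hlt
      · rw [ENNReal.div_mul_cancel hz hfin]
    have h1 : (F r).toReal = (F r / ν r).toReal * (ν r).toReal := by
      conv_lhs => rw [hFe, ENNReal.toReal_mul]
    have h2 : (ν r).toReal ≤ |C| * r ^ k := by
      refine ENNReal.toReal_le_of_le_ofReal (by positivity) ((hν r hr0).trans ?_)
      exact ENNReal.ofReal_le_ofReal (by gcongr; exact le_abs_self C)
    rw [h1, inv_mul_le_iff₀ (by positivity)]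
    calc (F r / ν r).toReal * (ν r).toReal ≤ (F r / ν r).toReal * (|C| * r ^ k) := by gcongr
      _ = r ^ k * ((F r / ν r).toReal * |C|) := by ring

/-- At almost every point, testing a measure `m` with rescaled bumps amounts to testing its density
with respect to `ν`: the singular part of `m` and the oscillation of the density are of lower
order than `r ^ k`. -/
lemma ae_tendsto_integral_bumpAt_sub {d : ℕ} (m ν : Measure (SpaceTime d)) [IsFiniteMeasure m]
    [IsLocallyFiniteMeasure ν] (k : ℕ) (C : ℝ)
    (hν : ∀ x r, 0 < r → ν (Metric.closedBall x r) ≤ ENNReal.ofReal (C * r ^ k)) :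
    ∀ᵐ x ∂ν, Tendsto (fun r => (r ^ k)⁻¹ * (∫ z, bumpAt x r z ∂m
      - (m.rnDeriv ν x).toReal * ∫ z, bumpAt x r z ∂ν)) (𝓝[>] 0) (𝓝 0) := by
  have hint : Integrable (fun z => (m.rnDeriv ν z).toReal) ν := Measure.integrable_toReal_rnDeriv
  have hL := VitaliFamily.ae_tendsto_lintegral_enorm_sub_div (Besicovitch.vitaliFamily ν)
    hint.locallyIntegrable
  have hS := VitaliFamily.ae_eventually_measure_zero_of_singular (Besicovitch.vitaliFamily ν)
    (Measure.mutuallySingular_singularPart m ν)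
  filter_upwards [hL, hS] with x hLx hSx
  have h1 := tendsto_rescaled_of_div_tendsto_zero k C (hν x)
    (hLx.comp (Besicovitch.tendsto_filterAt ν x))
  have h2 := tendsto_rescaled_of_div_tendsto_zero k C (hν x)
    (hSx.comp (Besicovitch.tendsto_filterAt ν x))
  have h3 := h1.add h2
  rw [add_zero] at h3
  refine squeeze_zero_norm' ?_ h3
  filter_upwards [self_mem_nhdsWithin] with r hr
  have hr0 : (0 : ℝ) < r := hr
  set θ := fun z => (m.rnDeriv ν z).toReal with hθ
  set b := bumpAt x r with hb
  have hbm : AEStronglyMeasurable b ν := (continuous_bumpAt x r).aestronglyMeasurable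
  have hbnorm : ∀ z, ‖b z‖ ≤ 1 := fun z => by
    rw [Real.norm_of_nonneg (bumpAt_nonneg x r z)]; exact bumpAt_le_one x r z
  have hbi : ∀ (κ : Measure (SpaceTime d)) [IsFiniteMeasure κ], Integrable b κ := fun κ _ =>
    (integrable_const (1 : ℝ)).mono' (continuous_bumpAt x r).aestronglyMeasurable
      (Eventually.of_forall hbnorm)
  have hsupp : HasCompactSupport b := (isCompact_closedBall x r).of_isClosed_subset
    (isClosed_tsupport _) (tsupport_bumpAt_subset x hr0)
  have hbν : Integrable b ν := (continuous_bumpAt x r).integrable_of_hasCompactSupport hsupp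
  have hθb : Integrable (fun z => θ z * b z) ν :=
    hint.mul_bdd hbm (Eventually.of_forall hbnorm)
  -- Lebesgue decomposition of `m`: the singular part is handled by `hB`, the density by `hA`
  have hdec : ∫ z, b z ∂m = ∫ z, b z ∂(m.singularPart ν) + ∫ z, θ z * b z ∂ν := by
    conv_lhs => rw [← Measure.singularPart_add_rnDeriv m ν]
    have hac : ∫ z, b z ∂(ν.withDensity (m.rnDeriv ν)) = ∫ z, θ z * b z ∂ν := by
      rw [integral_withDensity_eq_integral_toReal_smul (Measure.measurable_rnDeriv m ν)
        (Measure.rnDeriv_lt_top m ν)]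
      rfl
    rw [integral_add_measure (hbi _) (hbi _), hac]
  have hsub : ∫ z, θ z * b z ∂ν - θ x * ∫ z, b z ∂ν = ∫ z, (θ z - θ x) * b z ∂ν := by
    rw [← integral_const_mul, ← integral_sub hθb (hbν.const_mul _)]
    congr 1; ext z; ring
  have hA : ‖∫ z, (θ z - θ x) * b z ∂ν‖
      ≤ (∫⁻ z in Metric.closedBall x r, ‖θ z - θ x‖ₑ ∂ν).toReal := by
    have hi : IntegrableOn (fun z => θ z - θ x) (Metric.closedBall x r) ν :=
      hint.integrableOn.sub (integrableOn_const (isCompact_closedBall x r).measure_lt_top.ne)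
    rw [← integral_norm_eq_lintegral_enorm hi.1, ← setIntegral_eq_integral_of_forall_compl_eq_zero
      (s := Metric.closedBall x r)]
    · refine (norm_integral_le_integral_norm _).trans (integral_mono_of_nonneg
        (Eventually.of_forall fun z => norm_nonneg _) hi.norm (Eventually.of_forall fun z => ?_))
      simp only [norm_mul]
      exact mul_le_of_le_one_right (norm_nonneg _) (hbnorm z)
    · intro z hz
      have : b z = 0 := by
        by_contra h
        exact hz (support_bumpAt_subset x hr0 h)
      simp [this]
  have hB : ‖∫ z, b z ∂(m.singularPart ν)‖
      ≤ ((m.singularPart ν) (Metric.closedBall x r)).toReal := by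
    rw [← setIntegral_eq_integral_of_forall_compl_eq_zero (s := Metric.closedBall x r)]
    · have := norm_setIntegral_le_of_norm_le_const (μ := m.singularPart ν)
        (s := Metric.closedBall x r) (f := b) (C := 1) (measure_lt_top _ _)
        (fun z _ => hbnorm z)
      simpa [measureReal_def] using this
    · intro z hz
      by_contra h
      exact hz (support_bumpAt_subset x hr0 h)
  have heq : ∫ z, b z ∂m - θ x * ∫ z, b z ∂ν
      = ∫ z, b z ∂(m.singularPart ν) + ∫ z, (θ z - θ x) * b z ∂ν := by
    rw [hdec, ← hsub]; ring
  change ‖(r ^ k)⁻¹ * (∫ z, b z ∂m - θ x * ∫ z, b z ∂ν)‖ ≤ _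
  rw [heq, norm_mul, Real.norm_of_nonneg (by positivity : (0 : ℝ) ≤ (r ^ k)⁻¹)]
  calc (r ^ k)⁻¹ * ‖∫ z, b z ∂(m.singularPart ν) + ∫ z, (θ z - θ x) * b z ∂ν‖
      ≤ (r ^ k)⁻¹ * (((m.singularPart ν) (Metric.closedBall x r)).toReal
        + (∫⁻ z in Metric.closedBall x r, ‖θ z - θ x‖ₑ ∂ν).toReal) := by
        gcongr
        exact (norm_add_le _ _).trans (add_le_add hB hA)
    _ = _ := (mul_add _ _ _).trans (add_comm _ _)

/-! ### Blow ups -/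

/-- Change of variables from the ball of radius `l` around `x` to the unit ball, for functions that
need not be measurable. -/
lemma lintegral_ball_eq_rescaled {d : ℕ} (F : SpaceTime d → ENNReal) (x : SpaceTime d) {l : ℝ}
    (hl : 0 < l) :
    ∫⁻ w in Metric.ball x l, F w
      = ENNReal.ofReal (l ^ (d + 1)) * ∫⁻ z in Metric.ball (0 : SpaceTime d) 1, F (x + l • z) := by
  have hemb1 : MeasurableEmbedding fun w : SpaceTime d => x + w :=
    (Homeomorph.addLeft x).measurableEmbedding
  have hemb2 : MeasurableEmbedding fun w : SpaceTime d => l • w :=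
    (Homeomorph.smulOfNeZero l hl.ne').measurableEmbedding
  have hmp := measurePreserving_add_left (volume : Measure (SpaceTime d)) x
  have h1 := hmp.setLIntegral_comp_preimage_emb hemb1 F (Metric.ball x l)
  have hp1 : (fun w => x + w) ⁻¹' Metric.ball x l = Metric.ball 0 l := by
    ext w; simp [dist_eq_norm]
  rw [hp1] at h1
  rw [← h1]
  have hp2 : (fun w : SpaceTime d => l • w) ⁻¹' Metric.ball 0 l = Metric.ball 0 1 := by
    ext w
    simp only [mem_preimage, mem_ball_zero_iff, norm_smul, Real.norm_of_nonneg hl.le]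
    exact mul_lt_iff_lt_one_right hl
  have h2 : ∫⁻ z in Metric.ball (0 : SpaceTime d) 1, F (x + l • z)
      = ∫⁻ w in Metric.ball (0 : SpaceTime d) l, F (x + w)
        ∂(Measure.map (fun w => l • w) (volume : Measure (SpaceTime d))) := by
    rw [hemb2.restrict_map, hemb2.lintegral_map, hp2]
  rw [h2, Measure.map_addHaar_smul _ hl.ne', Measure.restrict_smul, lintegral_smul_measure,
    smul_eq_mul, ← mul_assoc, ← ENNReal.ofReal_mul (by positivity)]
  have : l ^ (d + 1) * |(l ^ Module.finrank ℝ (SpaceTime d))⁻¹| = 1 := by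
    rw [abs_of_pos (by positivity)]
    simp only [finrank_euclideanSpace, Fintype.card_fin]
    exact mul_inv_cancel₀ (by positivity)
  rw [this]; simp

lemma eventually_closedBall_subset {d : ℕ} {Q : Set (SpaceTime d)} (hQ : IsOpen Q)
    {x : SpaceTime d} (hx : x ∈ Q) : ∀ᶠ l : ℝ in 𝓝[>] 0, Metric.closedBall x l ⊆ Q := by
  obtain ⟨ε, hε, hsub⟩ := Metric.isOpen_iff.1 hQ x hx
  filter_upwards [Ioo_mem_nhdsGT hε] with l hl
  exact (Metric.closedBall_subset_ball hl.2).trans hsub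

section BlowUp

variable {d : ℕ} {V W : Type*}

lemma ae_eq_comp_affine {Q : Set (SpaceTime d)} {g g' : SpaceTime d → V} {x : SpaceTime d} {l : ℝ}
    (hl : 0 < l) (hsub : Metric.closedBall x l ⊆ Q) (hg : g =ᵐ[volume.restrict Q] g') :
    ∀ᵐ z ∂(volume.restrict (Metric.ball (0 : SpaceTime d) 1)), g (x + l • z) = g' (x + l • z) := by
  have h1 : ∀ᵐ w ∂(volume.restrict (Metric.ball x l)), g w = g' w :=
    ae_restrict_of_ae_restrict_of_subset (Metric.ball_subset_closedBall.trans hsub) hg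
  rw [ae_iff, Measure.restrict_apply' Metric.isOpen_ball.measurableSet] at h1 ⊢
  have h2 := Measure.addHaar_preimage_smul (volume : Measure (SpaceTime d)) hl.ne'
    ((fun w => x + w) ⁻¹' ({a | ¬g a = g' a} ∩ Metric.ball x l))
  rw [measure_preimage_add, h1, mul_zero] at h2
  refine measure_mono_null ?_ h2
  rintro z ⟨hz, hzb⟩
  refine ⟨hz, ?_⟩
  rw [mem_ball_zero_iff] at hzb
  simp only [Metric.mem_ball, dist_self_add_left, norm_smul, Real.norm_of_nonneg hl.le]
  nlinarith

lemma jumpProfile_comp (n : SpaceTime d) (a b : V) (Φ : V → W) (z : SpaceTime d) :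
    Φ (jumpProfile n a b z) = jumpProfile n (Φ a) (Φ b) z := by
  unfold jumpProfile; split_ifs <;> rfl

lemma measurable_jumpProfile [MeasurableSpace V] (n : SpaceTime d) (a b : V) :
    Measurable (jumpProfile n a b) :=
  Measurable.ite (measurableSet_halfSpace n) measurable_const measurable_const

variable [NormedAddCommGroup V] [NormedAddCommGroup W]

/-- Blow ups at the points of an open set depend on `g` only through its class modulo null sets. -/
lemma HasBlowUp.congr_ae {Q : Set (SpaceTime d)} (hQ : IsOpen Q) {x : SpaceTime d} (hx : x ∈ Q)
    {g g' v : SpaceTime d → V} (hg : g =ᵐ[volume.restrict Q] g') (h : HasBlowUp g x v) :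
    HasBlowUp g' x v := by
  refine Tendsto.congr' ?_ h
  filter_upwards [self_mem_nhdsWithin, eventually_closedBall_subset hQ hx] with l hl hsub
  refine lintegral_congr_ae ?_
  filter_upwards [ae_eq_comp_affine hl hsub hg] with z hz
  rw [hz]

lemma HasBlowUp.congr_right {x : SpaceTime d} {g v v' : SpaceTime d → V} (hv : v =ᵐ[volume] v')
    (h : HasBlowUp g x v) : HasBlowUp g x v' := by
  refine Tendsto.congr (fun l => lintegral_congr_ae (ae_restrict_of_ae ?_)) h
  filter_upwards [hv] with z hz
  rw [hz]

/-- On bounded sets a continuous map satisfies `‖Φ a - Φ b‖ ≤ ε + K ‖a - b‖`. -/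
lemma exists_norm_sub_le_add_mul [ProperSpace V] {Φ : V → W} (hΦ : Continuous Φ) (R : ℝ) {ε : ℝ}
    (hε : 0 < ε) :
    ∃ K : ℝ, 0 ≤ K ∧ ∀ a b : V, ‖a‖ ≤ R → ‖b‖ ≤ R → ‖Φ a - Φ b‖ ≤ ε + K * ‖a - b‖ := by
  have hc := isCompact_closedBall (0 : V) R
  obtain ⟨C, hC⟩ := hc.exists_bound_of_continuousOn hΦ.continuousOn
  obtain ⟨δ, hδ, hu⟩ := Metric.uniformContinuousOn_iff.1
    (hc.uniformContinuousOn_of_continuous hΦ.continuousOn) ε hε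
  refine ⟨2 * |C| / δ, by positivity, fun a b ha hb => ?_⟩
  have ha' : a ∈ Metric.closedBall (0 : V) R := by simpa using ha
  have hb' : b ∈ Metric.closedBall (0 : V) R := by simpa using hb
  by_cases h : dist a b < δ
  · have := hu a ha' b hb' h
    rw [dist_eq_norm] at this
    have h0 : 0 ≤ 2 * |C| / δ * ‖a - b‖ := by positivity
    linarith
  · rw [dist_eq_norm, not_lt] at h
    have h1 : ‖Φ a - Φ b‖ ≤ 2 * |C| := by
      have := norm_sub_le (Φ a) (Φ b)
      have := hC a ha'
      have := hC b hb'
      have := le_abs_self C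
      linarith
    have h2 : 2 * |C| ≤ 2 * |C| / δ * ‖a - b‖ := by
      rw [div_mul_eq_mul_div, le_div_iff₀ hδ]; gcongr
    linarith

/-- Blow ups of bounded functions are compatible with continuous maps. -/
lemma HasBlowUp.comp_continuous [ProperSpace V] {g : SpaceTime d → V} {x n : SpaceTime d} {a b : V}
    {M : ℝ} (hg : ∀ z, ‖g z‖ ≤ M) (h : HasBlowUp g x (jumpProfile n a b)) {Φ : V → W}
    (hΦ : Continuous Φ) :
    HasBlowUp (fun z => Φ (g z)) x (jumpProfile n (Φ a) (Φ b)) := by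
  -- `‖Φ v - Φ w‖ ≤ ε + K ‖v - w‖` in the range of the values: the first term is small after
  -- integration by the choice of `ε`, the second one by the blow up of `g`
  set R := max M (max ‖a‖ ‖b‖) with hR
  have hgR : ∀ z, ‖g z‖ ≤ R := fun z => (hg z).trans (le_max_left _ _)
  have hjR : ∀ z, ‖jumpProfile n a b z‖ ≤ R := fun z => by
    unfold jumpProfile
    split_ifs
    · exact (le_max_left _ _).trans (le_max_right _ _)
    · exact (le_max_right _ _).trans (le_max_right _ _)
  rw [HasBlowUp, ENNReal.tendsto_nhds_zero]
  intro η hη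
  set B := volume (Metric.ball (0 : SpaceTime d) 1) with hB
  have hBtop : B ≠ ⊤ := measure_ball_lt_top.ne
  obtain ⟨ε, hε, hεη⟩ : ∃ ε : ℝ, 0 < ε ∧ ENNReal.ofReal ε * B ≤ η / 2 := by
    have : Tendsto (fun ε : ℝ => ENNReal.ofReal ε * B) (𝓝[>] 0) (𝓝 0) := by
      have h1 : Tendsto (fun ε : ℝ => ENNReal.ofReal ε) (𝓝[>] 0) (𝓝 0) := by
        have := ENNReal.tendsto_ofReal (tendsto_nhdsWithin_of_tendsto_nhds
          (s := Ioi (0 : ℝ)) (tendsto_id (x := 𝓝 (0 : ℝ))))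
        simpa using this
      simpa using ENNReal.Tendsto.mul_const h1 (Or.inr hBtop)
    obtain ⟨ε, h1, h2⟩ := ((ENNReal.tendsto_nhds_zero.1 this (η / 2)
      (ENNReal.half_pos hη.ne')).and self_mem_nhdsWithin).exists
    exact ⟨ε, h2, h1⟩
  obtain ⟨K, hK, hΦK⟩ := exists_norm_sub_le_add_mul hΦ R hε
  have hK0 : Tendsto (fun l : ℝ => ENNReal.ofReal K *
      ∫⁻ z in Metric.ball (0 : SpaceTime d) 1, ‖g (x + l • z) - jumpProfile n a b z‖ₑ)
      (𝓝[>] 0) (𝓝 0) := by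
    simpa using ENNReal.Tendsto.const_mul h (Or.inr ENNReal.ofReal_ne_top)
  filter_upwards [ENNReal.tendsto_nhds_zero.1 hK0 (η / 2) (ENNReal.half_pos hη.ne')] with l hl
  calc ∫⁻ z in Metric.ball (0 : SpaceTime d) 1,
        ‖Φ (g (x + l • z)) - jumpProfile n (Φ a) (Φ b) z‖ₑ
      ≤ ∫⁻ z in Metric.ball (0 : SpaceTime d) 1,
        (ENNReal.ofReal ε + ENNReal.ofReal K * ‖g (x + l • z) - jumpProfile n a b z‖ₑ) := by
        refine lintegral_mono fun z => ?_
        rw [← jumpProfile_comp]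
        have := hΦK _ _ (hgR (x + l • z)) (hjR z)
        rw [← ofReal_norm, ← ofReal_norm, ← ENNReal.ofReal_mul hK, ← ENNReal.ofReal_add hε.le
          (by positivity)]
        exact ENNReal.ofReal_le_ofReal this
    _ = ENNReal.ofReal ε * B + ENNReal.ofReal K *
        ∫⁻ z in Metric.ball (0 : SpaceTime d) 1, ‖g (x + l • z) - jumpProfile n a b z‖ₑ := by
        rw [lintegral_add_left measurable_const, lintegral_const_mul' _ _ ENNReal.ofReal_ne_top]
        simp [hB]
    _ ≤ η / 2 + η / 2 := add_le_add hεη hl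
    _ = η := ENNReal.add_halves η

lemma measure_ball_inter_halfSpace_pos {n : SpaceTime d} (hn : n ≠ 0) :
    0 < volume (Metric.ball (0 : SpaceTime d) 1 ∩ {z | 0 < ⟪z, n⟫_ℝ}) := by
  have ho : IsOpen (Metric.ball (0 : SpaceTime d) 1 ∩ {z | 0 < ⟪z, n⟫_ℝ}) :=
    Metric.isOpen_ball.inter (isOpen_lt continuous_const (by fun_prop))
  refine ho.measure_pos _ ⟨(2 * ‖n‖)⁻¹ • n, ?_, ?_⟩
  · have : ‖n‖ ≠ 0 := norm_ne_zero_iff.2 hn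
    rw [mem_ball_zero_iff, norm_smul, norm_inv, norm_mul, norm_norm]
    simp; field_simp; norm_num
  · have := norm_pos_iff.2 hn
    simp only [mem_ofPred_eq, inner_smul_left, real_inner_self_eq_norm_sq]
    simp; positivity

/-- One-sided traces of a function with values in a closed set belong to that set. -/
lemma HasBlowUp.mem_of_isClosed {g : SpaceTime d → V} {x n : SpaceTime d} {a b : V} (hn : n ≠ 0)
    (h : HasBlowUp g x (jumpProfile n a b)) {C : Set V} (hC : IsClosed C) (hg : ∀ z, g z ∈ C) :
    a ∈ C ∧ b ∈ C := by
  have key : ∀ (c : V) (H : Set (SpaceTime d)), MeasurableSet H →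
      (∀ z ∈ H, jumpProfile n a b z = c) →
      0 < volume (Metric.ball (0 : SpaceTime d) 1 ∩ H) → c ∈ C := by
    intro c H hHm hH hpos
    by_contra hc
    have hd : 0 < Metric.infEDist c C := by
      rw [pos_iff_ne_zero]
      intro h0
      exact hc (hC.closure_eq ▸ Metric.mem_closure_iff_infEDist_zero.2 h0)
    -- on `H` the distance from the profile to the values of `g` is at least that from `c` to `C`
    have hle : ∀ l : ℝ, Metric.infEDist c C * volume (Metric.ball (0 : SpaceTime d) 1 ∩ H)
        ≤ ∫⁻ z in Metric.ball (0 : SpaceTime d) 1, ‖g (x + l • z) - jumpProfile n a b z‖ₑ := by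
      intro l
      calc _ = ∫⁻ z in Metric.ball (0 : SpaceTime d) 1 ∩ H, Metric.infEDist c C := by
              rw [setLIntegral_const]
        _ ≤ ∫⁻ z in Metric.ball (0 : SpaceTime d) 1 ∩ H,
              ‖g (x + l • z) - jumpProfile n a b z‖ₑ := by
              refine setLIntegral_mono' (Metric.isOpen_ball.measurableSet.inter hHm) fun z hz => ?_
              rw [hH z hz.2, ← edist_eq_enorm_sub, edist_comm]
              exact Metric.infEDist_le_edist_of_mem (hg _)
        _ ≤ _ := lintegral_mono_set inter_subset_left
    have h0 := ge_of_tendsto' h hle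
    rw [nonpos_iff_eq_zero, mul_eq_zero] at h0
    rcases h0 with h0 | h0
    · exact hd.ne' h0
    · exact hpos.ne' h0
  have hm : ∀ m : SpaceTime d, MeasurableSet {z : SpaceTime d | 0 < ⟪z, m⟫_ℝ} := fun m =>
    (isOpen_lt continuous_const (by fun_prop)).measurableSet
  refine ⟨key a {z | 0 < ⟪z, n⟫_ℝ} (hm n) (fun z hz => ?_) (measure_ball_inter_halfSpace_pos hn),
    key b {z | 0 < ⟪z, -n⟫_ℝ} (hm (-n)) (fun z hz => ?_)
      (measure_ball_inter_halfSpace_pos (neg_ne_zero.2 hn))⟩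
  · rw [mem_ofPred_eq] at hz
    simp [jumpProfile, hz.le]
  · rw [mem_ofPred_eq, inner_neg_right] at hz
    simp [jumpProfile, not_le.2 (neg_pos.1 hz)]

lemma HasBlowUp.prodMk [MeasurableSpace V] [BorelSpace V] [SecondCountableTopology V]
    {g v : SpaceTime d → V} {k w : SpaceTime d → W} {x : SpaceTime d}
    (hg : Measurable g) (hv : Measurable v) (h1 : HasBlowUp g x v) (h2 : HasBlowUp k x w) :
    HasBlowUp (fun z => (g z, k z)) x (fun z => (v z, w z)) := by
  have h := h1.add h2
  rw [add_zero] at h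
  refine tendsto_of_tendsto_of_tendsto_of_le_of_le tendsto_const_nhds h (fun _ => zero_le) ?_
  intro l
  dsimp only
  rw [← lintegral_add_left (by fun_prop)]
  refine lintegral_mono fun z => ?_
  rw [Prod.mk_sub_mk, ← ofReal_norm, ← ofReal_norm, ← ofReal_norm,
    ← ENNReal.ofReal_add (norm_nonneg _) (norm_nonneg _)]
  refine ENNReal.ofReal_le_ofReal ?_
  rw [Prod.norm_mk]
  exact max_le (le_add_of_nonneg_right (norm_nonneg _)) (le_add_of_nonneg_left (norm_nonneg _))

end BlowUp

/-- An essentially bounded function agrees almost everywhere with a bounded measurable one. -/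
lemma exists_bounded_measurable_rep {d : ℕ} {V : Type*} [NormedAddCommGroup V] [MeasurableSpace V]
    [BorelSpace V] [SecondCountableTopology V] {μ : Measure (SpaceTime d)} {g : SpaceTime d → V}
    (hg : MemLp g ⊤ μ) :
    ∃ (g' : SpaceTime d → V) (M : ℝ), Measurable g' ∧ (∀ z, ‖g' z‖ ≤ M) ∧ g =ᵐ[μ] g' := by
  set g0 := hg.1.mk g with hg0
  have hm : Measurable g0 := hg.1.stronglyMeasurable_mk.measurable
  have hae : g =ᵐ[μ] g0 := hg.1.ae_eq_mk
  have hM : ∀ᵐ z ∂μ, ‖g z‖ ≤ (eLpNormEssSup g μ).toReal := by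
    have hfin : eLpNormEssSup g μ ≠ ⊤ := by simpa using hg.eLpNorm_ne_top
    filter_upwards [enorm_ae_le_eLpNormEssSup g μ] with z hz
    rw [← toReal_enorm]
    exact ENNReal.toReal_mono hfin hz
  set M := (eLpNormEssSup g μ).toReal
  have hms : MeasurableSet {z | ‖g0 z‖ ≤ M} := measurableSet_le hm.norm measurable_const
  refine ⟨{z | ‖g0 z‖ ≤ M}.indicator g0, M, hm.indicator hms, fun z => ?_, ?_⟩
  · by_cases hz : ‖g0 z‖ ≤ M
    · rw [indicator_of_mem (by exact hz)]; exact hz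
    · rw [indicator_of_notMem (by exact hz)]; simp [M]
  · filter_upwards [hae, hM] with z h1 h2
    rw [indicator_of_mem (by rw [mem_ofPred_eq, ← h1]; exact h2), h1]

/-! ### Lipschitz graphs -/

lemma euclideanHausdorffMeasure_image_le {X Y : Type*} [EMetricSpace X] [MeasurableSpace X]
    [BorelSpace X] [EMetricSpace Y] [MeasurableSpace Y] [BorelSpace Y] {K : NNReal} {f : X → Y}
    {s : Set X} (hf : LipschitzOnWith K f s) (k : ℕ) :
    μHE[k] (f '' s) ≤ (K : ENNReal) ^ k * μHE[k] s := by
  simp only [Measure.euclideanHausdorffMeasure_def, Measure.smul_apply, ENNReal.smul_def,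
    smul_eq_mul]
  have h := hf.hausdorffMeasure_image_le (d := (k : ℝ)) (Nat.cast_nonneg k)
  rw [ENNReal.rpow_natCast] at h
  calc _ ≤ _ := mul_le_mul_right h _
    _ = _ := by ring

section Graph

variable {d : ℕ} (L : SpaceTime d ≃ₗᵢ[ℝ] SpaceTime d) (h : Space d → ℝ)

/-- The parametrization of the graph of `h` over the hyperplane orthogonal to `L (1, 0)`. -/
def graphMap (y : Space d) : SpaceTime d := L (stack (h y) y)

/-- The projection onto the hyperplane orthogonal to `L (1, 0)`, in coordinates. -/
def graphProj (z : SpaceTime d) : Space d := spacePart (L.symm z)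

/-- The image of Lebesgue measure under the parametrization of a graph. -/
def graphMeasure : Measure (SpaceTime d) := Measure.map (graphMap L h) volume

@[simp] lemma graphProj_graphMap (y : Space d) : graphProj L (graphMap L h y) = y := by
  simp [graphProj, graphMap]

lemma lipschitzWith_graphProj : LipschitzWith 1 (graphProj L) := by
  refine LipschitzWith.of_dist_le_mul fun z w => ?_
  rw [dist_eq_norm, dist_eq_norm, graphProj, graphProj, ← spacePart_sub, ← map_sub]
  refine (norm_spacePart_le _).trans ?_
  rw [L.symm.norm_map, NNReal.coe_one, one_mul]

variable {L h}

lemma lipschitzWith_graphMap {ε : NNReal} (hh : LipschitzWith ε h) :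
    LipschitzWith (1 + ε) (graphMap L h) := by
  refine LipschitzWith.of_dist_le_mul fun y w => ?_
  have h1 := hh.dist_le_mul y w
  rw [Real.dist_eq] at h1
  rw [dist_eq_norm, graphMap, graphMap, ← map_sub, L.norm_map, stack_sub]
  refine le_of_sq_le_sq ?_ (by positivity)
  rw [norm_stack_sq, ← dist_eq_norm, mul_pow]
  have h2 : (h y - h w) ^ 2 ≤ (ε * dist y w) ^ 2 := sq_le_sq' (by
    have := neg_abs_le (h y - h w); linarith) ((le_abs_self _).trans h1)
  have h3 : (0 : ℝ) ≤ ε := ε.2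
  push_cast
  nlinarith [mul_nonneg h3 (sq_nonneg (dist y w))]

lemma continuous_graphMap {ε : NNReal} (hh : LipschitzWith ε h) : Continuous (graphMap L h) :=
  (lipschitzWith_graphMap hh).continuous

lemma measurableEmbedding_graphMap {ε : NNReal} (hh : LipschitzWith ε h) :
    MeasurableEmbedding (graphMap L h) :=
  (continuous_graphMap hh).measurableEmbedding
    (Function.LeftInverse.injective (graphProj_graphMap L h))

lemma measurableSet_range_graphMap {ε : NNReal} (hh : LipschitzWith ε h) :
    MeasurableSet (range (graphMap L h)) := (measurableEmbedding_graphMap hh).measurableSet_range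

lemma graphMeasure_apply {ε : NNReal} (hh : LipschitzWith ε h) (A : Set (SpaceTime d)) :
    graphMeasure L h A = volume (graphMap L h ⁻¹' A) :=
  (measurableEmbedding_graphMap hh).map_apply _ _

lemma graphMeasure_compl_range {ε : NNReal} (hh : LipschitzWith ε h) :
    graphMeasure L h (range (graphMap L h))ᶜ = 0 := by
  rw [graphMeasure_apply hh]
  simp [preimage_compl]

lemma graphMeasure_closedBall_le {ε : NNReal} (hh : LipschitzWith ε h) (x : SpaceTime d) {r : ℝ}
    (hr : 0 < r) :
    graphMeasure L h (Metric.closedBall x r)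
      ≤ ENNReal.ofReal ((volume (Metric.ball (0 : Space d) 1)).toReal * r ^ d) := by
  rw [graphMeasure_apply hh]
  have hsub : graphMap L h ⁻¹' Metric.closedBall x r ⊆ Metric.closedBall (graphProj L x) r := by
    intro y hy
    have := (lipschitzWith_graphProj L).dist_le_mul (graphMap L h y) x
    rw [graphProj_graphMap, NNReal.coe_one, one_mul] at this
    exact this.trans hy
  refine (measure_mono hsub).trans (le_of_eq ?_)
  rw [Measure.addHaar_closedBall _ _ hr.le, mul_comm, ENNReal.ofReal_mul ENNReal.toReal_nonneg,
    ENNReal.ofReal_toReal measure_ball_lt_top.ne]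
  simp

lemma isLocallyFiniteMeasure_graphMeasure {ε : NNReal} (hh : LipschitzWith ε h) :
    IsLocallyFiniteMeasure (graphMeasure L h) where
  finiteAtNhds x := ⟨Metric.closedBall x 1, Metric.closedBall_mem_nhds x one_pos,
    (graphMeasure_closedBall_le hh x one_pos).trans_lt ENNReal.ofReal_lt_top⟩

lemma graphMeasure_le {ε : NNReal} (hh : LipschitzWith ε h) :
    graphMeasure L h ≤ μHE[d].restrict (range (graphMap L h)) := by
  refine Measure.le_iff.2 fun A hA => ?_
  rw [graphMeasure_apply hh, Measure.restrict_apply hA,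
    ← EuclideanSpace.euclideanHausdorffMeasure_eq_volume]
  have hsub : graphMap L h ⁻¹' A ⊆ graphProj L '' (A ∩ range (graphMap L h)) := fun y hy =>
    ⟨graphMap L h y, ⟨hy, mem_range_self y⟩, graphProj_graphMap L h y⟩
  refine (measure_mono hsub).trans ?_
  have := euclideanHausdorffMeasure_image_le
    ((lipschitzWith_graphProj L).lipschitzOnWith (s := A ∩ range (graphMap L h))) d
  simpa using this

lemma restrict_range_graphMap_le {ε : NNReal} (hh : LipschitzWith ε h) :
    μHE[d].restrict (range (graphMap L h))
      ≤ ((1 + ε : NNReal) ^ d : NNReal) • graphMeasure L h := by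
  refine Measure.le_iff.2 fun A hA => ?_
  rw [Measure.restrict_apply hA, Measure.smul_apply, graphMeasure_apply hh,
    ← EuclideanSpace.euclideanHausdorffMeasure_eq_volume, ← image_preimage_eq_inter_range]
  refine (euclideanHausdorffMeasure_image_le
    ((lipschitzWith_graphMap (L := L) hh).lipschitzOnWith (s := graphMap L h ⁻¹' A)) d).trans ?_
  rw [ENNReal.smul_def, smul_eq_mul]
  push_cast
  exact le_rfl

lemma absolutelyContinuous_graphMeasure {ε : NNReal} (hh : LipschitzWith ε h) :
    μHE[d].restrict (range (graphMap L h)) ≪ graphMeasure L h :=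
  (Measure.absolutelyContinuous_of_le (restrict_range_graphMap_le hh)).trans
    (Measure.smul_absolutelyContinuous (c := ((1 + ε : NNReal) ^ d : NNReal)))

/-- On a Lipschitz graph, the density of a measure with respect to the graph measure differs from
its density with respect to Hausdorff measure by a factor close to one. -/
lemma ae_rnDeriv_graphMeasure {ε : NNReal} (hh : LipschitzWith ε h) :
    ∃ k : SpaceTime d → ENNReal,
      (∀ᵐ x ∂(graphMeasure L h), 1 ≤ k x ∧ k x ≤ (1 + ε : NNReal) ^ d) ∧
      ∀ (m : Measure (SpaceTime d)) [IsFiniteMeasure m] (S : Set (SpaceTime d)), MeasurableSet S →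
        ∀ θ : SpaceTime d → ENNReal, Measurable θ →
        m.restrict S = (μHE[d].restrict S).withDensity θ →
        ∀ᵐ x ∂(graphMeasure L h), x ∈ S → m.rnDeriv (graphMeasure L h) x = k x * θ x := by
  set ν := graphMeasure L h with hν
  set κ := (μHE[d] : Measure (SpaceTime d)).restrict (range (graphMap L h)) with hκ
  have : IsLocallyFiniteMeasure ν := isLocallyFiniteMeasure_graphMeasure hh
  have hle : κ ≤ ((1 + ε : NNReal) ^ d : NNReal) • ν := restrict_range_graphMap_le hh
  have : SigmaFinite κ := Measure.sigmaFinite_of_le _ hle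
  have hac : κ ≪ ν := absolutelyContinuous_graphMeasure hh
  have hden : ν.withDensity (κ.rnDeriv ν) = κ := Measure.withDensity_rnDeriv_eq κ ν hac
  -- the factor is the density of Hausdorff measure on the graph; its bounds come from the
  -- Lipschitz constants of the parametrization and of its inverse, the projection
  refine ⟨κ.rnDeriv ν, ?_, fun m _ S hS θ hθ hm => ?_⟩
  · have h1 : (fun _ => 1 : SpaceTime d → ENNReal) ≤ᵐ[ν] κ.rnDeriv ν := by
      refine ae_le_of_forall_setLIntegral_le_of_sigmaFinite measurable_const fun s hs _ => ?_
      rw [setLIntegral_one, ← withDensity_apply (κ.rnDeriv ν) hs, hden]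
      exact graphMeasure_le hh s
    have h2 : κ.rnDeriv ν ≤ᵐ[ν] fun _ => ((1 + ε : NNReal) : ENNReal) ^ d := by
      refine ae_le_of_forall_setLIntegral_le_of_sigmaFinite (Measure.measurable_rnDeriv _ _)
        fun s hs _ => ?_
      rw [← withDensity_apply _ hs, hden, setLIntegral_const]
      have := hle s
      rw [Measure.smul_apply, ENNReal.smul_def, smul_eq_mul] at this
      push_cast at this ⊢
      exact this
    filter_upwards [h1, h2] with x hx1 hx2 using ⟨hx1, hx2⟩
  · set Γ := range (graphMap L h) with hΓdef
    have hΓ : MeasurableSet Γ := measurableSet_range_graphMap hh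
    have e1 : m.restrict (Γ ∩ S) = ν.withDensity ((Γ ∩ S).indicator (κ.rnDeriv ν * θ)) := by
      rw [withDensity_indicator (hΓ.inter hS), ← restrict_withDensity (hΓ.inter hS),
        withDensity_mul _ (Measure.measurable_rnDeriv _ _) hθ, hden,
        restrict_withDensity (hΓ.inter hS), ← Measure.restrict_restrict hΓ, hm,
        restrict_withDensity hΓ, Measure.restrict_restrict hΓ,
        hκ, Measure.restrict_restrict (hΓ.inter hS), inter_assoc, inter_comm S Γ, ← inter_assoc,
        inter_self]
    have e2 : (m.restrict (Γ ∩ S)).rnDeriv ν =ᵐ[ν] (Γ ∩ S).indicator (κ.rnDeriv ν * θ) := by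
      rw [e1]
      exact Measure.rnDeriv_withDensity ν
        (((Measure.measurable_rnDeriv _ _).mul hθ).indicator (hΓ.inter hS))
    have e3 := Measure.rnDeriv_restrict m ν (hΓ.inter hS)
    have hrange : ∀ᵐ x ∂ν, x ∈ Γ := by
      rw [ae_iff]; exact graphMeasure_compl_range hh
    filter_upwards [e2, e3, hrange] with x h2 h3 hxΓ hxS
    rw [h2] at h3
    have hx : x ∈ Γ ∩ S := ⟨hxΓ, hxS⟩
    rw [indicator_of_mem hx, indicator_of_mem hx] at h3
    exact h3.symm

end Graph

lemma exists_lipschitzWith_radialBump (d : ℕ) :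
    ∃ C : NNReal, LipschitzWith C (radialBump : SpaceTime d → ℝ) :=
  ContDiff.lipschitzWith_of_hasCompactSupport hasCompactSupport_radialBump
    (contDiff_radialBump.of_le (m := 1) (by simp)) one_ne_zero

/-- A graph with small Lipschitz constant is seen by a rescaled bump as a flat hyperplane, up to
a small error. -/
lemma exists_forall_abs_integral_bumpAt_sub_le (d : ℕ) :
    ∃ C : ℝ, 0 ≤ C ∧ ∀ (L : SpaceTime d ≃ₗᵢ[ℝ] SpaceTime d) (h : Space d → ℝ) (ε : NNReal),
      LipschitzWith ε h → ∀ x ∈ range (graphMap L h), ∀ r : ℝ, 0 < r →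
        |(r ^ d)⁻¹ * ∫ z, bumpAt x r z ∂(graphMeasure L h) - bumpMass d| ≤ C * ε := by
  obtain ⟨C, hC⟩ := exists_lipschitzWith_radialBump d
  refine ⟨C * (volume (Metric.closedBall (0 : Space d) 1)).toReal, by positivity, ?_⟩
  rintro L h ε hh _ ⟨y0, rfl⟩ r hr
  rw [graphMeasure, (measurableEmbedding_graphMap hh).integral_map]
  -- the height of the graph, rescaled around the point `y0`
  set t : Space d → ℝ := fun w => r⁻¹ * (h (y0 + r • w) - h y0) with ht
  have hcont : Continuous fun w => radialBump (stack (t w) w) := by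
    have := hh.continuous
    exact continuous_radialBump.comp
      (continuous_stack.comp (by fun_prop : Continuous fun w => (t w, w)))
  have e1 : ∀ w, bumpAt (graphMap L h y0) r (graphMap L h (y0 + r • w))
      = radialBump (stack (t w) w) := by
    intro w
    rw [bumpAt, graphMap, graphMap, ← map_sub, stack_sub, ← map_smul, stack_smul]
    simp only [radialBump, L.norm_map, ht]
    rw [add_sub_cancel_left, inv_smul_smul₀ hr.ne']
  have e2 : (r ^ d)⁻¹ * ∫ y, bumpAt (graphMap L h y0) r (graphMap L h y)
      = ∫ w, radialBump (stack (t w) w) := by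
    rw [← integral_add_left_eq_self _ y0]
    have := Measure.integral_comp_smul_of_nonneg (volume : Measure (Space d))
      (fun w => bumpAt (graphMap L h y0) r (graphMap L h (y0 + w))) r (hR := hr.le)
    simp only [e1, finrank_euclideanSpace, Fintype.card_fin, smul_eq_mul] at this
    exact this.symm
  have hzero : ∀ w : Space d, w ∉ Metric.closedBall (0 : Space d) 1 →
      radialBump (stack (t w) w) = 0 := by
    intro w hw
    refine radialBump_of_one_le ?_
    have h1 := norm_spacePart_le (stack (t w) w)
    rw [spacePart_stack] at h1
    rw [mem_closedBall_zero_iff, not_le] at hw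
    linarith
  have hzero' : ∀ w : Space d, w ∉ Metric.closedBall (0 : Space d) 1 → radialBump w = 0 := by
    intro w hw
    rw [mem_closedBall_zero_iff, not_le] at hw
    exact radialBump_of_one_le hw.le
  have hint : Integrable fun w => radialBump (stack (t w) w) :=
    hcont.integrable_of_hasCompactSupport (HasCompactSupport.intro (isCompact_closedBall 0 1) hzero)
  rw [e2, bumpMass, ← integral_sub hint integrable_radialBump,
    ← setIntegral_eq_integral_of_forall_compl_eq_zero (s := Metric.closedBall (0 : Space d) 1)
    (fun w hw => by rw [hzero w hw, hzero' w hw, sub_self])]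
  have hb := norm_setIntegral_le_of_norm_le_const (μ := (volume : Measure (Space d)))
    (s := Metric.closedBall (0 : Space d) 1)
    (f := fun w => radialBump (stack (t w) w) - radialBump w) (C := C * ε)
    measure_closedBall_lt_top ?_
  · rw [measureReal_def, Real.norm_eq_abs] at hb
    linarith
  · intro w hw
    rw [mem_closedBall_zero_iff] at hw
    have h0 : radialBump w = radialBump (stack 0 w) := by
      simp only [radialBump, norm_stack_sq]; simp
    have h1 := hC.dist_le_mul (stack (t w) w) (stack 0 w)
    have h2 : ‖stack (t w) w - stack 0 w‖ = |t w| := by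
      rw [stack_sub, sub_self, sub_zero, ← sq_eq_sq₀ (norm_nonneg _) (abs_nonneg _), norm_stack_sq,
        sq_abs]
      simp
    have h3 : |t w| ≤ ε := by
      have h4 := hh.dist_le_mul (y0 + r • w) y0
      rw [Real.dist_eq, dist_self_add_left, norm_smul, Real.norm_of_nonneg hr.le] at h4
      rw [ht]
      simp only [abs_mul, abs_inv, abs_of_pos hr]
      rw [inv_mul_le_iff₀ hr]
      have h5 : (0 : ℝ) ≤ ε := ε.2
      nlinarith [mul_nonneg h5 hr.le]
    rw [dist_eq_norm, dist_eq_norm, h2, ← h0] at h1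
    exact h1.trans (by gcongr)

/-! ### Covering rectifiable sets by flat Lipschitz graphs -/

/-- If the increments of `f` are controlled by those of `g`, then `f` factors through `g` by a
Lipschitz map. -/
lemma euclideanHausdorffMeasure_image_le_of_dist_le {T X Y : Type*} [MetricSpace X]
    [MeasurableSpace X] [BorelSpace X] [MetricSpace Y] [MeasurableSpace Y] [BorelSpace Y]
    {K : NNReal} {f : T → X} {g : T → Y} {t : Set T} (k : ℕ)
    (hfg : ∀ y ∈ t, ∀ w ∈ t, dist (f y) (f w) ≤ K * dist (g y) (g w)) :
    μHE[k] (f '' t) ≤ (K : ENNReal) ^ k * μHE[k] (g '' t) := by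
  rcases t.eq_empty_or_nonempty with rfl | ⟨y0, hy0⟩
  · simp
  have : Nonempty T := ⟨y0⟩
  set φ := f ∘ Function.invFunOn g t with hφ
  have hmem : ∀ y ∈ t, Function.invFunOn g t (g y) ∈ t := fun y hy =>
    Function.invFunOn_mem (mem_image_of_mem g hy)
  have heq : ∀ y ∈ t, g (Function.invFunOn g t (g y)) = g y := fun y hy =>
    Function.invFunOn_eq (mem_image_of_mem g hy)
  have hφg : ∀ y ∈ t, φ (g y) = f y := by
    intro y hy
    have := hfg _ (hmem y hy) y hy
    rw [heq y hy, dist_self, mul_zero] at this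
    exact dist_le_zero.1 this
  have hlip : LipschitzOnWith K φ (g '' t) := by
    refine LipschitzOnWith.of_dist_le_mul ?_
    rintro _ ⟨y, hy, rfl⟩ _ ⟨w, hw, rfl⟩
    rw [hφg y hy, hφg w hw]
    exact hfg y hy w hw
  have himg : φ '' (g '' t) = f '' t := by
    rw [image_image]
    exact image_congr hφg
  rw [← himg]
  exact euclideanHausdorffMeasure_image_le hlip k

/-- Where a map is close to a linear map with nontrivial kernel, it shrinks volume: the kernel
direction can be compressed by the factor `δ` before the map stops being Lipschitz. -/
lemma euclideanHausdorffMeasure_image_le_of_not_injective {d : ℕ} {F : Space d → SpaceTime d}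
    {A : Space d →L[ℝ] SpaceTime d} (hA : ¬ Function.Injective A) {t : Set (Space d)} {δ : NNReal}
    (hδ1 : δ ≤ 1) (hF : ApproximatesLinearOn F A t δ) :
    μHE[d] (F '' t) ≤ ((‖A‖₊ + 1 : NNReal) : ENNReal) ^ d * (δ * volume t) := by
  obtain ⟨w, hw0, hAw⟩ : ∃ w : Space d, w ≠ 0 ∧ A w = 0 := by
    rw [injective_iff_map_eq_zero] at hA
    push Not at hA
    obtain ⟨w, h1, h2⟩ := hA
    exact ⟨w, h2, h1⟩
  -- `Lδ` compresses the unit vector `k` of the kernel by the factor `δ` and fixes `kᗮ`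
  set k : Space d := ‖w‖⁻¹ • w with hk
  have hknorm : ‖k‖ = 1 := by
    rw [hk, norm_smul, norm_inv, norm_norm, inv_mul_cancel₀ (norm_ne_zero_iff.2 hw0)]
  have hAk : A k = 0 := by rw [hk, map_smul, hAw, smul_zero]
  set Lδ : Space d →ₗ[ℝ] Space d :=
    LinearMap.transvection (((δ : ℝ) - 1) • (innerSL ℝ k : Space d →L[ℝ] ℝ).toLinearMap) k with hL
  have hLapp : ∀ y, Lδ y = y + (((δ : ℝ) - 1) * ⟪k, y⟫_ℝ) • k := by
    intro y; simp [hL, LinearMap.transvection.apply]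
  have hdet : LinearMap.det Lδ = δ := by
    rw [hL, LinearMap.transvection.det]
    simp [hknorm]
  have hvol : volume (Lδ '' t) = δ * volume t := by
    rw [Measure.addHaar_image_linearMap, hdet, abs_of_nonneg (NNReal.coe_nonneg δ),
      ENNReal.ofReal_coe_nnreal]
  rw [← hvol, ← EuclideanSpace.euclideanHausdorffMeasure_eq_volume]
  refine euclideanHausdorffMeasure_image_le_of_dist_le d fun y hy y' hy' => ?_
  have h1 := hF y hy y' hy'
  have h2 : A (Lδ (y - y')) = A (y - y') := by
    rw [hLapp, map_add, map_smul, hAk, smul_zero, add_zero]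
  have h3 : δ * ‖y - y'‖ ≤ ‖Lδ (y - y')‖ := by
    refine le_of_sq_le_sq ?_ (norm_nonneg _)
    rw [hLapp, norm_add_sq_real, norm_smul, hknorm, inner_smul_right,
      real_inner_comm k (y - y'), mul_pow,
      Real.norm_eq_abs, mul_one, sq_abs]
    have hcs : ⟪k, y - y'⟫_ℝ ^ 2 ≤ ‖y - y'‖ ^ 2 := by
      have := abs_real_inner_le_norm k (y - y')
      rw [hknorm, one_mul] at this
      exact sq_le_sq' (by have := neg_abs_le ⟪k, y - y'⟫_ℝ; linarith) ((le_abs_self _).trans this)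
    have hδ : (δ : ℝ) ^ 2 ≤ 1 := by
      have : (δ : ℝ) ≤ 1 := by exact_mod_cast hδ1
      have := δ.2
      exact pow_le_one₀ this ‹_›
    nlinarith [mul_nonneg (sub_nonneg.2 hδ) (sub_nonneg.2 hcs)]
  rw [dist_eq_norm, dist_eq_norm, ← map_sub]
  calc ‖F y - F y'‖ = ‖(F y - F y' - A (y - y')) + A (Lδ (y - y'))‖ := by rw [h2]; congr 1; abel
    _ ≤ δ * ‖y - y'‖ + ‖A‖ * ‖Lδ (y - y')‖ :=
      (norm_add_le _ _).trans (add_le_add h1 (A.le_opNorm _))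
    _ ≤ ‖Lδ (y - y')‖ + ‖A‖ * ‖Lδ (y - y')‖ := by gcongr
    _ = _ := by push_cast; ring

/-- The critical values of a map into one dimension more are negligible for the Hausdorff measure
of the dimension of the source. -/
lemma euclideanHausdorffMeasure_image_critical_eq_zero {d : ℕ} {F : Space d → SpaceTime d} :
    μHE[d] (F '' {y | DifferentiableAt ℝ F y ∧ ¬ Function.Injective (fderiv ℝ F y)}) = 0 := by
  set s := {y | DifferentiableAt ℝ F y ∧ ¬ Function.Injective (fderiv ℝ F y)} with hs
  have hcov : F '' s ⊆ ⋃ N : ℕ, F '' (s ∩ Metric.ball 0 N) := by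
    rintro _ ⟨y, hy, rfl⟩
    obtain ⟨N, hN⟩ := exists_nat_gt ‖y‖
    exact mem_iUnion.2 ⟨N, y, ⟨hy, by simpa using hN⟩, rfl⟩
  refine measure_mono_null hcov (measure_iUnion_null fun N => ?_)
  set sN := s ∩ Metric.ball (0 : Space d) N with hsN
  rcases sN.eq_empty_or_nonempty with he | hne
  · simp [he]
  have hfin : volume sN ≠ ⊤ :=
    ((measure_mono inter_subset_right).trans_lt measure_ball_lt_top).ne
  have key : ∀ η : NNReal, 0 < η → η ≤ 1 → μHE[d] (F '' sN) ≤ η * volume sN := by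
    intro η hη hη1
    -- the accuracy `r A` compensates the factor `(‖A‖ + 1) ^ d` in the estimate for noninjective
    -- linear maps
    set r : (Space d →L[ℝ] SpaceTime d) → NNReal := fun A => η / (‖A‖₊ + 1) ^ d with hr
    have hr0 : ∀ A, r A ≠ 0 := fun A => (by positivity : 0 < r A).ne'
    obtain ⟨t, A, htd, htm, htc, hta, htA⟩ :=
      exists_partition_approximatesLinearOn_of_hasFDerivWithinAt F sN (fderiv ℝ F)
        (fun x hx => hx.1.1.hasFDerivAt.hasFDerivWithinAt) r hr0
    have hAn : ∀ i, ¬ Function.Injective (A i) := by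
      intro i
      obtain ⟨y, hy, hAy⟩ := htA hne i
      rw [hAy]; exact hy.1.2
    have hsub : F '' sN ⊆ ⋃ i, F '' (sN ∩ t i) := by
      rw [← image_iUnion, ← inter_iUnion, inter_eq_left.2 htc]
    calc μHE[d] (F '' sN) ≤ ∑' i, μHE[d] (F '' (sN ∩ t i)) :=
          (measure_mono hsub).trans (measure_iUnion_le _)
      _ ≤ ∑' i, η * (volume.restrict sN) (t i) := by
          refine ENNReal.tsum_le_tsum fun i => ?_
          have hri : r (A i) ≤ 1 := by
            rw [hr]
            refine (div_le_self zero_le ?_).trans hη1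
            exact one_le_pow₀ le_add_self
          refine (euclideanHausdorffMeasure_image_le_of_not_injective (hAn i) hri (hta i)).trans ?_
          rw [← mul_assoc, Measure.restrict_apply (htm i), inter_comm sN]
          refine mul_le_mul_left (le_of_eq ?_) _
          rw [← ENNReal.coe_pow, ← ENNReal.coe_mul, hr]
          congr 1
          exact mul_div_cancel₀ _ (by positivity)
      _ = η * (volume.restrict sN) (⋃ i, t i) := by
          rw [ENNReal.tsum_mul_left, measure_iUnion htd htm]
      _ ≤ η * volume sN := by
          refine mul_le_mul_right ?_ _
          exact (measure_mono (subset_univ _)).trans (Measure.restrict_apply_univ _).le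
  have hlim : Tendsto (fun η : NNReal => (η : ENNReal) * volume sN) (𝓝[>] 0) (𝓝 0) := by
    have h1 : Tendsto (fun η : NNReal => (η : ENNReal)) (𝓝[>] 0) (𝓝 0) := by
      have := (ENNReal.continuous_coe.tendsto (0 : NNReal)).mono_left
        (nhdsWithin_le_nhds (s := Ioi 0))
      simpa using this
    simpa using ENNReal.Tendsto.mul_const h1 (Or.inr hfin)
  refine le_antisymm (ge_of_tendsto hlim ?_) zero_le
  filter_upwards [Ioc_mem_nhdsGT (show (0 : NNReal) < 1 from one_pos)] with η hη
  exact key η hη.1 hη.2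

/-- A set whose points are related by an inequality of graph type lies in a Lipschitz graph. -/
lemma subset_range_graphMap {d : ℕ} (L : SpaceTime d ≃ₗᵢ[ℝ] SpaceTime d) {E : Set (SpaceTime d)}
    {ε : NNReal}
    (hE : ∀ z ∈ E, ∀ w ∈ E,
      |L.symm (z - w) 0| ≤ ε * ‖graphProj L z - graphProj L w‖) :
    ∃ h : Space d → ℝ, LipschitzWith ε h ∧ E ⊆ range (graphMap L h) := by
  set h0 : Space d → ℝ := fun p => L.symm (Function.invFunOn (graphProj L) E p) 0 with hh0
  have hmem : ∀ z ∈ E, Function.invFunOn (graphProj L) E (graphProj L z) ∈ E := fun z hz =>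
    Function.invFunOn_mem (mem_image_of_mem _ hz)
  have heq : ∀ z ∈ E, graphProj L (Function.invFunOn (graphProj L) E (graphProj L z))
      = graphProj L z := fun z hz => Function.invFunOn_eq (mem_image_of_mem _ hz)
  have hval : ∀ z ∈ E, h0 (graphProj L z) = L.symm z 0 := by
    intro z hz
    have := hE _ (hmem z hz) z hz
    rw [heq z hz, sub_self, norm_zero, mul_zero] at this
    have h1 := abs_nonpos_iff.1 this
    rw [map_sub, PiLp.sub_apply] at h1
    rw [hh0]; linarith
  have hlip : LipschitzOnWith ε h0 (graphProj L '' E) := by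
    refine LipschitzOnWith.of_dist_le_mul ?_
    rintro _ ⟨z, hz, rfl⟩ _ ⟨w, hw, rfl⟩
    rw [hval z hz, hval w hw, Real.dist_eq, dist_eq_norm]
    have := hE z hz w hw
    rwa [map_sub, PiLp.sub_apply] at this
  obtain ⟨h, hh, heqOn⟩ := hlip.extend_real
  refine ⟨h, hh, fun z hz => ⟨graphProj L z, ?_⟩⟩
  rw [graphMap, ← heqOn (mem_image_of_mem _ hz), hval z hz, graphProj, stack_spacePart,
    L.apply_symm_apply]

/-- Where a map is close to an injective linear map, its image lies in a Lipschitz graph over the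
range of the linear map. -/
lemma exists_graph_of_approximatesLinearOn {d : ℕ} {F : Space d → SpaceTime d}
    {A : Space d →L[ℝ] SpaceTime d} {K : NNReal} (hA : AntilipschitzWith K A) (hK : 0 < K)
    {ε : NNReal} (hε : ε ≤ 1) {t : Set (Space d)}
    (hF : ApproximatesLinearOn F A t (ε / (2 * K))) :
    ∃ (L : SpaceTime d ≃ₗᵢ[ℝ] SpaceTime d) (h : Space d → ℝ),
      LipschitzWith ε h ∧ F '' t ⊆ range (graphMap L h) := by
  obtain ⟨e, he, heA⟩ : ∃ e : SpaceTime d, ‖e‖ = 1 ∧ ∀ w, ⟪A w, e⟫_ℝ = 0 := by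
    have hne : (LinearMap.range A.toLinearMap)ᗮ ≠ ⊥ := by
      rw [Ne, Submodule.orthogonal_eq_bot_iff]
      intro htop
      have h1 := LinearMap.finrank_range_le A.toLinearMap
      rw [htop, finrank_top] at h1
      simp at h1
    obtain ⟨v, hv, hv0⟩ := (Submodule.ne_bot_iff _).1 hne
    refine ⟨‖v‖⁻¹ • v, ?_, fun w => ?_⟩
    · rw [norm_smul, norm_inv, norm_norm, inv_mul_cancel₀ (norm_ne_zero_iff.2 hv0)]
    · rw [inner_smul_right, (Submodule.mem_orthogonal _ v).1 hv (A w) ⟨w, rfl⟩, mul_zero]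
  obtain ⟨L, hL⟩ := exists_isometry_map_single e he
  refine ⟨L, subset_range_graphMap L ?_⟩
  rintro _ ⟨y, hy, rfl⟩ _ ⟨w, hw, rfl⟩
  set D := F y - F w with hD
  set a := A (y - w) with ha
  have h1 : ‖D - a‖ ≤ ε / 2 * ‖a‖ := by
    have h2 := hF y hy w hw
    have h3 := hA.le_mul_dist y w
    rw [dist_eq_norm, dist_eq_norm, ← map_sub] at h3
    refine h2.trans ?_
    have hK' : (0 : ℝ) < K := hK
    have hε' : (0 : ℝ) ≤ ε := ε.2
    push_cast
    calc (ε : ℝ) / (2 * K) * ‖y - w‖ ≤ ε / (2 * K) * (K * ‖a‖) := by gcongr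
      _ = ε / 2 * ‖a‖ := by field_simp
  have hε' : (ε : ℝ) ≤ 1 := by exact_mod_cast hε
  have hε0 : (0 : ℝ) ≤ ε := ε.2
  have h0 : L.symm a 0 = 0 := by rw [isometry_symm_apply_zero, hL, ha, heA]
  have hproj : graphProj L (F y) - graphProj L (F w) = spacePart (L.symm D) := by
    rw [graphProj, graphProj, ← spacePart_sub, ← map_sub]
  have hheight : |L.symm D 0| ≤ ε / 2 * ‖a‖ := by
    have : L.symm D 0 = L.symm (D - a) 0 := by
      rw [map_sub L.symm D a, PiLp.sub_apply, h0, sub_zero]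
    rw [this]
    refine le_trans ?_ h1
    rw [← L.symm.norm_map (D - a), ← Real.norm_eq_abs]
    exact PiLp.norm_apply_le _ _
  have hspace : ‖a‖ ≤ 2 * ‖spacePart (L.symm D)‖ := by
    have h3 : ‖spacePart (L.symm a)‖ = ‖a‖ := by
      rw [← L.symm.norm_map a, ← sq_eq_sq₀ (norm_nonneg _) (norm_nonneg _), norm_sq_eq_coord, h0]
      simp
    have h4 : ‖spacePart (L.symm D) - spacePart (L.symm a)‖ ≤ ε / 2 * ‖a‖ := by
      rw [← spacePart_sub, ← map_sub]
      exact (norm_spacePart_le _).trans ((L.symm.norm_map _).le.trans h1)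
    have h5 := norm_sub_norm_le (spacePart (L.symm a)) (spacePart (L.symm D))
    rw [norm_sub_rev, h3] at h5
    nlinarith [norm_nonneg a]
  rw [hproj]
  calc |L.symm D 0| ≤ ε / 2 * ‖a‖ := hheight
    _ ≤ ε / 2 * (2 * ‖spacePart (L.symm D)‖) := by gcongr
    _ = _ := by ring

lemma euclideanHausdorffMeasure_image_eq_zero_of_volume_eq_zero {d : ℕ} {C : NNReal}
    {F : Space d → SpaceTime d} (hF : LipschitzWith C F) {t : Set (Space d)} (ht : volume t = 0) :
    μHE[d] (F '' t) = 0 := by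
  have := euclideanHausdorffMeasure_image_le (hF.lipschitzOnWith (s := t)) d
  rw [EuclideanSpace.euclideanHausdorffMeasure_eq_volume, ht, mul_zero] at this
  exact le_antisymm this zero_le

/-- By Rademacher's theorem and the estimate for critical values, only the points where a Lipschitz
map is an immersion matter for its image. -/
lemma euclideanHausdorffMeasure_image_not_immersed_eq_zero {d : ℕ} {C : NNReal}
    {F : Space d → SpaceTime d} (hF : LipschitzWith C F) :
    μHE[d] (F '' {y | ¬(DifferentiableAt ℝ F y ∧ Function.Injective (fderiv ℝ F y))}) = 0 := by
  have hsub : F '' {y | ¬(DifferentiableAt ℝ F y ∧ Function.Injective (fderiv ℝ F y))}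
      ⊆ F '' {y | ¬DifferentiableAt ℝ F y}
        ∪ F '' {y | DifferentiableAt ℝ F y ∧ ¬ Function.Injective (fderiv ℝ F y)} := by
    rw [← image_union]
    refine image_mono fun y hy => ?_
    rw [mem_ofPred_eq, not_and] at hy
    by_cases h : DifferentiableAt ℝ F y
    · exact Or.inr ⟨h, hy h⟩
    · exact Or.inl h
  refine measure_mono_null hsub (measure_union_null ?_
    euclideanHausdorffMeasure_image_critical_eq_zero)
  exact euclideanHausdorffMeasure_image_eq_zero_of_volume_eq_zero hF
    (ae_iff.1 (hF.ae_differentiableAt (μ := volume)))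

/-- Almost all of a Lipschitz image of `ℝᵈ` is covered by countably many graphs, in varying
directions, of functions with Lipschitz constant as small as desired. -/
lemma LipschitzWith.exists_graph_cover {d : ℕ} {C : NNReal} {F : Space d → SpaceTime d}
    (hF : LipschitzWith C F) {ε : NNReal} (hε0 : 0 < ε) (hε : ε ≤ 1) :
    ∃ (L : ℕ → SpaceTime d ≃ₗᵢ[ℝ] SpaceTime d) (h : ℕ → Space d → ℝ),
      (∀ j, LipschitzWith ε (h j)) ∧
      μHE[d] (range F \ ⋃ j, range (graphMap (L j) (h j))) = 0 := by
  set s := {y | DifferentiableAt ℝ F y ∧ Function.Injective (fderiv ℝ F y)} with hs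
  have hbad : μHE[d] (F '' sᶜ) = 0 := euclideanHausdorffMeasure_image_not_immersed_eq_zero hF
  suffices H : ∃ (L : ℕ → SpaceTime d ≃ₗᵢ[ℝ] SpaceTime d) (h : ℕ → Space d → ℝ),
      (∀ j, LipschitzWith ε (h j)) ∧ F '' s ⊆ ⋃ j, range (graphMap (L j) (h j)) by
    obtain ⟨L, h, hh, hsub⟩ := H
    refine ⟨L, h, hh, measure_mono_null ?_ hbad⟩
    rintro _ ⟨⟨y, rfl⟩, hy⟩
    exact ⟨y, fun hys => hy (hsub ⟨y, hys, rfl⟩), rfl⟩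
  rcases s.eq_empty_or_nonempty with he | hne
  · exact ⟨fun _ => LinearIsometryEquiv.refl ℝ _, fun _ _ => 0, fun _ => LipschitzWith.const' 0,
      by simp [he]⟩
  have hanti : ∀ A : Space d →L[ℝ] SpaceTime d, Function.Injective A →
      ∃ K : NNReal, 0 < K ∧ AntilipschitzWith K A := by
    intro A hA
    obtain ⟨K, hK, h⟩ := A.toLinearMap.exists_antilipschitzWith (LinearMap.ker_eq_bot.2 hA)
    exact ⟨K, hK, h⟩
  choose! K hK0 hK using hanti
  classical
  set r : (Space d →L[ℝ] SpaceTime d) → NNReal :=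
    fun A => if Function.Injective A then ε / (2 * K A) else 1 with hr
  -- the value `1` is never used: the approximating maps are derivatives at points of `s`
  have hr0 : ∀ A, r A ≠ 0 := by
    intro A
    rw [hr]
    dsimp only
    split_ifs with hA
    · have := hK0 A hA
      exact (by positivity : 0 < ε / (2 * K A)).ne'
    · exact one_ne_zero
  obtain ⟨t, A, -, -, htc, hta, htA⟩ := exists_partition_approximatesLinearOn_of_hasFDerivWithinAt
    F s (fderiv ℝ F) (fun x hx => hx.1.hasFDerivAt.hasFDerivWithinAt) r hr0
  have hinj : ∀ i, Function.Injective (A i) := by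
    intro i
    obtain ⟨y, hy, hAy⟩ := htA hne i
    rw [hAy]; exact hy.2
  have hgr : ∀ i, ∃ (L : SpaceTime d ≃ₗᵢ[ℝ] SpaceTime d) (h : Space d → ℝ),
      LipschitzWith ε h ∧ F '' (s ∩ t i) ⊆ range (graphMap L h) := by
    intro i
    refine exists_graph_of_approximatesLinearOn (hK _ (hinj i)) (hK0 _ (hinj i)) hε ?_
    have := hta i
    simp only [hr, if_pos (hinj i)] at this
    exact this
  choose L h hh hsub using hgr
  refine ⟨L, h, hh, ?_⟩
  rintro _ ⟨y, hy, rfl⟩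
  obtain ⟨i, hi⟩ := mem_iUnion.1 (htc hy)
  exact mem_iUnion.2 ⟨i, hsub i ⟨y, ⟨hy, hi⟩, rfl⟩⟩

lemma IsRectifiableSet.exists_graph_cover {d : ℕ} {S : Set (SpaceTime d)} (hS : IsRectifiableSet S)
    {ε : NNReal} (hε0 : 0 < ε) (hε : ε ≤ 1) :
    ∃ (L : ℕ → ℕ → SpaceTime d ≃ₗᵢ[ℝ] SpaceTime d) (h : ℕ → ℕ → Space d → ℝ),
      (∀ i j, LipschitzWith ε (h i j)) ∧
      μHE[d] (S \ ⋃ i, ⋃ j, range (graphMap (L i j) (h i j))) = 0 := by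
  obtain ⟨F, hF, hnull⟩ := hS.cover
  choose C hC using hF
  choose L h hh hcov using fun i => LipschitzWith.exists_graph_cover (hC i) hε0 hε
  refine ⟨L, h, hh, measure_mono_null ?_ (measure_union_null hnull (measure_iUnion_null hcov))⟩
  rintro x ⟨hxS, hx⟩
  by_cases hxF : x ∈ ⋃ i, range (F i)
  · obtain ⟨i, hi⟩ := mem_iUnion.1 hxF
    refine Or.inr (mem_iUnion.2 ⟨i, hi, fun hx' => hx (mem_iUnion.2 ⟨i, hx'⟩)⟩)
  · exact Or.inl ⟨hxS, hxF⟩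

/-! ### Absolute continuity with respect to Hausdorff measure -/

lemma hausdorffMeasure_eq_zero_of_euclidean {X : Type*} [EMetricSpace X] [MeasurableSpace X]
    [BorelSpace X] {k : ℕ} {A : Set X} (h : μHE[k] A = 0) : μH[k] A = 0 := by
  rw [Measure.euclideanHausdorffMeasure_def, Measure.smul_apply, ENNReal.smul_def, smul_eq_mul,
    mul_eq_zero] at h
  rcases h with h | h
  · rw [ENNReal.coe_eq_zero] at h
    exact absurd h (Measure.addHaarScalarFactor_volume_hausdorffMeasure_ne_zero k)
  · exact h

lemma volume_eq_zero_of_euclideanHausdorffMeasure_eq_zero {d : ℕ} {A : Set (SpaceTime d)}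
    (h : μHE[d] A = 0) : volume A = 0 := by
  rw [← EuclideanSpace.euclideanHausdorffMeasure_eq_volume]
  rcases Measure.euclideanHausdorffMeasure_zero_or_top (Nat.lt_succ_self d) A with h' | h'
  · exact h'
  · rw [h] at h'; simp at h'

/-- A compact set of vanishing `d`-dimensional measure has finite covers by small balls for which
the sum of the `d`-th powers of the radii is small. -/
lemma exists_finite_ball_cover {d : ℕ} {K : Set (SpaceTime d)} (hK : IsCompact K)
    (h0 : μHE[d] K = 0) {η δ : ℝ} (hη : 0 < η) (hδ : 0 < δ) :
    ∃ I : Finset (SpaceTime d × ℝ), (∀ i ∈ I, i.1 ∈ K ∧ 0 < i.2 ∧ i.2 < δ) ∧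
      K ⊆ ⋃ i ∈ I, Metric.ball i.1 i.2 ∧ ∑ i ∈ I, i.2 ^ d ≤ η := by
  have hH := hausdorffMeasure_eq_zero_of_euclidean h0
  set η' : ENNReal := ENNReal.ofReal η / 2 with hη'
  have hη'0 : η' ≠ 0 := (ENNReal.half_pos (by simpa using hη)).ne'
  rw [Measure.hausdorffMeasure_apply, ENNReal.iSup_eq_zero] at hH
  have h1 := hH (ENNReal.ofReal (δ / 2))
  rw [ENNReal.iSup_eq_zero] at h1
  have h2 := (h1 (by simpa using half_pos hδ)).trans_lt (pos_iff_ne_zero.2 hη'0)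
  simp only [iInf_lt_iff] at h2
  obtain ⟨t, htK, htd, hsum⟩ := h2
  obtain ⟨ε, hε0, hεsum⟩ := ENNReal.exists_pos_sum_of_countable hη'0 ℕ
  have hball : ∀ n : {n // (t n ∩ K).Nonempty}, ∃ p : SpaceTime d × ℝ, p.1 ∈ K ∧ 0 < p.2 ∧
      p.2 < δ ∧ t n ⊆ Metric.ball p.1 p.2 ∧
      ENNReal.ofReal (p.2 ^ d) ≤ (⨆ _ : (t n).Nonempty, Metric.ediam (t n) ^ (d : ℝ)) + ε n := by
    rintro ⟨n, x, hxt, hxK⟩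
    have hfin : Metric.ediam (t n) ≠ ⊤ := ((htd n).trans_lt ENNReal.ofReal_lt_top).ne
    set D := (Metric.ediam (t n)).toReal with hD
    have hD0 : 0 ≤ D := ENNReal.toReal_nonneg
    have hDδ : D < δ := by
      have : D ≤ δ / 2 := ENNReal.toReal_le_of_le_ofReal (half_pos hδ).le (htd n)
      linarith
    have hne : (t n).Nonempty := ⟨x, hxt⟩
    have hlim : Tendsto (fun r : ℝ => ENNReal.ofReal (r ^ d)) (𝓝[>] D)
        (𝓝 (ENNReal.ofReal (D ^ d))) :=
      (ENNReal.continuous_ofReal.comp (continuous_pow d)).tendsto D |>.mono_left nhdsWithin_le_nhds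
    have hDd : ENNReal.ofReal (D ^ d) = Metric.ediam (t n) ^ (d : ℝ) := by
      rw [ENNReal.rpow_natCast, ENNReal.ofReal_pow hD0, hD, ENNReal.ofReal_toReal hfin]
    have hlt : ENNReal.ofReal (D ^ d) < ENNReal.ofReal (D ^ d) + ε n :=
      ENNReal.lt_add_right ENNReal.ofReal_ne_top (by simpa using (hε0 n).ne')
    obtain ⟨r, hr1, hr2, hr3⟩ := ((hlim.eventually (gt_mem_nhds hlt)).and
      (Ioo_mem_nhdsGT hDδ)).exists
    refine ⟨(x, r), hxK, hD0.trans_lt hr2, hr3, fun z hz => ?_, ?_⟩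
    · have h3 := Metric.edist_le_ediam_of_mem hz hxt
      rw [edist_dist, ENNReal.ofReal_le_iff_le_toReal hfin] at h3
      exact lt_of_le_of_lt h3 hr2
    · rw [iSup_pos hne, ← hDd]
      exact hr1.le
  choose p hpK hp0 hpδ hpt hps using hball
  obtain ⟨J, hJ⟩ := hK.elim_finite_subcover (fun n => Metric.ball (p n).1 (p n).2)
    (fun n => Metric.isOpen_ball) (fun x hx => by
      obtain ⟨n, hn⟩ := mem_iUnion.1 (htK hx)
      exact mem_iUnion.2 ⟨⟨n, x, hn, hx⟩, hpt ⟨n, x, hn, hx⟩ hn⟩)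
  classical
  refine ⟨J.image p, ?_, ?_, ?_⟩
  · intro i hi
    obtain ⟨n, -, rfl⟩ := Finset.mem_image.1 hi
    exact ⟨hpK n, hp0 n, hpδ n⟩
  · intro x hx
    obtain ⟨n, hn, hxn⟩ := mem_iUnion₂.1 (hJ hx)
    exact mem_iUnion₂.2 ⟨p n, Finset.mem_image_of_mem p hn, hxn⟩
  · have hle : ∑ i ∈ J.image p, i.2 ^ d ≤ ∑ n ∈ J, (p n).2 ^ d :=
      Finset.sum_image_le_of_nonneg fun i hi => by
        obtain ⟨n, -, rfl⟩ := Finset.mem_image.1 hi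
        exact pow_nonneg (hp0 n).le d
    refine hle.trans ?_
    rw [← ENNReal.ofReal_le_ofReal_iff hη.le,
      ENNReal.ofReal_sum_of_nonneg (fun n _ => pow_nonneg (hp0 n).le d)]
    calc ∑ n ∈ J, ENNReal.ofReal ((p n).2 ^ d)
        ≤ ∑ n ∈ J, ((⨆ _ : (t n).Nonempty, Metric.ediam (t n) ^ (d : ℝ)) + ε n) :=
          Finset.sum_le_sum fun n _ => hps n
      _ ≤ ∑' n : {n // (t n ∩ K).Nonempty},
            ((⨆ _ : (t n).Nonempty, Metric.ediam (t n) ^ (d : ℝ)) + ε n) := ENNReal.sum_le_tsum _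
      _ ≤ ∑' n, ((⨆ _ : (t n).Nonempty, Metric.ediam (t n) ^ (d : ℝ)) + (ε n : ENNReal)) :=
          ENNReal.tsum_comp_le_tsum_of_injective Subtype.val_injective
            (fun n => (⨆ _ : (t n).Nonempty, Metric.ediam (t n) ^ (d : ℝ)) + (ε n : ENNReal))
      _ ≤ η' + η' := by
          rw [ENNReal.tsum_add]
          exact add_le_add hsum.le hεsum.le
      _ = ENNReal.ofReal η := ENNReal.add_halves _

/-- A smooth substitute for the indicator of a finite union of balls, whose gradient is controlled
by the sum of the gradients of the single bumps: `1 - ∏ (1 - φᵢ)`. -/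
lemma exists_smooth_union_bump {d : ℕ} (I : Finset (SpaceTime d × ℝ)) (hI : ∀ i ∈ I, 0 < i.2) :
    ∃ φ : SpaceTime d → ℝ, ContDiff ℝ ∞ φ ∧ (∀ z, 0 ≤ φ z ∧ φ z ≤ 1) ∧
      (∀ z, φ z ≠ 0 → ∃ i ∈ I, z ∈ Metric.closedBall i.1 (2 * i.2)) ∧
      (∀ i ∈ I, ∀ z ∈ Metric.ball i.1 i.2, Real.smoothTransition (3 / 4) ≤ φ z) ∧
      ∀ z, ‖fderiv ℝ φ z‖ ≤ ∑ i ∈ I, ‖fderiv ℝ (bumpAt i.1 (2 * i.2)) z‖ := by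
  classical
  induction I using Finset.induction_on with
  | empty => exact ⟨fun _ => 0, contDiff_const, by simp, by simp, by simp, by simp⟩
  | insert j I hj ih =>
    obtain ⟨φ, h1, h2, h3, h4, h5⟩ := ih fun i hi => hI i (Finset.mem_insert_of_mem hi)
    have hj0 : 0 < j.2 := hI j (Finset.mem_insert_self j I)
    set b := bumpAt j.1 (2 * j.2) with hb
    have hb0 : ∀ z, 0 ≤ b z := bumpAt_nonneg _ _
    have hb1 : ∀ z, b z ≤ 1 := bumpAt_le_one _ _
    have hbc : ContDiff ℝ ∞ b := contDiff_bumpAt _ _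
    refine ⟨fun z => 1 - (1 - b z) * (1 - φ z), by fun_prop, fun z => ?_, fun z hz => ?_,
      fun i hi z hz => ?_, fun z => ?_⟩
    · have := h2 z
      constructor <;>
        nlinarith [hb0 z, hb1 z, mul_nonneg (sub_nonneg.2 (hb1 z)) (sub_nonneg.2 this.2)]
    · by_cases hbz : b z = 0
      · by_cases hφz : φ z = 0
        · simp [hbz, hφz] at hz
        · obtain ⟨i, hi, hzi⟩ := h3 z hφz
          exact ⟨i, Finset.mem_insert_of_mem hi, hzi⟩
      · exact ⟨j, Finset.mem_insert_self j I, support_bumpAt_subset _ (by positivity) hbz⟩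
    · rcases Finset.mem_insert.1 hi with rfl | hi
      · have hbz : Real.smoothTransition (3 / 4) ≤ b z := by
          refine Real.smoothTransition.monotone ?_
          rw [norm_smul, norm_inv, Real.norm_of_nonneg (by positivity : 0 ≤ 2 * i.2)]
          rw [Metric.mem_ball, dist_eq_norm] at hz
          have : (2 * i.2)⁻¹ * ‖z - i.1‖ ≤ 1 / 2 := by
            rw [inv_mul_le_iff₀ (by positivity)]; linarith
          have h0 : 0 ≤ (2 * i.2)⁻¹ * ‖z - i.1‖ := by positivity
          nlinarith
        nlinarith [h2 z, hb1 z, mul_nonneg (sub_nonneg.2 (hb1 z)) (h2 z).1]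
      · have := h4 i hi z hz
        nlinarith [h2 z, hb0 z, mul_nonneg (hb0 z) (sub_nonneg.2 (h2 z).2)]
    · have hd1 : DifferentiableAt ℝ b z := hbc.differentiable (by simp) z
      have hd2 : DifferentiableAt ℝ φ z := h1.differentiable (by simp) z
      have hf := ((hd1.hasFDerivAt.const_sub 1).mul (hd2.hasFDerivAt.const_sub 1)).const_sub 1
      have hf' : fderiv ℝ (fun z => 1 - (1 - b z) * (1 - φ z)) z
          = (1 - b z) • fderiv ℝ φ z + (1 - φ z) • fderiv ℝ b z := by
        refine HasFDerivAt.fderiv ?_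
        have : (1 - b z) • fderiv ℝ φ z + (1 - φ z) • fderiv ℝ b z
            = -((1 - b z) • -fderiv ℝ φ z + (1 - φ z) • -fderiv ℝ b z) := by
          ext v; simp; ring
        rw [this]
        exact hf
      rw [Finset.sum_insert hj]
      refine (congrArg norm hf').le.trans ((norm_add_le _ _).trans
        ((add_le_add ?_ ?_).trans (add_comm _ _).le))
      rotate_left
      · rw [norm_smul, Real.norm_of_nonneg (by linarith [(h2 z).2])]
        exact mul_le_of_le_one_left (norm_nonneg _) (by linarith [(h2 z).1])
      · rw [norm_smul, Real.norm_of_nonneg (by linarith [hb1 z])]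
        exact (mul_le_of_le_one_left (norm_nonneg _) (by linarith [hb0 z])).trans (h5 z)

lemma norm_fderiv_bumpAt {d : ℕ} (x : SpaceTime d) {r : ℝ} (hr : 0 < r) (z : SpaceTime d) :
    ‖fderiv ℝ (bumpAt x r) z‖ = r⁻¹ * ‖fderiv ℝ radialBump (r⁻¹ • (z - x))‖ := by
  have : fderiv ℝ (bumpAt x r) z = r⁻¹ • fderiv ℝ radialBump (r⁻¹ • (z - x)) := by
    ext v; rw [fderiv_bumpAt]; rfl
  rw [this, norm_smul, norm_inv, Real.norm_of_nonneg hr.le]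

lemma integral_norm_fderiv_bumpAt {d : ℕ} (x : SpaceTime d) {r : ℝ} (hr : 0 < r) :
    ∫ z, ‖fderiv ℝ (bumpAt x r) z‖
      = r ^ d * ∫ z : SpaceTime d, ‖fderiv ℝ (radialBump : SpaceTime d → ℝ) z‖ := by
  simp only [norm_fderiv_bumpAt x hr]
  rw [integral_const_mul, integral_sub_right_eq_self
    (fun z => ‖fderiv ℝ (radialBump : SpaceTime d → ℝ) (r⁻¹ • z)‖) x,
    Measure.integral_comp_smul_of_nonneg _ (fun z => ‖fderiv ℝ (radialBump : SpaceTime d → ℝ) z‖)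
      r⁻¹ (hR := by positivity)]
  simp only [finrank_euclideanSpace, Fintype.card_fin, smul_eq_mul, inv_pow, inv_inv]
  field_simp
  ring

lemma integrable_norm_fderiv_of_isTestFunction {d : ℕ} {Q : Set (SpaceTime d)}
    {φ : SpaceTime d → ℝ} (hφ : IsTestFunction Q φ) : Integrable fun z => ‖fderiv ℝ φ z‖ :=
  ((hφ.smooth.continuous_fderiv (by simp)).integrable_of_hasCompactSupport
    (hφ.compact_support.fderiv ℝ)).norm

lemma integrable_of_continuous_of_support_subset {d : ℕ} {μ : Measure (SpaceTime d)}
    {K : Set (SpaceTime d)} (hK : IsCompact K) (hμ : μ K < ⊤) {φ : SpaceTime d → ℝ}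
    (hφ : Continuous φ) (hs : ∀ z ∉ K, φ z = 0) : Integrable φ μ := by
  have h1 : IntegrableOn φ K μ := by
    obtain ⟨C, hC⟩ := hK.exists_bound_of_continuousOn hφ.continuousOn
    exact Measure.integrableOn_of_bounded hμ.ne hφ.aestronglyMeasurable
      ((ae_restrict_mem hK.measurableSet).mono fun z hz => hC z hz)
  rwa [integrableOn_iff_integrable_of_support_subset] at h1
  intro z hz
  by_contra h
  exact hz (hs z h)

/-- The two measures `pos` and `neg` satisfy `pos - neg = -div Z + s` as distributions on `Q`. -/
def IsBalance {d : ℕ} (Q : Set (SpaceTime d)) (pos neg : Measure (SpaceTime d))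
    (Z : SpaceTime d → SpaceTime d) (s : SpaceTime d → ℝ) : Prop :=
  ∀ φ, IsTestFunction Q φ →
    (∫ z, φ z ∂pos) - (∫ z, φ z ∂neg) = ∫ z in Q, (fderiv ℝ φ z (Z z) + s z * φ z)

section Balance

variable {d : ℕ} {Q : Set (SpaceTime d)} {pos neg : Measure (SpaceTime d)}
  {Z : SpaceTime d → SpaceTime d} {s : SpaceTime d → ℝ} {M : ℝ}

lemma measurable_fderiv_apply {φ : SpaceTime d → ℝ} (hφ : Continuous (fderiv ℝ φ))
    {V : SpaceTime d → SpaceTime d} (hV : Measurable V) :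
    Measurable fun z => fderiv ℝ φ z (V z) := by
  have h1 : Continuous fun p : (SpaceTime d →L[ℝ] ℝ) × SpaceTime d => p.1 p.2 :=
    isBoundedBilinearMap_apply.continuous
  exact h1.measurable.comp (hφ.measurable.prodMk hV)

lemma integrable_fderiv_flux (hZm : Measurable Z) (hZ : ∀ z, ‖Z z‖ ≤ M) {φ : SpaceTime d → ℝ}
    (hφ : IsTestFunction Q φ) : Integrable fun z => fderiv ℝ φ z (Z z) := by
  have hc : Continuous (fderiv ℝ φ) := hφ.smooth.continuous_fderiv (by simp)
  refine ((integrable_norm_fderiv_of_isTestFunction hφ).mul_const M).mono'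
    (measurable_fderiv_apply hc hZm).aestronglyMeasurable (Eventually.of_forall fun z => ?_)
  exact ((fderiv ℝ φ z).le_opNorm _).trans (by gcongr; exact hZ z)

lemma integrable_source_mul (hs : IntegrableOn s Q) {φ : SpaceTime d → ℝ} (hφ : Continuous φ)
    {C : ℝ} (hC : ∀ z, ‖φ z‖ ≤ C) : IntegrableOn (fun z => s z * φ z) Q :=
  Integrable.mul_bdd hs hφ.aestronglyMeasurable (Eventually.of_forall hC)

/-- The positive part of the balance does not charge compact sets that are negligible for
`d`-dimensional measure and for the negative part. -/
lemma IsBalance.measure_compact_eq_zero (hb : IsBalance Q pos neg Z s) (hQ : IsOpen Q)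
    (hpos : ∀ K, IsCompact K → K ⊆ Q → pos K < ⊤) (hneg : ∀ K, IsCompact K → K ⊆ Q → neg K < ⊤)
    (hZm : Measurable Z) (hZ : ∀ z, ‖Z z‖ ≤ M) (hs : IntegrableOn s Q)
    {K : Set (SpaceTime d)} (hK : IsCompact K) (hKQ : K ⊆ Q) (hK0 : μHE[d] K = 0)
    (hKneg : neg K = 0) : pos K = 0 := by
  -- The balance is tested with functions `φ m` that are bounded below on `K` and shrink to it. The
  -- integral of `‖fderiv (φ m)‖` is at most the sum of the `d`-th powers of the radii of a cover
  -- of `K`, up to a factor, so that the flux term vanishes in the limit.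
  have hvol : volume K = 0 := volume_eq_zero_of_euclideanHausdorffMeasure_eq_zero hK0
  have hM : 0 ≤ M := (norm_nonneg _).trans (hZ 0)
  obtain ⟨R, hR, hRQ⟩ := hK.exists_cthickening_subset_open hQ hKQ
  set K1 := Metric.cthickening R K with hK1
  have hK1c : IsCompact K1 := hK.cthickening
  set δ : ℕ → ℝ := fun m => R / 2 / (m + 1) with hδdef
  have hδ : ∀ m, 0 < δ m := fun m => by positivity
  have hδlim : Tendsto δ atTop (𝓝 0) := by
    have := (tendsto_one_div_add_atTop_nhds_zero_nat (𝕜 := ℝ)).const_mul (R / 2)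
    simpa [hδdef, div_eq_mul_inv] using this
  have hδR : ∀ m, 2 * δ m ≤ R := fun m => by
    have : δ m ≤ R / 2 := div_le_self (by positivity) (by
      have : (0 : ℝ) ≤ m := Nat.cast_nonneg m
      linarith)
    linarith
  choose I hI hIK hIs using fun m => exists_finite_ball_cover hK hK0 (hδ m) (hδ m)
  choose φ hφ1 hφ2 hφ3 hφ4 hφ5 using fun m =>
    exists_smooth_union_bump (I m) (fun i hi => (hI m i hi).2.1)
  have hsupp : ∀ m z, φ m z ≠ 0 → z ∈ Metric.cthickening (2 * δ m) K := by
    intro m z hz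
    obtain ⟨i, hi, hzi⟩ := hφ3 m z hz
    refine Metric.mem_cthickening_of_dist_le z i.1 _ K (hI m i hi).1 ?_
    exact (Metric.mem_closedBall.1 hzi).trans (by linarith [(hI m i hi).2.2])
  have hsupp1 : ∀ m z, z ∉ K1 → φ m z = 0 := fun m z hz => by
    by_contra h
    exact hz (Metric.cthickening_mono (hδR m) K (hsupp m z h))
  have hts : ∀ m, tsupport (φ m) ⊆ K1 := fun m =>
    closure_minimal (fun z hz => by by_contra h; exact hz (hsupp1 m z h))
      Metric.isClosed_cthickening
  have htest : ∀ m, IsTestFunction Q (φ m) := fun m =>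
    ⟨hφ1 m, hK1c.of_isClosed_subset (isClosed_tsupport _) (hts m), (hts m).trans hRQ⟩
  have hnorm : ∀ m z, ‖φ m z‖ ≤ 1 := fun m z => by
    rw [Real.norm_of_nonneg (hφ2 m z).1]; exact (hφ2 m z).2
  have hpt : ∀ z ∉ K, Tendsto (fun m => φ m z) atTop (𝓝 0) := by
    intro z hz
    have hpos' : 0 < Metric.infEDist z K := by
      rw [pos_iff_ne_zero]
      intro h0
      exact hz (hK.isClosed.closure_eq ▸ Metric.mem_closure_iff_infEDist_zero.2 h0)
    have hlim : Tendsto (fun m => ENNReal.ofReal (2 * δ m)) atTop (𝓝 0) := by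
      have := ENNReal.tendsto_ofReal (hδlim.const_mul 2)
      simpa using this
    refine tendsto_const_nhds.congr' ?_
    filter_upwards [hlim.eventually (gt_mem_nhds hpos')] with m hm
    by_contra h
    exact absurd (hsupp m z (Ne.symm h)) (not_le.2 hm)
  have hneglim : Tendsto (fun m => ∫ z, φ m z ∂neg) atTop (𝓝 0) := by
    have h := tendsto_integral_of_dominated_convergence (μ := neg) (F := φ) (f := fun _ => 0)
      (K1.indicator fun _ => (1 : ℝ)) (fun m => (hφ1 m).continuous.aestronglyMeasurable)
      ((integrable_indicator_iff hK1c.measurableSet).2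
        (integrableOn_const (hneg K1 hK1c hRQ).ne))
      (fun m => Eventually.of_forall fun z => ?_) ?_
    · simpa using h
    · by_cases hz : z ∈ K1
      · simpa [hz] using hnorm m z
      · simp [hz, hsupp1 m z hz]
    · have : ∀ᵐ z ∂neg, z ∉ K := measure_eq_zero_iff_ae_notMem.1 hKneg
      filter_upwards [this] with z hz using hpt z hz
  have hsrclim : Tendsto (fun m => ∫ z in Q, s z * φ m z) atTop (𝓝 0) := by
    have h := tendsto_integral_of_dominated_convergence (μ := volume.restrict Q)
      (F := fun m z => s z * φ m z) (f := fun _ => 0) (fun z => ‖s z‖)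
      (fun m => (integrable_source_mul hs (hφ1 m).continuous (hnorm m)).1) hs.norm
      (fun m => Eventually.of_forall fun z => ?_) ?_
    · simpa using h
    · rw [norm_mul]; exact mul_le_of_le_one_right (norm_nonneg _) (hnorm m z)
    · have : ∀ᵐ z ∂(volume.restrict Q), z ∉ K :=
        ae_restrict_of_ae (measure_eq_zero_iff_ae_notMem.1 hvol)
      filter_upwards [this] with z hz
      simpa using (hpt z hz).const_mul (s z)
  set C1 := ∫ z : SpaceTime d, ‖fderiv ℝ (radialBump : SpaceTime d → ℝ) z‖ with hC1
  have hC10 : 0 ≤ C1 := integral_nonneg fun z => norm_nonneg _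
  have hflux : ∀ m, ∫ z in Q, fderiv ℝ (φ m) z (Z z) ≤ M * (2 ^ d * C1) * δ m := by
    intro m
    have hbi : ∀ i ∈ I m, Integrable fun z => ‖fderiv ℝ (bumpAt i.1 (2 * i.2)) z‖ := fun i hi =>
      integrable_norm_fderiv_of_isTestFunction
        (isTestFunction_bumpAt (Q := univ) i.1 (by linarith [(hI m i hi).2.1]) (subset_univ _))
    calc ∫ z in Q, fderiv ℝ (φ m) z (Z z) ≤ ∫ z in Q, M * ‖fderiv ℝ (φ m) z‖ := by
          refine integral_mono (integrable_fderiv_flux hZm hZ (htest m)).integrableOn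
            ((integrable_norm_fderiv_of_isTestFunction (htest m)).integrableOn.const_mul M)
            fun z => ?_
          refine (le_abs_self _).trans (((fderiv ℝ (φ m) z).le_opNorm _).trans ?_)
          rw [mul_comm]
          gcongr
          exact hZ z
      _ ≤ ∫ z, M * ‖fderiv ℝ (φ m) z‖ := by
          refine setIntegral_le_integral
            ((integrable_norm_fderiv_of_isTestFunction (htest m)).const_mul M)
            (Eventually.of_forall fun z => by positivity)
      _ ≤ ∫ z, M * ∑ i ∈ I m, ‖fderiv ℝ (bumpAt i.1 (2 * i.2)) z‖ := by
          refine integral_mono ((integrable_norm_fderiv_of_isTestFunction (htest m)).const_mul M)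
            ((integrable_finsetSum _ hbi).const_mul M) fun z => ?_
          exact mul_le_mul_of_nonneg_left (hφ5 m z) hM
      _ = M * ∑ i ∈ I m, (2 * i.2) ^ d * C1 := by
          rw [integral_const_mul, integral_finsetSum _ hbi]
          congr 1
          refine Finset.sum_congr rfl fun i hi => ?_
          exact integral_norm_fderiv_bumpAt _ (by linarith [(hI m i hi).2.1])
      _ = M * (2 ^ d * C1) * ∑ i ∈ I m, i.2 ^ d := by
          rw [Finset.mul_sum, Finset.mul_sum]
          refine Finset.sum_congr rfl fun i _ => ?_
          ring
      _ ≤ M * (2 ^ d * C1) * δ m := by gcongr; exact hIs m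
  set c := Real.smoothTransition (3 / 4) with hc
  have hc0 : 0 < c := Real.smoothTransition.pos_of_pos (by norm_num)
  have hlower : ∀ m, c * (pos K).toReal
      ≤ (∫ z, φ m z ∂neg) + M * (2 ^ d * C1) * δ m + ∫ z in Q, s z * φ m z := by
    intro m
    have h1 : c * (pos K).toReal ≤ ∫ z, φ m z ∂pos := by
      have hi : Integrable (φ m) pos := integrable_of_continuous_of_support_subset hK1c
        (hpos K1 hK1c hRQ) (hφ1 m).continuous (hsupp1 m)
      calc c * (pos K).toReal = ∫ z in K, c ∂pos := by
            rw [setIntegral_const, smul_eq_mul, mul_comm, measureReal_def]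
        _ ≤ ∫ z in K, φ m z ∂pos := by
            refine setIntegral_mono_on (integrableOn_const (hpos K hK hKQ).ne) hi.integrableOn
              hK.measurableSet fun z hz => ?_
            obtain ⟨i, hi, hzi⟩ := mem_iUnion₂.1 (hIK m hz)
            exact hφ4 m i hi z hzi
        _ ≤ ∫ z, φ m z ∂pos :=
            setIntegral_le_integral hi (Eventually.of_forall fun z => (hφ2 m z).1)
    have h2 := hb (φ m) (htest m)
    rw [integral_add (integrable_fderiv_flux hZm hZ (htest m)).integrableOn
      (integrable_source_mul hs (hφ1 m).continuous (hnorm m))] at h2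
    linarith [hflux m]
  have hlim := (hneglim.add (hδlim.const_mul (M * (2 ^ d * C1)))).add hsrclim
  have hle := ge_of_tendsto' hlim hlower
  simp only [mul_zero, add_zero] at hle
  have : (pos K).toReal = 0 := le_antisymm (by nlinarith) ENNReal.toReal_nonneg
  rcases (ENNReal.toReal_eq_zero_iff _).1 this with h | h
  · exact h
  · exact absurd h (hpos K hK hKQ).ne

/-- A measure which is the divergence of a bounded vector field, up to an integrable source, does
not charge sets that are negligible for `d`-dimensional Hausdorff measure. -/
lemma IsBalance.measure_eq_zero (hb : IsBalance Q pos neg Z s) (hQ : IsOpen Q)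
    (hposQ : pos Qᶜ = 0)
    (hpos : ∀ K, IsCompact K → K ⊆ Q → pos K < ⊤) (hneg : ∀ K, IsCompact K → K ⊆ Q → neg K < ⊤)
    (hms : pos ⟂ₘ neg) (hZm : Measurable Z) (hZ : ∀ z, ‖Z z‖ ≤ M) (hs : IntegrableOn s Q)
    {A : Set (SpaceTime d)} (hA : μHE[d] A = 0) : pos A = 0 := by
  obtain ⟨N, hN, hN1, hN2⟩ := hms
  set A' := toMeasurable μHE[d] A with hA'
  have hA'0 : μHE[d] A' = 0 := by rw [hA', measure_toMeasurable, hA]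
  have hA'm : MeasurableSet A' := measurableSet_toMeasurable _ _
  -- `neg` vanishes on `Nᶜ`, and `pos` on `N`; inner regularity reduces to compact sets
  have key : pos (A' ∩ Nᶜ ∩ Q) = 0 := by
    refine measure_null_of_locally_null _ fun x hx => ?_
    obtain ⟨r, hr0, hr⟩ := Metric.nhds_basis_closedBall.mem_iff.1 (hQ.mem_nhds hx.2)
    refine ⟨A' ∩ Nᶜ ∩ Q ∩ Metric.closedBall x r,
      inter_mem_nhdsWithin _ (Metric.closedBall_mem_nhds x hr0), ?_⟩
    set B := Metric.closedBall x r with hB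
    have hBc : IsCompact B := isCompact_closedBall x r
    have : IsFiniteMeasure (pos.restrict B) := ⟨by
      rw [Measure.restrict_apply_univ]; exact hpos B hBc hr⟩
    by_contra hne
    have hm : MeasurableSet (A' ∩ Nᶜ ∩ Q) := (hA'm.inter hN.compl).inter hQ.measurableSet
    have hlt : 0 < (pos.restrict B) (A' ∩ Nᶜ ∩ Q) := by
      rw [Measure.restrict_apply hm]; exact pos_iff_ne_zero.2 hne
    obtain ⟨K, hKsub, hKc, hK0⟩ := hm.exists_lt_isCompact hlt
    rw [Measure.restrict_apply hKc.measurableSet] at hK0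
    refine hK0.ne' (hb.measure_compact_eq_zero hQ hpos hneg hZm hZ hs (hKc.inter hBc)
      (inter_subset_right.trans hr) (measure_mono_null ?_ hA'0) (measure_mono_null ?_ hN2))
    · exact fun z hz => (hKsub hz.1).1.1
    · exact fun z hz => (hKsub hz.1).1.2
  refine measure_mono_null ?_ (measure_union_null (measure_union_null key hN1) hposQ)
  intro z hz
  by_cases hzN : z ∈ N
  · exact Or.inl (Or.inr hzN)
  · by_cases hzQ : z ∈ Q
    · exact Or.inl (Or.inl ⟨⟨subset_toMeasurable _ _ hz, hzN⟩, hzQ⟩)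
    · exact Or.inr hzQ

end Balance

/-! ### Jump formula for divergences on rectifiable sets -/

lemma volume_range_graphMap {d : ℕ} {L : SpaceTime d ≃ₗᵢ[ℝ] SpaceTime d} {h : Space d → ℝ}
    {ε : NNReal} (hh : LipschitzWith ε h) : volume (range (graphMap L h)) = 0 := by
  have hac : (volume : Measure (SpaceTime d)) ≪ μH[((d + 1 : NNReal) : ℝ)] := by
    rw [← EuclideanSpace.euclideanHausdorffMeasure_eq_volume,
      Measure.euclideanHausdorffMeasure_def]
    push_cast
    exact Measure.smul_absolutelyContinuous
  refine measure_zero_of_dimH_lt hac ?_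
  refine ((lipschitzWith_graphMap hh).dimH_range_le).trans_lt ?_
  rw [Real.dimH_univ_eq_finrank]
  simp only [finrank_euclideanSpace, Fintype.card_fin]
  push_cast
  exact_mod_cast Nat.lt_succ_self d

section Balance

variable {d : ℕ} {Q : Set (SpaceTime d)} {pos neg : Measure (SpaceTime d)}
  {Z : SpaceTime d → SpaceTime d} {s : SpaceTime d → ℝ} {M : ℝ}

lemma integrable_fderiv_radialBump_apply {V : SpaceTime d → SpaceTime d} (hV : Measurable V)
    {C : ℝ} (hC : ∀ z, ‖V z‖ ≤ C) : Integrable fun z => fderiv ℝ radialBump z (V z) := by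
  have hi : Integrable fun z => ‖fderiv ℝ (radialBump : SpaceTime d → ℝ) z‖ :=
    (continuous_fderiv_radialBump.integrable_of_hasCompactSupport
      hasCompactSupport_fderiv_radialBump).norm
  refine (hi.mul_const C).mono'
    (measurable_fderiv_apply continuous_fderiv_radialBump hV).aestronglyMeasurable
    (Eventually.of_forall fun z => ?_)
  exact ((fderiv ℝ (radialBump : SpaceTime d → ℝ) z).le_opNorm _).trans (by gcongr; exact hC z)

/-- The pairing of a bounded field with the gradient of a rescaled bump, in the blow up limit. -/
lemma HasBlowUp.tendsto_flux (hQ : IsOpen Q) (hZm : Measurable Z) (hZ : ∀ z, ‖Z z‖ ≤ M)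
    {x n a b : SpaceTime d} (hx : x ∈ Q) (hn : ‖n‖ = 1)
    (hbl : HasBlowUp Z x (jumpProfile n a b)) :
    Tendsto (fun r => (r ^ d)⁻¹ * ∫ z in Q, fderiv ℝ (bumpAt x r) z (Z z)) (𝓝[>] 0)
      (𝓝 (-(bumpMass d * ⟪a - b, n⟫_ℝ))) := by
  rw [← integral_fderiv_jumpProfile n a b hn]
  obtain ⟨C, hC⟩ := (hasCompactSupport_fderiv_radialBump
    (E := SpaceTime d)).exists_bound_of_continuous continuous_fderiv_radialBump
  have hC0 : 0 ≤ C := (norm_nonneg _).trans (hC 0)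
  have hjm : Measurable (jumpProfile n a b) := measurable_jumpProfile n a b
  have hjb : ∀ z, ‖jumpProfile n a b z‖ ≤ max ‖a‖ ‖b‖ := fun z => by
    unfold jumpProfile; split_ifs <;> simp
  have hscale : ∀ r : ℝ, 0 < r → Metric.closedBall x r ⊆ Q →
      (r ^ d)⁻¹ * ∫ z in Q, fderiv ℝ (bumpAt x r) z (Z z)
        = ∫ w, fderiv ℝ radialBump w (Z (x + r • w)) := by
    intro r hr hsub
    have h1 : ∫ z in Q, fderiv ℝ (bumpAt x r) z (Z z) = ∫ z, fderiv ℝ (bumpAt x r) z (Z z) := by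
      refine setIntegral_eq_integral_of_forall_compl_eq_zero fun z hz => ?_
      have : z ∉ tsupport (fderiv ℝ (bumpAt x r)) := fun h =>
        hz (hsub (tsupport_bumpAt_subset x hr (tsupport_fderiv_subset ℝ h)))
      rw [image_eq_zero_of_notMem_tsupport this]; rfl
    rw [h1, ← integral_add_left_eq_self _ x]
    have h2 := Measure.integral_comp_smul_of_nonneg (volume : Measure (SpaceTime d))
      (fun w => fderiv ℝ (bumpAt x r) (x + w) (Z (x + w))) r (hR := hr.le)
    simp only [finrank_euclideanSpace, Fintype.card_fin, smul_eq_mul] at h2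
    have h3 : ∀ w, fderiv ℝ (bumpAt x r) (x + r • w) (Z (x + r • w))
        = r⁻¹ * fderiv ℝ radialBump w (Z (x + r • w)) := by
      intro w
      rw [fderiv_bumpAt, add_sub_cancel_left, inv_smul_smul₀ hr.ne']
    simp only [h3] at h2
    rw [integral_const_mul, pow_succ] at h2
    have : (r ^ d)⁻¹ * ∫ w, fderiv ℝ (bumpAt x r) (x + w) (Z (x + w))
        = r * ((r ^ d * r)⁻¹ * ∫ w, fderiv ℝ (bumpAt x r) (x + w) (Z (x + w))) := by
      field_simp
    rw [this, ← h2]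
    field_simp
  rw [tendsto_iff_edist_tendsto_0]
  have hlim : Tendsto (fun r : ℝ => ENNReal.ofReal C *
      ∫⁻ z in Metric.ball (0 : SpaceTime d) 1, ‖Z (x + r • z) - jumpProfile n a b z‖ₑ)
      (𝓝[>] 0) (𝓝 0) := by
    simpa using ENNReal.Tendsto.const_mul hbl (Or.inr ENNReal.ofReal_ne_top)
  refine tendsto_of_tendsto_of_tendsto_of_le_of_le' tendsto_const_nhds hlim
    (Eventually.of_forall fun _ => zero_le) ?_
  filter_upwards [self_mem_nhdsWithin, eventually_closedBall_subset hQ hx] with r hr hsub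
  rw [hscale r hr hsub, edist_eq_enorm_sub, ← integral_sub
    (integrable_fderiv_radialBump_apply (by fun_prop) fun z => hZ _)
    (integrable_fderiv_radialBump_apply hjm hjb)]
  refine (enorm_integral_le_lintegral_enorm _).trans ?_
  rw [← lintegral_const_mul' _ _ ENNReal.ofReal_ne_top,
    ← lintegral_indicator Metric.isOpen_ball.measurableSet]
  refine lintegral_mono fun w => ?_
  by_cases hw : w ∈ Metric.ball (0 : SpaceTime d) 1
  · rw [indicator_of_mem hw, ← map_sub, ← ofReal_norm, ← ofReal_norm, ← ENNReal.ofReal_mul hC0]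
    refine ENNReal.ofReal_le_ofReal ?_
    exact ((fderiv ℝ (radialBump : SpaceTime d → ℝ) w).le_opNorm _).trans (by gcongr; exact hC w)
  · rw [indicator_of_notMem hw]
    rw [mem_ball_zero_iff, not_lt] at hw
    rw [fderiv_radialBump_of_one_le hw]
    simp

/-- An integrable source is of lower order than surface measures. -/
lemma ae_tendsto_source (hs : IntegrableOn s Q) {L : SpaceTime d ≃ₗᵢ[ℝ] SpaceTime d}
    {h : Space d → ℝ} {ε : NNReal} (hh : LipschitzWith ε h) :
    ∀ᵐ x ∂(graphMeasure L h),
      Tendsto (fun r => (r ^ d)⁻¹ * ∫ z in Q, s z * bumpAt x r z) (𝓝[>] 0) (𝓝 0) := by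
  set ν := graphMeasure L h with hν
  have : IsLocallyFiniteMeasure ν := isLocallyFiniteMeasure_graphMeasure hh
  set s0 := hs.1.mk s with hs0
  have hs0m : Measurable s0 := hs.1.stronglyMeasurable_mk.measurable
  have hs0i : Integrable s0 (volume.restrict Q) := hs.congr hs.1.ae_eq_mk
  -- the measure `|s|` is singular to the graph measure, because graphs are Lebesgue null
  set m := (volume.restrict Q).withDensity fun z => ‖s0 z‖ₑ with hm
  have : IsFiniteMeasure m := isFiniteMeasure_withDensity hs0i.2.ne
  have hsing : m ⟂ₘ ν := by
    refine ⟨range (graphMap L h), measurableSet_range_graphMap hh, ?_, graphMeasure_compl_range hh⟩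
    refine withDensity_absolutelyContinuous _ _ ?_
    exact le_antisymm ((Measure.restrict_apply_le _ _).trans (volume_range_graphMap hh).le) zero_le
  have hrn := hsing.rnDeriv_ae_eq_zero
  have hdiff := ae_tendsto_integral_bumpAt_sub m ν d _ fun x r hr =>
    graphMeasure_closedBall_le hh x hr
  filter_upwards [hrn, hdiff] with x hx1 hx2
  rw [hx1] at hx2
  simp only [Pi.zero_apply, ENNReal.toReal_zero, zero_mul, sub_zero] at hx2
  refine squeeze_zero_norm' ?_ hx2
  filter_upwards [self_mem_nhdsWithin] with r hr
  have hr0 : (0 : ℝ) < r := hr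
  rw [norm_mul, Real.norm_of_nonneg (by positivity : 0 ≤ (r ^ d)⁻¹)]
  gcongr
  have h1 : ∫ z, bumpAt x r z ∂m = ∫ z in Q, ‖s0 z‖ * bumpAt x r z := by
    rw [hm, integral_withDensity_eq_integral_toReal_smul (by fun_prop) (by simp)]
    simp
  have h2 : ∫ z in Q, s z * bumpAt x r z = ∫ z in Q, s0 z * bumpAt x r z := by
    refine integral_congr_ae ?_
    filter_upwards [hs.1.ae_eq_mk] with z hz
    rw [hz]
  rw [h1, h2]
  refine (norm_integral_le_integral_norm _).trans (le_of_eq ?_)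
  congr 1
  ext z
  rw [norm_mul, Real.norm_of_nonneg (bumpAt_nonneg x r z)]

/-- On an almost flat graph the jump formula holds up to a small relative error. -/
lemma IsBalance.ae_graph_jump (hb : IsBalance Q pos neg Z s) (hQ : IsOpen Q)
    (hZm : Measurable Z) (hZ : ∀ z, ‖Z z‖ ≤ M) (hs : IntegrableOn s Q)
    {K : Set (SpaceTime d)} (hKQ : K ⊆ Q)
    (hposK : pos K < ⊤) (hnegK : neg K < ⊤)
    {C : ℝ} {L : SpaceTime d ≃ₗᵢ[ℝ] SpaceTime d} {h : Space d → ℝ} {ε : NNReal}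
    (hh : LipschitzWith ε h)
    (hC : ∀ x ∈ range (graphMap L h), ∀ r : ℝ, 0 < r →
        |(r ^ d)⁻¹ * ∫ z, bumpAt x r z ∂(graphMeasure L h) - bumpMass d| ≤ C * ε) :
    ∀ᵐ x ∂(graphMeasure L h), x ∈ interior K → ∀ n a b : SpaceTime d, ‖n‖ = 1 →
      HasBlowUp Z x (jumpProfile n a b) →
      |(((pos.restrict K).rnDeriv (graphMeasure L h) x).toReal
          - ((neg.restrict K).rnDeriv (graphMeasure L h) x).toReal) * bumpMass d
        + bumpMass d * ⟪a - b, n⟫_ℝ|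
        ≤ C * ε * |((pos.restrict K).rnDeriv (graphMeasure L h) x).toReal
          - ((neg.restrict K).rnDeriv (graphMeasure L h) x).toReal| := by
  set ν := graphMeasure L h with hν
  have : IsLocallyFiniteMeasure ν := isLocallyFiniteMeasure_graphMeasure hh
  have : IsFiniteMeasure (pos.restrict K) := ⟨by rwa [Measure.restrict_apply_univ]⟩
  have : IsFiniteMeasure (neg.restrict K) := ⟨by rwa [Measure.restrict_apply_univ]⟩
  have hbd : ∀ (x : SpaceTime d) (r : ℝ), 0 < r → ν (Metric.closedBall x r)
      ≤ ENNReal.ofReal ((volume (Metric.ball (0 : Space d) 1)).toReal * r ^ d) :=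
    fun x r hr => graphMeasure_closedBall_le (L := L) hh x hr
  have hrange : ∀ᵐ x ∂ν, x ∈ range (graphMap L h) := by
    rw [ae_iff]; exact graphMeasure_compl_range hh
  filter_upwards [ae_tendsto_integral_bumpAt_sub (pos.restrict K) ν d _ hbd,
    ae_tendsto_integral_bumpAt_sub (neg.restrict K) ν d _ hbd, ae_tendsto_source hs hh, hrange]
    with x h1 h2 h3 hxr hxK n a b hn hbl
  have h4 := hbl.tendsto_flux hQ hZm hZ (hKQ (interior_subset hxK)) hn
  -- the rescaled balance tested with `bumpAt x r`: the left side is close to `τ * c r`, and the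
  -- right side converges by the blow up of the flux
  set τ := ((pos.restrict K).rnDeriv ν x).toReal - ((neg.restrict K).rnDeriv ν x).toReal with hτ
  set c : ℝ → ℝ := fun r => (r ^ d)⁻¹ * ∫ z, bumpAt x r z ∂ν with hc
  have hlim : Tendsto (fun r => τ * c r) (𝓝[>] 0) (𝓝 (-(bumpMass d * ⟪a - b, n⟫_ℝ))) := by
    have h5 := (h4.add h3).sub (h1.sub h2)
    simp only [add_zero, sub_zero] at h5
    refine h5.congr' ?_
    filter_upwards [self_mem_nhdsWithin, eventually_closedBall_subset isOpen_interior hxK]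
      with r hr hsub
    have hr0 : (0 : ℝ) < r := hr
    have hsubK : Metric.closedBall x r ⊆ K := hsub.trans interior_subset
    have htest : IsTestFunction Q (bumpAt x r) := isTestFunction_bumpAt x hr0 (hsubK.trans hKQ)
    have hres : ∀ m : Measure (SpaceTime d), ∫ z, bumpAt x r z ∂(m.restrict K)
        = ∫ z, bumpAt x r z ∂m := fun m =>
      setIntegral_eq_integral_of_forall_compl_eq_zero fun z hz => by
        by_contra hne
        exact hz (hsubK (support_bumpAt_subset x hr0 hne))
    have hbal := hb _ htest
    rw [integral_add (integrable_fderiv_flux hZm hZ htest).integrableOn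
      (integrable_source_mul hs (continuous_bumpAt x r) (C := 1) fun z => by
        rw [Real.norm_of_nonneg (bumpAt_nonneg x r z)]; exact bumpAt_le_one x r z)] at hbal
    rw [hres pos, hres neg, ← mul_add, ← hbal, hc, hτ]
    ring
  have hlim2 : Tendsto (fun r => |τ * bumpMass d - τ * c r|) (𝓝[>] 0)
      (𝓝 |τ * bumpMass d + bumpMass d * ⟪a - b, n⟫_ℝ|) := by
    have := (hlim.const_sub (τ * bumpMass d)).abs
    rwa [sub_neg_eq_add] at this
  refine le_of_tendsto hlim2 ?_
  filter_upwards [self_mem_nhdsWithin] with r hr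
  rw [← mul_sub, abs_mul, abs_sub_comm (bumpMass d), mul_comm]
  exact mul_le_mul_of_nonneg_right (hC x hxr r hr) (abs_nonneg _)

/-- The jump formula for the densities with respect to Hausdorff measure: the errors disappear
when the set is covered by flatter and flatter graphs. -/
lemma IsBalance.ae_jump (hb : IsBalance Q pos neg Z s) (hQ : IsOpen Q)
    (hZm : Measurable Z) (hZ : ∀ z, ‖Z z‖ ≤ M) (hs : IntegrableOn s Q)
    {K : Set (SpaceTime d)} (hKQ : K ⊆ Q)
    (hposK : pos K < ⊤) (hnegK : neg K < ⊤) {S : Set (SpaceTime d)} (hS : IsRectifiableSet S)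
    (hSm : MeasurableSet S) {θ₁ θ₂ : SpaceTime d → ENNReal} (hθ₁ : Measurable θ₁)
    (hθ₂ : Measurable θ₂)
    (h₁ : (pos.restrict K).restrict S = (μHE[d].restrict S).withDensity θ₁)
    (h₂ : (neg.restrict K).restrict S = (μHE[d].restrict S).withDensity θ₂) :
    ∀ᵐ x ∂μHE[d], x ∈ S → x ∈ interior K → ∀ n a b : SpaceTime d, ‖n‖ = 1 →
      HasBlowUp Z x (jumpProfile n a b) →
      (θ₁ x).toReal - (θ₂ x).toReal = -⟪a - b, n⟫_ℝ := by
  have : IsFiniteMeasure (pos.restrict K) := ⟨by rwa [Measure.restrict_apply_univ]⟩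
  have : IsFiniteMeasure (neg.restrict K) := ⟨by rwa [Measure.restrict_apply_univ]⟩
  obtain ⟨C, hC0, hC⟩ := exists_forall_abs_integral_bumpAt_sub_le d
  set c0 := bumpMass d with hc0
  -- `k` is the density of Hausdorff measure with respect to the measure of an `ε`-flat graph
  have hstep : ∀ ε : NNReal, 0 < ε → ε ≤ 1 →
      ∀ᵐ x ∂μHE[d], x ∈ S → x ∈ interior K → ∃ k : ℝ, 1 ≤ k ∧ k ≤ (1 + ε) ^ d ∧
        ∀ n a b : SpaceTime d, ‖n‖ = 1 → HasBlowUp Z x (jumpProfile n a b) →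
          |k * ((θ₁ x).toReal - (θ₂ x).toReal) * c0 + c0 * ⟪a - b, n⟫_ℝ|
            ≤ C * ε * |k * ((θ₁ x).toReal - (θ₂ x).toReal)| := by
    intro ε hε0 hε1
    obtain ⟨L, h, hh, hcov⟩ := hS.exists_graph_cover hε0 hε1
    have hgraph : ∀ i j, ∀ᵐ x ∂μHE[d], x ∈ range (graphMap (L i j) (h i j)) →
        x ∈ S → x ∈ interior K → ∃ k : ℝ, 1 ≤ k ∧ k ≤ (1 + ε) ^ d ∧
        ∀ n a b : SpaceTime d, ‖n‖ = 1 → HasBlowUp Z x (jumpProfile n a b) →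
          |k * ((θ₁ x).toReal - (θ₂ x).toReal) * c0 + c0 * ⟪a - b, n⟫_ℝ|
            ≤ C * ε * |k * ((θ₁ x).toReal - (θ₂ x).toReal)| := by
      intro i j
      rw [← ae_restrict_iff' (measurableSet_range_graphMap (hh i j))]
      refine (absolutelyContinuous_graphMeasure (hh i j)).ae_le ?_
      obtain ⟨k, hk, hkm⟩ := ae_rnDeriv_graphMeasure (L := L i j) (hh i j)
      filter_upwards [hk, hkm (pos.restrict K) S hSm θ₁ hθ₁ h₁,
        hkm (neg.restrict K) S hSm θ₂ hθ₂ h₂,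
        hb.ae_graph_jump hQ hZm hZ hs hKQ hposK hnegK (hh i j) (hC (L i j) (h i j) ε (hh i j))]
        with x hx1 hx2 hx3 hx4 hxS hxK
      have htop : ((1 + ε : NNReal) : ENNReal) ^ d ≠ ⊤ := ENNReal.pow_ne_top ENNReal.coe_ne_top
      have hkt : k x ≠ ⊤ := (hx1.2.trans_lt (lt_top_iff_ne_top.2 htop)).ne
      refine ⟨(k x).toReal, ?_, ?_, fun n a b hn hbl => ?_⟩
      · have := ENNReal.toReal_mono hkt hx1.1
        simpa using this
      · have := ENNReal.toReal_mono htop hx1.2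
        rw [ENNReal.toReal_pow, ENNReal.coe_toReal] at this
        exact_mod_cast this
      · have := hx4 hxK n a b hn hbl
        rw [hx2 hxS, hx3 hxS, ENNReal.toReal_mul, ENNReal.toReal_mul, ← mul_sub] at this
        exact this
    have hcov' : ∀ᵐ x ∂μHE[d], x ∉ S \ ⋃ i, ⋃ j, range (graphMap (L i j) (h i j)) :=
      measure_eq_zero_iff_ae_notMem.1 hcov
    filter_upwards [ae_all_iff.2 fun i => ae_all_iff.2 fun j => hgraph i j, hcov']
      with x hx1 hx2 hxS hxK
    have hx3 : x ∈ ⋃ i, ⋃ j, range (graphMap (L i j) (h i j)) := by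
      by_contra hne
      exact hx2 ⟨hxS, hne⟩
    obtain ⟨i, hi⟩ := mem_iUnion.1 hx3
    obtain ⟨j, hj⟩ := mem_iUnion.1 hi
    exact hx1 i j hj hxS hxK
  set ε : ℕ → NNReal := fun m => 1 / (m + 1) with hεdef
  have hε0 : ∀ m, 0 < ε m := fun m => by positivity
  have hε1 : ∀ m, ε m ≤ 1 := fun m => div_le_self zero_le (by simp)
  have hεlim : Tendsto (fun m => (ε m : ℝ)) atTop (𝓝 0) := by
    have := tendsto_one_div_add_atTop_nhds_zero_nat (𝕜 := ℝ)
    simpa [hεdef] using this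
  filter_upwards [ae_all_iff.2 fun m => hstep (ε m) (hε0 m) (hε1 m)] with x hx hxS hxK n a b hn hbl
  choose k hk1 hk2 hk using fun m => hx m hxS hxK
  have hklim : Tendsto k atTop (𝓝 1) := by
    refine tendsto_of_tendsto_of_tendsto_of_le_of_le tendsto_const_nhds ?_ hk1 hk2
    have := (hεlim.const_add 1).pow d
    simpa using this
  set t := (θ₁ x).toReal - (θ₂ x).toReal with ht
  have hl : Tendsto (fun m => |k m * t * c0 + c0 * ⟪a - b, n⟫_ℝ|) atTop
      (𝓝 |1 * t * c0 + c0 * ⟪a - b, n⟫_ℝ|) :=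
    (((hklim.mul_const t).mul_const c0).add_const _).abs
  have hr : Tendsto (fun m => C * ε m * |k m * t|) atTop (𝓝 (C * 0 * |1 * t|)) :=
    (hεlim.const_mul C).mul (hklim.mul_const t).abs
  have hle := le_of_tendsto_of_tendsto' hl hr fun m => hk m n a b hn hbl
  simp only [mul_zero, zero_mul, one_mul] at hle
  have h0 := abs_nonpos_iff.1 hle
  have hc0pos : 0 < c0 := bumpMass_pos d
  have h5 : c0 * (t + ⟪a - b, n⟫_ℝ) = 0 := by linarith
  have h6 := (mul_eq_zero.1 h5).resolve_left hc0pos.ne'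
  linarith

end Balance

lemma IsRectifiableSet.sigmaFinite {d : ℕ} {S : Set (SpaceTime d)} (hS : IsRectifiableSet S) :
    SigmaFinite (μHE[d].restrict S) := by
  obtain ⟨F, hF, hnull⟩ := hS.cover
  choose C hC using hF
  set N := S \ ⋃ i, range (F i) with hN
  set T : Set (Set (SpaceTime d)) :=
    insert Sᶜ (insert N (range fun p : ℕ × ℕ => F p.1 '' Metric.ball 0 p.2)) with hT
  refine Measure.sigmaFinite_of_countable (S := T)
    (((countable_range _).insert _).insert _) ?_ ?_
  · rintro A (rfl | rfl | ⟨⟨i, m⟩, rfl⟩)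
    · rw [Measure.restrict_apply₀' hS.nullMeasurable]; simp
    · exact (Measure.restrict_apply_le _ _).trans_lt (by rw [hnull]; simp)
    · refine (Measure.restrict_apply_le _ _).trans_lt ?_
      refine (euclideanHausdorffMeasure_image_le
        ((hC i).lipschitzOnWith (s := Metric.ball 0 (m : ℝ))) d).trans_lt ?_
      rw [EuclideanSpace.euclideanHausdorffMeasure_eq_volume]
      exact ENNReal.mul_lt_top (ENNReal.pow_lt_top ENNReal.coe_lt_top) measure_ball_lt_top
  · refine eq_univ_of_forall fun x => ?_
    by_cases hxS : x ∈ S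
    · by_cases hx : x ∈ ⋃ i, range (F i)
      · obtain ⟨i, y, rfl⟩ := mem_iUnion.1 hx
        obtain ⟨m, hm⟩ := exists_nat_gt ‖y‖
        exact ⟨_, Or.inr (Or.inr ⟨(i, m), rfl⟩), y, by simpa using hm, rfl⟩
      · exact ⟨N, Or.inr (Or.inl rfl), hxS, hx⟩
    · exact ⟨Sᶜ, Or.inl rfl, hxS⟩

lemma IsRectifiableSet.mono_ae {d : ℕ} {S S' : Set (SpaceTime d)} (hS : IsRectifiableSet S)
    (hsub : S' ⊆ S) (hm : MeasurableSet S') : IsRectifiableSet S' where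
  nullMeasurable := hm.nullMeasurableSet
  cover := by
    obtain ⟨F, hF, hnull⟩ := hS.cover
    exact ⟨F, hF, measure_mono_null (sdiff_subset_sdiff_left hsub) hnull⟩

/-- The restriction to a rectifiable set of the divergence of a bounded field with one-sided
traces. The orientation `n` enters only through the traces. -/
lemma restrictEq_of_isBalance {d : ℕ} {Q : Set (SpaceTime d)} (hQ : IsOpen Q)
    (D : SignedRadonMeasure Q) {Z : SpaceTime d → SpaceTime d} {s : SpaceTime d → ℝ} {M : ℝ}
    (hb : IsBalance Q D.pos D.neg Z s) (hZm : Measurable Z) (hZ : ∀ z, ‖Z z‖ ≤ M)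
    (hs : IntegrableOn s Q) {S : Set (SpaceTime d)} (hS : IsRectifiableSet S)
    {n Zp Zm : SpaceTime d → SpaceTime d} (hn : ∀ᵐ x ∂μHE[d], x ∈ S → ‖n x‖ = 1)
    (htr : AreTraces S n Z Zp Zm) :
    D.RestrictEq S fun x => -⟪Zp x - Zm x, n x⟫_ℝ := by
  -- both parts of `D` are absolutely continuous with respect to Hausdorff measure; for the negative
  -- part the balance is used with all signs reversed
  have hposac : ∀ A, μHE[d] A = 0 → D.pos A = 0 := fun A hA =>
    hb.measure_eq_zero hQ D.pos_compl D.pos_lt_top D.neg_lt_top D.mutuallySingular hZm hZ hs hA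
  have hb' : IsBalance Q D.neg D.pos (fun z => -Z z) (fun z => -s z) := by
    intro φ hφ
    have h1 := hb φ hφ
    have h2 : ∀ z, fderiv ℝ φ z (-Z z) + -s z * φ z = -(fderiv ℝ φ z (Z z) + s z * φ z) := by
      intro z; rw [map_neg]; ring
    simp only [h2, integral_neg]
    linarith
  have hnegac : ∀ A, μHE[d] A = 0 → D.neg A = 0 := fun A hA =>
    hb'.measure_eq_zero hQ D.neg_compl D.neg_lt_top D.pos_lt_top D.mutuallySingular.symm hZm.neg
      (fun z => by rw [norm_neg]; exact hZ z) hs.neg hA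
  obtain ⟨S0, hS0S, hS0m, hS0ae⟩ := hS.nullMeasurable.exists_measurable_subset_ae_eq
  have hS0 : IsRectifiableSet S0 := hS.mono_ae hS0S hS0m
  have hdiff : μHE[d] (S \ S0) = 0 := (ae_eq_set.1 hS0ae).2
  have hσ : SigmaFinite (μHE[d].restrict S0) := hS0.sigmaFinite
  intro B K0 hB hK0 hK0Q hBK0
  -- the jump formula holds in the interior of compact sets, so `K0` is enlarged
  obtain ⟨K, hK, hK0K, hKQ⟩ := exists_compact_between hK0 hQ hK0Q
  have hBK : B ⊆ interior K := hBK0.trans hK0K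
  have hposK := D.pos_lt_top K hK hKQ
  have hnegK := D.neg_lt_top K hK hKQ
  have : IsFiniteMeasure (D.pos.restrict K) := ⟨by rwa [Measure.restrict_apply_univ]⟩
  have : IsFiniteMeasure (D.neg.restrict K) := ⟨by rwa [Measure.restrict_apply_univ]⟩
  set σ := (μHE[d] : Measure (SpaceTime d)).restrict S0 with hσdef
  have hden : ∀ m : Measure (SpaceTime d), IsFiniteMeasure (m.restrict K) →
      (∀ A, μHE[d] A = 0 → m A = 0) → (m.restrict K).restrict S0
        = σ.withDensity (((m.restrict K).restrict S0).rnDeriv σ) := by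
    intro m hm hac
    refine (Measure.withDensity_rnDeriv_eq _ _ ?_).symm
    refine Measure.AbsolutelyContinuous.restrict ?_ S0
    refine Measure.AbsolutelyContinuous.trans Measure.absolutelyContinuous_restrict ?_
    exact fun A hA => hac A hA
  set θ₁ := ((D.pos.restrict K).restrict S0).rnDeriv σ with hθ₁
  set θ₂ := ((D.neg.restrict K).restrict S0).rnDeriv σ with hθ₂
  have hd1 := hden D.pos inferInstance hposac
  have hd2 := hden D.neg inferInstance hnegac
  have hjump := hb.ae_jump hQ hZm hZ hs hKQ hposK hnegK hS0 hS0m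
    (Measure.measurable_rnDeriv _ _) (Measure.measurable_rnDeriv _ _) hd1 hd2
  have hBS : (B ∩ S : Set (SpaceTime d)) =ᵐ[μHE[d]] (B ∩ S0 : Set (SpaceTime d)) :=
    (ae_eq_refl B).inter hS0ae.symm
  have hrestr : (μHE[d] : Measure (SpaceTime d)).restrict (B ∩ S) = σ.restrict B := by
    rw [Measure.restrict_congr_set hBS, hσdef, Measure.restrict_restrict hB]
  have hg : (fun x => -⟪Zp x - Zm x, n x⟫_ℝ) =ᵐ[σ.restrict B]
      fun x => (θ₁ x).toReal - (θ₂ x).toReal := by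
    rw [hσdef, Measure.restrict_restrict hB]
    refine (ae_restrict_iff' (hB.inter hS0m)).2 ?_
    filter_upwards [hjump, hn, htr] with x h1 h2 h3 hx
    exact (h1 hx.2 (hBK hx.1) (n x) (Zp x) (Zm x) (h2 (hS0S hx.2)) (h3 (hS0S hx.2))).symm
  have hi1 : Integrable (fun x => (θ₁ x).toReal) (σ.restrict B) :=
    Measure.integrable_toReal_rnDeriv.integrableOn
  have hi2 : Integrable (fun x => (θ₂ x).toReal) (σ.restrict B) :=
    Measure.integrable_toReal_rnDeriv.integrableOn
  have hval : ∀ m : Measure (SpaceTime d), IsFiniteMeasure (m.restrict K) →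
      (∀ A, μHE[d] A = 0 → m A = 0) →
      (m (B ∩ S)).toReal = ∫ x in B, (((m.restrict K).restrict S0).rnDeriv σ x).toReal ∂σ := by
    intro m hm hac
    have h1 : m (B ∩ S) = m (B ∩ S0) := by
      refine le_antisymm ?_ (measure_mono (inter_subset_inter_right _ hS0S))
      have hsub : B ∩ S ⊆ (B ∩ S0) ∪ (S \ S0) := fun x hx => by
        by_cases h : x ∈ S0
        · exact Or.inl ⟨hx.1, h⟩
        · exact Or.inr ⟨hx.2, h⟩
      refine (measure_mono hsub).trans ((measure_union_le _ _).trans ?_)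
      rw [hac _ hdiff, add_zero]
    have h2 : m (B ∩ S0) = ((m.restrict K).restrict S0) B := by
      rw [Measure.restrict_apply hB, Measure.restrict_apply (hB.inter hS0m),
        inter_eq_left.2 (inter_subset_left.trans (hBK.trans interior_subset))]
    rw [integral_toReal (Measure.measurable_rnDeriv _ _).aemeasurable
      (ae_restrict_of_ae (Measure.rnDeriv_lt_top _ _)), ← withDensity_apply _ hB, ← hden m hm hac,
      h1, h2]
  refine ⟨?_, ?_⟩
  · rw [IntegrableOn, hrestr]
    exact (hi1.sub hi2).congr hg.symm
  · rw [hrestr, integral_congr_ae hg, integral_sub hi1 hi2, SignedRadonMeasure.val,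
      hval D.pos inferInstance hposac, hval D.neg inferInstance hnegac]

/-- The Rankine–Hugoniot condition: a bounded field whose divergence is an integrable function has
continuous normal traces on rectifiable sets. -/
lemma ae_inner_trace_sub_eq_zero {d : ℕ} {Q : Set (SpaceTime d)} (hQ : IsOpen Q)
    {Z : SpaceTime d → SpaceTime d} {s : SpaceTime d → ℝ} {M : ℝ}
    (hb : IsBalance Q 0 0 Z s) (hZm : Measurable Z) (hZ : ∀ z, ‖Z z‖ ≤ M)
    (hs : IntegrableOn s Q) {S : Set (SpaceTime d)} (hSQ : S ⊆ Q) (hS : IsRectifiableSet S) :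
    ∀ᵐ x ∂μHE[d], x ∈ S → ∀ n a b : SpaceTime d, ‖n‖ = 1 →
      HasBlowUp Z x (jumpProfile n a b) → ⟪a - b, n⟫_ℝ = 0 := by
  obtain ⟨S0, hS0S, hS0m, hS0ae⟩ := hS.nullMeasurable.exists_measurable_subset_ae_eq
  have hS0 : IsRectifiableSet S0 := hS.mono_ae hS0S hS0m
  have hmain : ∀ᵐ x ∂μHE[d], x ∈ S0 → ∀ n a b : SpaceTime d, ‖n‖ = 1 →
      HasBlowUp Z x (jumpProfile n a b) → ⟪a - b, n⟫_ℝ = 0 := by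
    rw [ae_iff]
    refine measure_null_of_locally_null _ fun x hx => ?_
    have hxQ : x ∈ Q := by
      by_contra h
      exact hx fun hxS => absurd (hSQ (hS0S hxS)) h
    obtain ⟨r, hr0, hr⟩ := Metric.nhds_basis_closedBall.mem_iff.1 (hQ.mem_nhds hxQ)
    have h := hb.ae_jump hQ hZm hZ hs hr (by simp)
      (by simp) hS0 hS0m (θ₁ := 0) (θ₂ := 0) measurable_const measurable_const (by simp) (by simp)
    rw [ae_iff] at h
    refine ⟨_, inter_mem_nhdsWithin _ (Metric.ball_mem_nhds x hr0), measure_mono_null ?_ h⟩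
    rintro y ⟨hy1, hy2⟩
    rw [mem_ofPred_eq] at hy1 ⊢
    contrapose! hy1
    intro hyS n a b hn hbl
    have := hy1 hyS (Metric.ball_subset_interior_closedBall hy2) n a b hn hbl
    simpa using this
  filter_upwards [hmain, hS0ae.mem_iff] with x h1 h2 hxS
  exact h1 (h2.2 hxS)

/-! ### Jump directions are normal to rectifiable sets -/

/-- The `L¹` distance in the unit ball between the rescaling of `g` at `x` to scale `l` and a jump
profile. -/
def jumpError {d : ℕ} (g : SpaceTime d → ℝ) (ν : SpaceTime d) (a b : ℝ) (x : SpaceTime d)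
    (l : ℝ) : ENNReal :=
  ∫⁻ z in Metric.ball (0 : SpaceTime d) 1, ‖g (x + l • z) - jumpProfile ν a b z‖ₑ

lemma jumpProfile_smul {d : ℕ} {V : Type*} (ν : SpaceTime d) (a b : V) {l : ℝ} (hl : 0 < l)
    (z : SpaceTime d) : jumpProfile ν a b (l • z) = jumpProfile ν a b z := by
  simp only [jumpProfile, inner_smul_left, conj_trivial, mul_nonneg_iff_of_pos_left hl]

lemma lintegral_ball_jumpProfile {d : ℕ} (g : SpaceTime d → ℝ) (ν : SpaceTime d) (a b : ℝ)
    (x : SpaceTime d) {l : ℝ} (hl : 0 < l) :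
    ∫⁻ w in Metric.ball x l, ‖g w - jumpProfile ν a b (w - x)‖ₑ
      = ENNReal.ofReal (l ^ (d + 1)) * jumpError g ν a b x l := by
  rw [lintegral_ball_eq_rescaled _ x hl, jumpError]
  simp only [add_sub_cancel_left, jumpProfile_smul ν a b hl]

/-- If two jump profiles for the same function take different constant values on a part of a
common ball, then one of them is a bad approximation. -/
lemma enorm_sub_mul_le_jumpError {d : ℕ} {g : SpaceTime d → ℝ} (hg : Measurable g)
    {ν ν' x y : SpaceTime d} {a b a' b' e e' l l' : ℝ} (hl : 0 < l) (hl' : 0 < l')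
    (hball : Metric.ball y l' ⊆ Metric.ball x l) {H : Set (SpaceTime d)} (hH : MeasurableSet H)
    (he : ∀ w ∈ Metric.ball y l', jumpProfile ν a b (w - x) = e)
    (he' : ∀ z ∈ H, jumpProfile ν' a' b' z = e') :
    ENNReal.ofReal (l' ^ (d + 1)) * (‖e - e'‖ₑ * volume (Metric.ball (0 : SpaceTime d) 1 ∩ H))
      ≤ ENNReal.ofReal (l ^ (d + 1)) * jumpError g ν a b x l
        + ENNReal.ofReal (l' ^ (d + 1)) * jumpError g ν' a' b' y l' := by
  have hm : ∀ (n : SpaceTime d) (c c' : ℝ) (z : SpaceTime d),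
      Measurable fun w => ‖g w - jumpProfile n c c' (w - z)‖ₑ := fun n c c' z =>
    (hg.sub ((measurable_jumpProfile n c c').comp (measurable_id.sub_const z))).enorm
  rw [← lintegral_ball_jumpProfile g ν a b x hl, ← lintegral_ball_jumpProfile g ν' a' b' y hl']
  calc _ = ENNReal.ofReal (l' ^ (d + 1)) *
        ∫⁻ z in Metric.ball (0 : SpaceTime d) 1, H.indicator (fun _ => ‖e - e'‖ₑ) z := by
        rw [lintegral_indicator hH, lintegral_const, Measure.restrict_restrict hH,
          Measure.restrict_apply_univ, inter_comm]
    _ ≤ ENNReal.ofReal (l' ^ (d + 1)) * ∫⁻ z in Metric.ball (0 : SpaceTime d) 1,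
          (fun w => ‖g w - jumpProfile ν a b (w - x)‖ₑ + ‖g w - jumpProfile ν' a' b' (w - y)‖ₑ)
            (y + l' • z) := by
        gcongr ENNReal.ofReal _ * ?_
        refine setLIntegral_mono' Metric.isOpen_ball.measurableSet fun z hz => ?_
        by_cases hzH : z ∈ H
        · rw [indicator_of_mem hzH]
          have hw : y + l' • z ∈ Metric.ball y l' := by
            rw [mem_ball_zero_iff] at hz
            simp only [Metric.mem_ball, dist_self_add_left, norm_smul, Real.norm_of_nonneg hl'.le]
            nlinarith
          dsimp only
          rw [he _ hw, add_sub_cancel_left, jumpProfile_smul _ _ _ hl', he' z hzH,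
            ← edist_eq_enorm_sub, ← edist_eq_enorm_sub, ← edist_eq_enorm_sub,
            edist_comm (g _) e]
          exact edist_triangle _ _ _
        · rw [indicator_of_notMem hzH]; exact zero_le
    _ = ∫⁻ w in Metric.ball y l',
          (‖g w - jumpProfile ν a b (w - x)‖ₑ + ‖g w - jumpProfile ν' a' b' (w - y)‖ₑ) :=
        (lintegral_ball_eq_rescaled (fun w => ‖g w - jumpProfile ν a b (w - x)‖ₑ
          + ‖g w - jumpProfile ν' a' b' (w - y)‖ₑ) y hl').symm
    _ = (∫⁻ w in Metric.ball y l', ‖g w - jumpProfile ν a b (w - x)‖ₑ)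
          + ∫⁻ w in Metric.ball y l', ‖g w - jumpProfile ν' a' b' (w - y)‖ₑ :=
        lintegral_add_left (hm _ _ _ _) _
    _ ≤ _ := add_le_add (lintegral_mono_set hball) le_rfl

/-- The tolerance for the approximation by jump profiles, in terms of the aperture `δ` of a cone
and of a lower bound `η` for the jumps and for the volumes of half balls. -/
def jumpTolerance (d : ℕ) (δ η : ℝ) : ℝ := η ^ 2 * δ ^ (d + 1) / (2 ^ (d + 1) + 1)

/-- Two nearby points, both well approximated by jump profiles with almost the same one-sided
values, are such that the second lies close to the jump hyperplane of the first. -/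
lemma abs_inner_sub_le_of_jumpError_le {d : ℕ} {g : SpaceTime d → ℝ} (hg : Measurable g)
    {ν ν' x y : SpaceTime d} {a b a' b' α β δ η l₀ : ℝ} (hδ : 0 < δ) (hδ1 : δ ≤ 1) (hη : 0 < η)
    (ha : |a - α| < η) (hb : |b - β| < η) (ha' : |a' - α| < η) (hb' : |b' - β| < η)
    (hαβ : 4 * η ≤ |α - β|)
    (hx : ∀ l, 0 < l → l < l₀ → jumpError g ν a b x l ≤ ENNReal.ofReal (jumpTolerance d δ η))
    (hy : ∀ l, 0 < l → l < l₀ → jumpError g ν' a' b' y l ≤ ENNReal.ofReal (jumpTolerance d δ η))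
    (hν' : ENNReal.ofReal η ≤ volume (Metric.ball (0 : SpaceTime d) 1 ∩ {z | 0 < ⟪z, ν'⟫_ℝ}))
    (hν'' : ENNReal.ofReal η ≤ volume (Metric.ball (0 : SpaceTime d) 1 ∩ {z | ⟪z, ν'⟫_ℝ < 0}))
    (hν : ‖ν‖ = 1) (hxy : 2 * ‖y - x‖ < l₀) : |⟪y - x, ν⟫_ℝ| ≤ δ * ‖y - x‖ := by
  set r := ‖y - x‖ with hr
  rcases (norm_nonneg (y - x)).eq_or_lt with h0 | h0
  · rw [← hr] at h0
    rw [← h0, mul_zero]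
    refine (abs_real_inner_le_norm _ _).trans ?_
    rw [← hr, ← h0, zero_mul]
  rw [← hr] at h0
  have hδr : 0 < δ * r := mul_pos hδ h0
  have hδrr : δ * r ≤ r := mul_le_of_le_one_left h0.le hδ1
  have hball : Metric.ball y (δ * r) ⊆ Metric.ball x (2 * r) := by
    refine Metric.ball_subset_ball' ?_
    rw [dist_eq_norm, ← hr]; linarith
  have hdiff : ∀ w ∈ Metric.ball y (δ * r), |⟪w - x, ν⟫_ℝ - ⟪y - x, ν⟫_ℝ| < δ * r := by
    intro w hw
    rw [← inner_sub_left, sub_sub_sub_cancel_right]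
    refine (abs_real_inner_le_norm _ _).trans_lt ?_
    rw [hν, mul_one, ← dist_eq_norm]
    exact hw
  have hmH : ∀ s : ℝ → Prop, MeasurableSet {t | s t} →
      MeasurableSet {z : SpaceTime d | s ⟪z, ν'⟫_ℝ} := fun s hs =>
    (by fun_prop : Measurable fun z : SpaceTime d => ⟪z, ν'⟫_ℝ) hs
  -- If `y` were off the cone, the profile at `x` would be a constant `e` on the ball of radius
  -- `δ r` around `y`, while the profile at `y` takes the opposite value `e'` on half of that ball.
  have key : ∀ (e e' : ℝ) (H : Set (SpaceTime d)), MeasurableSet H →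
      (∀ w ∈ Metric.ball y (δ * r), jumpProfile ν a b (w - x) = e) →
      (∀ z ∈ H, jumpProfile ν' a' b' z = e') →
      ENNReal.ofReal η ≤ volume (Metric.ball (0 : SpaceTime d) 1 ∩ H) → 2 * η ≤ |e - e'| →
      False := by
    intro e e' H hH he he' hvol hee
    have h1 := enorm_sub_mul_le_jumpError hg (by positivity : 0 < 2 * r) hδr hball hH he he'
    have hc : 0 ≤ jumpTolerance d δ η := by unfold jumpTolerance; positivity
    have h2 : ENNReal.ofReal ((δ * r) ^ (d + 1) * (2 * η * η))
        ≤ ENNReal.ofReal ((2 * r) ^ (d + 1) * jumpTolerance d δ η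
          + (δ * r) ^ (d + 1) * jumpTolerance d δ η) := by
      rw [ENNReal.ofReal_add (by positivity) (by positivity),
        ENNReal.ofReal_mul (p := (δ * r) ^ (d + 1)) (q := 2 * η * η) (by positivity),
        ENNReal.ofReal_mul (p := 2 * η) (by positivity),
        ENNReal.ofReal_mul (p := (2 * r) ^ (d + 1)) (by positivity),
        ENNReal.ofReal_mul (p := (δ * r) ^ (d + 1)) (by positivity)]
      refine le_trans ?_ (h1.trans ?_)
      · gcongr
        rw [← ofReal_norm, Real.norm_eq_abs]
        exact ENNReal.ofReal_le_ofReal hee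
      · gcongr
        · exact hx _ (by positivity) hxy
        · exact hy _ hδr (by linarith)
    rw [ENNReal.ofReal_le_ofReal_iff (by positivity), mul_pow, mul_pow, jumpTolerance] at h2
    have hrd : 0 < r ^ (d + 1) := by positivity
    have hδd : 0 < δ ^ (d + 1) := by positivity
    have hδd1 : δ ^ (d + 1) ≤ 1 := pow_le_one₀ hδ.le hδ1
    have h2d : (0 : ℝ) < 2 ^ (d + 1) + 1 := by positivity
    have h3 : 2 * r ^ (d + 1) * (η ^ 2 * δ ^ (d + 1))
        ≤ r ^ (d + 1) * (η ^ 2 * δ ^ (d + 1)) := by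
      calc 2 * r ^ (d + 1) * (η ^ 2 * δ ^ (d + 1)) = δ ^ (d + 1) * r ^ (d + 1) * (2 * η * η) := by
            ring
        _ ≤ _ := h2
        _ = r ^ (d + 1) * (η ^ 2 * δ ^ (d + 1))
              * ((2 ^ (d + 1) + δ ^ (d + 1)) / (2 ^ (d + 1) + 1)) := by ring
        _ ≤ r ^ (d + 1) * (η ^ 2 * δ ^ (d + 1)) * 1 := by
            gcongr
            rw [div_le_one h2d]; linarith
        _ = _ := mul_one _
    have h4 : 0 < r ^ (d + 1) * (η ^ 2 * δ ^ (d + 1)) := by positivity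
    linarith
  have hab' : 2 * η ≤ |a - b'| := by
    have h1 : α - β = (a - b') - (a - α) + (b' - β) := by ring
    have h2 : |α - β| ≤ |a - b'| + |a - α| + |b' - β| := by
      rw [h1]; exact (abs_add_le _ _).trans (by gcongr; exact abs_sub _ _)
    linarith
  have hba' : 2 * η ≤ |b - a'| := by
    have h1 : α - β = (a' - b) - (a' - α) + (b - β) := by ring
    have h2 : |α - β| ≤ |a' - b| + |a' - α| + |b - β| := by
      rw [h1]; exact (abs_add_le _ _).trans (by gcongr; exact abs_sub _ _)
    rw [abs_sub_comm]
    linarith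
  by_contra! hcon
  rcases lt_abs.1 hcon with h | h
  · refine key a b' {z | ⟪z, ν'⟫_ℝ < 0} (hmH (· < 0) measurableSet_Iio) (fun w hw => ?_)
      (fun z hz => ?_) hν'' hab'
    · have := (abs_lt.1 (hdiff w hw)).1
      exact if_pos (by linarith)
    · exact if_neg (not_le.2 hz)
  · refine key b a' {z | 0 < ⟪z, ν'⟫_ℝ} (hmH (0 < ·) measurableSet_Ioi) (fun w hw => ?_)
      (fun z hz => ?_) hν' hba'
    · have := (abs_lt.1 (hdiff w hw)).2
      exact if_neg (by linarith)
    · exact if_pos (le_of_lt hz)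

/-- At almost every point of a set, every direction is tangent to it. -/
lemma ae_exists_seq_tangent {E : Type*} [NormedAddCommGroup E] [NormedSpace ℝ E]
    [FiniteDimensional ℝ E] [MeasurableSpace E] [BorelSpace E] (μ : Measure E)
    [μ.IsAddHaarMeasure] (t : Set E) :
    ∀ᵐ y ∂μ, y ∈ t → ∀ w : E, ∃ (r : ℕ → ℝ) (z : ℕ → E), (∀ k, 0 < r k) ∧
      Tendsto r atTop (𝓝 0) ∧ Tendsto z atTop (𝓝 w) ∧ ∀ k, y + r k • z k ∈ t := by
  filter_upwards [ae_imp_of_ae_restrict (Besicovitch.ae_tendsto_measure_inter_div μ t)]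
    with y hy hyt w
  have hex : ∀ k : ℕ, ∃ (r : ℝ) (z : E), 0 < r ∧ r < 1 / (k + 1) ∧ dist z w ≤ 1 / (k + 1) ∧
      y + r • z ∈ t := by
    intro k
    have hk : (0 : ℝ) < 1 / (k + 1) := by positivity
    have h1 := Measure.eventually_nonempty_inter_smul_of_density_one μ t y (hy hyt)
      (Metric.closedBall w (1 / (k + 1))) Metric.isClosed_closedBall.measurableSet
      (Metric.measure_closedBall_pos μ w hk).ne'
    obtain ⟨r, ⟨q, hqt, hq⟩, hr⟩ := (h1.and (Ioo_mem_nhdsGT hk)).exists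
    obtain ⟨z, hz, rfl⟩ : ∃ z ∈ Metric.closedBall w (1 / ((k : ℝ) + 1)), y + r • z = q := by
      rw [singleton_add, image_add_left, mem_preimage, mem_smul_set] at hq
      obtain ⟨z, hz, hzq⟩ := hq
      exact ⟨z, hz, by rw [hzq, add_neg_cancel_left]⟩
    exact ⟨r, z, hr.1, hr.2, hz, hqt⟩
  choose r z hr0 hr1 hz ht using hex
  refine ⟨r, z, hr0, ?_, ?_, ht⟩
  · exact squeeze_zero (fun k => (hr0 k).le) (fun k => (hr1 k).le)
      tendsto_one_div_add_atTop_nhds_zero_nat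
  · exact tendsto_iff_dist_tendsto_zero.2 (squeeze_zero (fun _ => dist_nonneg) hz
      tendsto_one_div_add_atTop_nhds_zero_nat)

/-- If the increments between nearby points of `E` satisfy a cone condition, then so do the tangent
vectors of a parametrized surface at almost every parameter with image in `E`. -/
lemma ae_abs_inner_fderiv_le_of_cone {d : ℕ} {F : Space d → SpaceTime d}
    {E : Set (SpaceTime d)} {ν : SpaceTime d → SpaceTime d} {δ ε : ℝ} (hε : 0 < ε)
    (hE : ∀ x ∈ E, ∀ y ∈ E, ‖y - x‖ < ε → |⟪y - x, ν x⟫_ℝ| ≤ δ * ‖y - x‖) :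
    ∀ᵐ y, F y ∈ E → DifferentiableAt ℝ F y →
      ∀ w, |⟪fderiv ℝ F y w, ν (F y)⟫_ℝ| ≤ δ * ‖fderiv ℝ F y w‖ := by
  filter_upwards [ae_exists_seq_tangent volume (F ⁻¹' E)] with y hy hyE hdiff w
  obtain ⟨r, z, hr0, hr, hz, ht⟩ := hy hyE w
  have hd : Tendsto (fun k => r k • z k) atTop (𝓝 0) := by simpa using hr.smul hz
  have hlim := (hdiff.hasFDerivAt.hasFDerivWithinAt (s := univ)).lim (l := atTop)
    (c := fun k => (r k)⁻¹) hd (Eventually.of_forall fun _ => mem_univ _)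
    (by simpa [inv_smul_smul₀ (hr0 _).ne'] using hz)
  have h1 : Tendsto (fun k => |⟪(r k)⁻¹ • (F (y + r k • z k) - F y), ν (F y)⟫_ℝ|) atTop
      (𝓝 |⟪fderiv ℝ F y w, ν (F y)⟫_ℝ|) :=
    (hlim.inner tendsto_const_nhds).abs
  refine le_of_tendsto_of_tendsto h1 (hlim.norm.const_mul δ) ?_
  have hcont : Tendsto (fun k => F (y + r k • z k)) atTop (𝓝 (F y)) := by
    have : Tendsto (fun k => y + r k • z k) atTop (𝓝 y) := by simpa using hd.const_add y
    exact hdiff.continuousAt.tendsto.comp this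
  filter_upwards [Metric.tendsto_nhds.1 hcont ε hε] with k hk
  rw [dist_eq_norm] at hk
  have := hE _ hyE _ (ht k) hk
  have hp : 0 < (r k)⁻¹ := inv_pos.2 (hr0 k)
  rw [inner_smul_left, norm_smul, conj_trivial, abs_mul, Real.norm_of_nonneg hp.le,
    abs_of_pos hp]
  nlinarith

lemma exists_nat_one_div_lt_min {a b c : ℝ} (ha : 0 < a) (hb : 0 < b) (hc : 0 < c) :
    ∃ m : ℕ, 1 / ((m : ℝ) + 1) < a ∧ 1 / ((m : ℝ) + 1) < b ∧ 1 / ((m : ℝ) + 1) < c := by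
  obtain ⟨m, hm⟩ := exists_nat_one_div_lt (lt_min ha (lt_min hb hc))
  exact ⟨m, hm.trans_le (min_le_left _ _),
    hm.trans_le ((min_le_right _ _).trans (min_le_left _ _)),
    hm.trans_le ((min_le_right _ _).trans (min_le_right _ _))⟩

/-- The jump direction of a function is orthogonal to every Lipschitz surface through its jump
points, at almost every parameter. The jump set is decomposed into countably many pieces on which
the blow ups are uniformly good; on each piece the increments are almost orthogonal to the jump
direction. -/
lemma ae_inner_fderiv_jump_eq_zero {d : ℕ} {g : SpaceTime d → ℝ} (hg : Measurable g)
    {J : Set (SpaceTime d)} {ν : SpaceTime d → SpaceTime d} {a b : SpaceTime d → ℝ}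
    (hab : ∀ x ∈ J, a x ≠ b x) (hν : ∀ x ∈ J, ‖ν x‖ = 1)
    (hJ : ∀ x ∈ J, HasBlowUp g x (jumpProfile (ν x) (a x) (b x)))
    (F : Space d → SpaceTime d) :
    ∀ᵐ y, F y ∈ J → DifferentiableAt ℝ F y → ∀ w, ⟪fderiv ℝ F y w, ν (F y)⟫_ℝ = 0 := by
  have hstep : ∀ δ : ℝ, 0 < δ → δ ≤ 1 → ∀ᵐ y, F y ∈ J → DifferentiableAt ℝ F y →
      ∀ w, |⟪fderiv ℝ F y w, ν (F y)⟫_ℝ| ≤ δ * ‖fderiv ℝ F y w‖ := by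
    intro δ hδ hδ1
    set η : ℕ → ℝ := fun m => 1 / ((m : ℝ) + 1) with hη
    have hη0 : ∀ m, 0 < η m := fun m => by positivity
    -- on `E m N α β` the one-sided values are within `η m` of `α` and `β`, the jump is large
    -- compared with `η m`, and the blow up is good at all scales below `η N`
    set E : ℕ → ℕ → ℚ → ℚ → Set (SpaceTime d) := fun m N α β =>
      {x | x ∈ J ∧ |a x - α| < η m ∧ |b x - β| < η m ∧ 4 * η m ≤ |(α : ℝ) - β| ∧
        (∀ l, 0 < l → l < η N →
          jumpError g (ν x) (a x) (b x) x l ≤ ENNReal.ofReal (jumpTolerance d δ (η m))) ∧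
        ENNReal.ofReal (η m) ≤ volume (Metric.ball (0 : SpaceTime d) 1 ∩ {z | 0 < ⟪z, ν x⟫_ℝ}) ∧
        ENNReal.ofReal (η m) ≤ volume (Metric.ball (0 : SpaceTime d) 1 ∩ {z | ⟪z, ν x⟫_ℝ < 0})}
      with hE
    have hcov : ∀ x ∈ J, ∃ m N α β, x ∈ E m N α β := by
      intro x hx
      have hne : ν x ≠ 0 := fun h => by have := hν x hx; rw [h, norm_zero] at this; norm_num at this
      have hv1 := measure_ball_inter_halfSpace_pos (n := ν x) hne
      have hv2 : 0 < volume (Metric.ball (0 : SpaceTime d) 1 ∩ {z | ⟪z, ν x⟫_ℝ < 0}) := by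
        simpa [inner_neg_right] using measure_ball_inter_halfSpace_pos (neg_ne_zero.2 hne)
      have hvt : ∀ H : Set (SpaceTime d), volume (Metric.ball (0 : SpaceTime d) 1 ∩ H) ≠ ⊤ :=
        fun H => ((measure_mono inter_subset_left).trans_lt measure_ball_lt_top).ne
      obtain ⟨m, hm1, hm2, hm3⟩ := exists_nat_one_div_lt_min
        (by have := abs_pos.2 (sub_ne_zero.2 (hab x hx)); positivity : 0 < |a x - b x| / 6)
        (ENNReal.toReal_pos hv1.ne' (hvt _)) (ENNReal.toReal_pos hv2.ne' (hvt _))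
      obtain ⟨α, hα1, hα2⟩ := exists_rat_btwn (show a x - η m < a x by linarith [hη0 m])
      obtain ⟨β, hβ1, hβ2⟩ := exists_rat_btwn (show b x - η m < b x by linarith [hη0 m])
      have hα : |a x - α| < η m := abs_lt.2 ⟨by linarith [hη0 m], by linarith⟩
      have hβ : |b x - β| < η m := abs_lt.2 ⟨by linarith [hη0 m], by linarith⟩
      have htol : 0 < ENNReal.ofReal (jumpTolerance d δ (η m)) := by
        have := hη0 m
        rw [ENNReal.ofReal_pos, jumpTolerance]; positivity
      obtain ⟨ε, hε, hεs⟩ := mem_nhdsGT_iff_exists_Ioo_subset.1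
        (ENNReal.tendsto_nhds_zero.1 (hJ x hx) _ htol)
      obtain ⟨N, hN⟩ := exists_nat_one_div_lt (show (0 : ℝ) < ε from hε)
      refine ⟨m, N, α, β, hx, hα, hβ, ?_, fun l hl hlN => hεs ⟨hl, hlN.trans hN⟩, ?_, ?_⟩
      · have h1 : a x - b x = (α - β) + (a x - α) - (b x - β) := by ring
        have h2 : |a x - b x| ≤ |(α : ℝ) - β| + |a x - α| + |b x - β| := by
          rw [h1]; exact (abs_sub _ _).trans (by gcongr; exact abs_add_le _ _)
        change 1 / ((m : ℝ) + 1) < _ at hm1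
        have h3 : η m < |a x - b x| / 6 := hm1
        linarith
      · exact ENNReal.ofReal_le_of_le_toReal hm2.le
      · exact ENNReal.ofReal_le_of_le_toReal hm3.le
    have hEpiece : ∀ m N α β, ∀ᵐ y, F y ∈ E m N α β → DifferentiableAt ℝ F y →
        ∀ w, |⟪fderiv ℝ F y w, ν (F y)⟫_ℝ| ≤ δ * ‖fderiv ℝ F y w‖ := by
      intro m N α β
      refine ae_abs_inner_fderiv_le_of_cone (half_pos (hη0 N)) ?_
      rintro x ⟨hxJ, hxa, hxb, hαβ, hxe, -, -⟩ y ⟨-, hya, hyb, -, hye, hy1, hy2⟩ hxy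
      exact abs_inner_sub_le_of_jumpError_le hg hδ hδ1 (hη0 m) hxa hxb hya hyb hαβ hxe hye hy1 hy2
        (hν x hxJ) (by linarith)
    filter_upwards [ae_all_iff.2 fun m => ae_all_iff.2 fun N => ae_all_iff.2 fun α =>
      ae_all_iff.2 fun β => hEpiece m N α β] with y hy hyJ
    obtain ⟨m, N, α, β, h⟩ := hcov _ hyJ
    exact hy m N α β h
  filter_upwards [ae_all_iff.2 fun j : ℕ => hstep (1 / ((j : ℝ) + 1)) (by positivity)
    (div_le_one_of_le₀ (by linarith [j.cast_nonneg (α := ℝ)]) (by positivity))]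
    with y hy hyJ hdiff w
  have hlim := (tendsto_one_div_add_atTop_nhds_zero_nat (𝕜 := ℝ)).mul_const ‖fderiv ℝ F y w‖
  rw [zero_mul] at hlim
  exact abs_nonpos_iff.1 (ge_of_tendsto' hlim fun j => hy j hyJ hdiff w)

/-- A hyperplane has exactly two unit normals. -/
lemma eq_or_eq_neg_of_orthogonal {d : ℕ} {A : Space d →L[ℝ] SpaceTime d}
    (hA : Function.Injective A) {n ν : SpaceTime d} (hn : ‖n‖ = 1) (hν : ‖ν‖ = 1)
    (hAn : ∀ w, ⟪n, A w⟫_ℝ = 0) (hAν : ∀ w, ⟪A w, ν⟫_ℝ = 0) : ν = n ∨ ν = -n := by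
  set R := LinearMap.range A.toLinearMap with hR
  have h1 := Submodule.finrank_add_finrank_orthogonal R
  rw [hR, LinearMap.finrank_range_of_inj hA, ← hR] at h1
  simp only [finrank_euclideanSpace, Fintype.card_fin] at h1
  have h2 : Module.finrank ℝ Rᗮ = 1 := by omega
  have hnR : n ∈ Rᗮ := by
    rw [Submodule.mem_orthogonal']
    rintro _ ⟨w, rfl⟩
    exact hAn w
  have hνR : ν ∈ Rᗮ := by
    rw [Submodule.mem_orthogonal]
    rintro _ ⟨w, rfl⟩
    exact hAν w
  have hn0 : (⟨n, hnR⟩ : Rᗮ) ≠ 0 := by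
    intro h
    have : n = 0 := congrArg Subtype.val h
    rw [this, norm_zero] at hn
    norm_num at hn
  obtain ⟨c, hc⟩ := (finrank_eq_one_iff_of_nonzero' _ hn0).1 h2 ⟨ν, hνR⟩
  have hc' : c • n = ν := congrArg Subtype.val hc
  have hc1 : |c| = 1 := by
    rw [← hc', norm_smul, hn, mul_one] at hν
    exact hν
  rcases abs_eq (zero_le_one' ℝ) |>.1 hc1 with h | h
  · left; rw [← hc', h, one_smul]
  · right; rw [← hc', h, neg_one_smul]

/-- Reversing the normal exchanges the two values, except on the hyperplane itself, where
`jumpProfile` takes the first value for both orientations. -/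
lemma jumpProfile_neg_ae_eq {d : ℕ} {V : Type*} {n : SpaceTime d} (hn : n ≠ 0) (a b : V) :
    jumpProfile (-n) a b =ᵐ[volume] jumpProfile n b a := by
  have hnull : volume ((ℝ ∙ n)ᗮ : Set (SpaceTime d)) = 0 := by
    refine Measure.addHaar_submodule _ _ fun h => hn ?_
    rw [Submodule.orthogonal_eq_top_iff] at h
    simpa using h
  filter_upwards [measure_eq_zero_iff_ae_notMem.1 hnull] with z hz
  have hz' : ⟪z, n⟫_ℝ ≠ 0 := fun h => hz <| by
    rw [SetLike.mem_coe, Submodule.mem_orthogonal_singleton_iff_inner_left]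
    exact h
  simp only [jumpProfile, inner_neg_right, Left.nonneg_neg_iff]
  rcases lt_or_gt_of_ne hz' with h | h
  · rw [if_pos h.le, if_neg (not_le.2 h)]
  · rw [if_neg (not_le.2 h), if_pos h.le]

/-! ### One-sided traces -/

/-- Bilateral traces of a scalar function on a rectifiable set give one-sided traces with respect
to a unit normal of the set. -/
lemma HasBilateralTraces.ae_exists_hasBlowUp {d : ℕ} {g : SpaceTime d → ℝ} (hg : Measurable g)
    {S : Set (SpaceTime d)} (hS : IsRectifiableSet S) {n : SpaceTime d → SpaceTime d}
    (hn : IsUnitNormal S n) (hgS : HasBilateralTraces g S) :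
    ∀ᵐ x ∂μHE[d], x ∈ S → ∃ a b : ℝ, HasBlowUp g x (jumpProfile (n x) a b) := by
  obtain ⟨F, hF, hnull⟩ := hS.cover
  choose C hC using hF
  set J : Set (SpaceTime d) := {x | IsJumpPoint g x} with hJdef
  have hJ : ∀ x, ∃ (a b : ℝ) (ν : SpaceTime d), x ∈ J →
      a ≠ b ∧ ‖ν‖ = 1 ∧ HasBlowUp g x (jumpProfile ν a b) := by
    intro x
    by_cases hx : x ∈ J
    · obtain ⟨a, b, ν, h⟩ := hx
      exact ⟨a, b, ν, fun _ => h⟩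
    · exact ⟨0, 0, 0, fun h => absurd h hx⟩
  choose a b ν hJ using hJ
  have hpar : ∀ i, ∀ᵐ y, (F i y ∈ J → DifferentiableAt ℝ (F i) y →
      ∀ w, ⟪fderiv ℝ (F i) y w, ν (F i y)⟫_ℝ = 0) ∧ (F i y ∈ S →
      Function.Injective (fderiv ℝ (F i) y) → ∀ w, ⟪n (F i y), fderiv ℝ (F i) y w⟫_ℝ = 0) :=
    fun i => (ae_inner_fderiv_jump_eq_zero hg (fun x hx => (hJ x hx).1) (fun x hx => (hJ x hx).2.1)
      (fun x hx => (hJ x hx).2.2) (F i)).and (hn.orthogonal (F i) (C i) (hC i))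
  have h1 := fun i => measure_eq_zero_iff_ae_notMem.1
    (euclideanHausdorffMeasure_image_eq_zero_of_volume_eq_zero (hC i) (ae_iff.1 (hpar i)))
  have h2 := fun i => measure_eq_zero_iff_ae_notMem.1
    (euclideanHausdorffMeasure_image_not_immersed_eq_zero (hC i))
  filter_upwards [ae_all_iff.2 h1, ae_all_iff.2 h2, measure_eq_zero_iff_ae_notMem.1 hnull,
    hn.norm_eq_one, hgS] with x hx1 hx2 hx3 hx4 hx5 hxS
  rcases hx5 hxS with ⟨c, hc⟩ | hxJ
  · refine ⟨c, c, ?_⟩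
    have : jumpProfile (n x) c c = fun _ => c := by ext z; simp [jumpProfile]
    rwa [this]
  · obtain ⟨i, y, rfl⟩ : ∃ i y, F i y = x := by
      by_contra! hne
      exact hx3 ⟨hxS, fun h => by
        obtain ⟨i, y, hy⟩ := mem_iUnion.1 h
        exact hne i y hy⟩
    have hgood := not_not.1 fun h => hx1 i ⟨y, h, rfl⟩
    have himm := not_not.1 fun h => hx2 i ⟨y, h, rfl⟩
    obtain ⟨-, hν1, hbl⟩ := hJ _ hxJ
    rcases eq_or_eq_neg_of_orthogonal himm.2 (hx4 hxS) hν1 (hgood.2 hxS himm.2)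
      (hgood.1 hxJ himm.1) with h | h
    · rw [h] at hbl
      exact ⟨_, _, hbl⟩
    · rw [h] at hbl
      have hne : n (F i y) ≠ 0 := fun h0 => by
        have := hx4 hxS
        rw [h0, norm_zero] at this
        norm_num at this
      exact ⟨_, _, hbl.congr_right (jumpProfile_neg_ae_eq hne _ _)⟩

lemma HasBlowUp.of_components {d : ℕ} {v : SpaceTime d → Space d} (hv : Measurable v)
    {x n : SpaceTime d} {a b : Space d}
    (h : ∀ i, HasBlowUp (fun z => v z i) x (jumpProfile n (a i) (b i))) :
    HasBlowUp v x (jumpProfile n a b) := by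
  have hsum := tendsto_finsetSum Finset.univ fun i (_ : i ∈ Finset.univ) => h i
  rw [Finset.sum_const_zero] at hsum
  refine tendsto_of_tendsto_of_tendsto_of_le_of_le tendsto_const_nhds hsum (fun _ => zero_le) ?_
  intro l
  dsimp only
  rw [← lintegral_finsetSum]
  · refine lintegral_mono fun z => ?_
    have hle : ∀ w : Space d, ‖w‖ₑ ≤ ∑ i, ‖w i‖ₑ := by
      intro w
      have h1 : w = ∑ i, EuclideanSpace.single i (w i) := by
        ext j; simp
      calc ‖w‖ₑ = ‖∑ i, EuclideanSpace.single i (w i)‖ₑ := by rw [← h1]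
        _ ≤ ∑ i, ‖EuclideanSpace.single i (w i)‖ₑ := enorm_sum_le _ _
        _ = _ := by simp [enorm]
    refine (hle _).trans (le_of_eq (Finset.sum_congr rfl fun i _ => ?_))
    rw [PiLp.sub_apply, jumpProfile_comp n a b (fun w : Space d => w i) z]
  · intro i _
    have := measurable_jumpProfile n (a i) (b i)
    fun_prop

lemma exists_traces_of_ae {d : ℕ} {V : Type*} [NormedAddCommGroup V] {S : Set (SpaceTime d)}
    {n : SpaceTime d → SpaceTime d} {g : SpaceTime d → V}
    (h : ∀ᵐ x ∂μHE[d], x ∈ S → ∃ a b : V, HasBlowUp g x (jumpProfile (n x) a b)) :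
    ∃ gp gm : SpaceTime d → V, AreTraces S n g gp gm := by
  classical
  refine ⟨fun x => if hx : ∃ a b : V, HasBlowUp g x (jumpProfile (n x) a b)
      then hx.choose else 0,
    fun x => if hx : ∃ a b : V, HasBlowUp g x (jumpProfile (n x) a b)
      then hx.choose_spec.choose else 0, ?_⟩
  filter_upwards [h] with x hx hxS
  have := hx hxS
  simp only [dif_pos this]
  exact this.choose_spec.choose_spec

lemma AreTraces.congr_ae {d : ℕ} {V : Type*} [NormedAddCommGroup V] {Q S : Set (SpaceTime d)}
    (hQ : IsOpen Q) (hSQ : S ⊆ Q) {n : SpaceTime d → SpaceTime d} {g g' gp gm : SpaceTime d → V}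
    (hg : g =ᵐ[volume.restrict Q] g') (h : AreTraces S n g gp gm) : AreTraces S n g' gp gm := by
  filter_upwards [h] with x hx hxS
  exact (hx hxS).congr_ae hQ (hSQ hxS) hg

lemma HasBilateralTraces.congr_ae {d : ℕ} {Q S : Set (SpaceTime d)} (hQ : IsOpen Q) (hSQ : S ⊆ Q)
    {g g' : SpaceTime d → ℝ} (hg : g =ᵐ[volume.restrict Q] g') (h : HasBilateralTraces g S) :
    HasBilateralTraces g' S := by
  filter_upwards [h] with x hx hxS
  rcases hx hxS with ⟨c, hc⟩ | ⟨a, b, ν, hab, hν, hb⟩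
  · exact Or.inl ⟨c, hc.congr_ae hQ (hSQ hxS) hg⟩
  · exact Or.inr ⟨a, b, ν, hab, hν, hb.congr_ae hQ (hSQ hxS) hg⟩

/-- An essentially bounded function with bilateral traces has one-sided traces. -/
lemma HasBilateralTraces.exists_traces {d : ℕ} {Q S : Set (SpaceTime d)} (hQ : IsOpen Q)
    (hSQ : S ⊆ Q) (hS : IsRectifiableSet S) {n : SpaceTime d → SpaceTime d}
    (hn : IsUnitNormal S n) {g : SpaceTime d → ℝ} (hg : MemLp g ⊤ (volume.restrict Q))
    (h : HasBilateralTraces g S) : ∃ gp gm, AreTraces S n g gp gm := by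
  obtain ⟨g', -, hm, -, hae⟩ := exists_bounded_measurable_rep hg
  obtain ⟨gp, gm, ht⟩ := exists_traces_of_ae ((h.congr_ae hQ hSQ hae).ae_exists_hasBlowUp hm hS hn)
  exact ⟨gp, gm, ht.congr_ae hQ hSQ hae.symm⟩

lemma HasBilateralTracesVec.exists_traces {d : ℕ} {Q S : Set (SpaceTime d)} (hQ : IsOpen Q)
    (hSQ : S ⊆ Q) (hS : IsRectifiableSet S) {n : SpaceTime d → SpaceTime d}
    (hn : IsUnitNormal S n) {v : SpaceTime d → Space d} (hv : MemLp v ⊤ (volume.restrict Q))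
    (h : HasBilateralTracesVec v S) : ∃ vp vm, AreTraces S n v vp vm := by
  obtain ⟨v', -, hm, -, hae⟩ := exists_bounded_measurable_rep hv
  have hcomp : ∀ i, ∀ᵐ x ∂μHE[d], x ∈ S →
      ∃ a b : ℝ, HasBlowUp (fun z => v' z i) x (jumpProfile (n x) a b) := by
    intro i
    have h1 : HasBilateralTraces (fun z => v z i) S := by
      filter_upwards [h] with x hx hxS using hx hxS i
    refine (h1.congr_ae hQ hSQ ?_).ae_exists_hasBlowUp (by fun_prop) hS hn
    filter_upwards [hae] with z hz
    rw [hz]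
  obtain ⟨vp, vm, ht⟩ : ∃ vp vm, AreTraces S n v' vp vm := by
    refine exists_traces_of_ae ?_
    filter_upwards [ae_all_iff.2 hcomp] with x hx hxS
    choose a b hab using fun i => hx i hxS
    exact ⟨WithLp.toLp 2 a, WithLp.toLp 2 b, HasBlowUp.of_components hm hab⟩
  exact ⟨vp, vm, ht.congr_ae hQ hSQ hae.symm⟩

/-! ### The internal energy -/

lemma intervalIntegrable_div_sq {p : ℝ → ℝ} (hp : Continuous p) {a b : ℝ} (ha : 0 < a)
    (hb : 0 < b) : IntervalIntegrable (fun s => p s / s ^ 2) volume a b := by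
  refine ContinuousOn.intervalIntegrable fun s hs => ?_
  have hs0 : 0 < s := (lt_min ha hb).trans_le hs.1
  exact (hp.continuousAt.div (by fun_prop) (by positivity)).continuousWithinAt

/-- The internal energy vanishes continuously at vacuum, because the pressure does. -/
lemma tendsto_internalEnergy_zero {p : ℝ → ℝ} (hp : Continuous p) (hp0 : p 0 = 0) :
    Tendsto (internalEnergy p) (𝓝 0) (𝓝 0) := by
  rw [Metric.tendsto_nhds]
  intro ε hε
  obtain ⟨K, hK, hpK⟩ := exists_norm_sub_le_add_mul hp 1 (half_pos hε)
  have hbound : ∀ r : ℝ, 0 < r → r ≤ 1 → |internalEnergy p r| ≤ ε / 2 + K * |r * Real.log r| := by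
    intro r hr hr1
    rw [internalEnergy, if_pos hr, intervalIntegral.integral_symm, mul_neg, abs_neg, abs_mul,
      abs_of_pos hr]
    have hpos : ∀ s ∈ uIcc r 1, 0 < s := fun s hs => by
      rw [uIcc_of_le hr1] at hs; exact hr.trans_le hs.1
    have hint : IntervalIntegrable (fun s : ℝ => ε / 2 / s ^ 2 + K / s) volume r 1 := by
      refine ContinuousOn.intervalIntegrable fun s hs => ?_
      have hs0 := hpos s hs
      exact ((continuousAt_const.div (by fun_prop) (by positivity)).add
        (continuousAt_const.div continuousAt_id hs0.ne')).continuousWithinAt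
    have h1 : |∫ s in r..1, p s / s ^ 2| ≤ ∫ s in r..1, (ε / 2 / s ^ 2 + K / s) := by
      rw [← Real.norm_eq_abs]
      refine intervalIntegral.norm_integral_le_of_norm_le hr1
        (Eventually.of_forall fun s hs => ?_) hint
      have hs0 : 0 < s := hr.trans hs.1
      have := hpK s 0 (by rw [Real.norm_of_nonneg hs0.le]; exact hs.2) (by simp)
      rw [hp0, sub_zero, sub_zero, Real.norm_of_nonneg hs0.le] at this
      rw [norm_div, norm_pow, Real.norm_of_nonneg hs0.le]
      calc ‖p s‖ / s ^ 2 ≤ (ε / 2 + K * s) / s ^ 2 := by gcongr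
        _ = _ := by field_simp
    have h2 : ∫ s in r..1, (ε / 2 / s ^ 2 + K / s)
        = (-(ε / 2) / 1 + K * Real.log 1) - (-(ε / 2) / r + K * Real.log r) := by
      refine intervalIntegral.integral_eq_sub_of_hasDerivAt
        (f := fun s => -(ε / 2) / s + K * Real.log s) (fun s hs => ?_) hint
      have hs0 := hpos s hs
      have h3 := ((hasDerivAt_inv hs0.ne').const_mul (-(ε / 2))).add
        ((Real.hasDerivAt_log hs0.ne').const_mul K)
      refine h3.congr_deriv ?_
      field_simp
    rw [h2] at h1
    calc r * |∫ s in r..1, p s / s ^ 2|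
        ≤ r * ((-(ε / 2) / 1 + K * Real.log 1) - (-(ε / 2) / r + K * Real.log r)) := by gcongr
      _ = ε / 2 - r * (ε / 2) - K * (r * Real.log r) := by
          rw [Real.log_one]; field_simp; ring
      _ ≤ ε / 2 + K * |r * Real.log r| := by
          have h3 : -(K * (r * Real.log r)) ≤ K * |r * Real.log r| := by
            rw [← mul_neg]; gcongr; exact neg_le_abs _
          have : 0 < r * (ε / 2) := by positivity
          linarith
  have hlog : Tendsto (fun r : ℝ => K * |r * Real.log r|) (𝓝 0) (𝓝 0) := by
    have := (Real.continuous_mul_log.tendsto 0).abs.const_mul K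
    simpa using this
  filter_upwards [Metric.tendsto_nhds.1 hlog (ε / 2) (half_pos hε),
    Iio_mem_nhds (zero_lt_one' ℝ)] with r hr hr1
  rw [Real.dist_eq, sub_zero] at hr ⊢
  rcases le_or_gt r 0 with h | h
  · rw [internalEnergy, if_neg h.not_gt, abs_zero]; exact hε
  · have := hbound r h (le_of_lt hr1)
    have := le_abs_self (K * |r * Real.log r|)
    linarith

lemma continuous_internalEnergy {p : ℝ → ℝ} (hp : Continuous p) (hp0 : p 0 = 0) :
    Continuous (internalEnergy p) := by
  rw [continuous_iff_continuousAt]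
  intro r
  rcases lt_trichotomy r 0 with h | h | h
  · refine (continuousAt_const (y := (0 : ℝ))).congr ?_
    filter_upwards [Iio_mem_nhds h] with s hs
    rw [internalEnergy, if_neg (not_lt.2 (le_of_lt hs))]
  · rw [h, ContinuousAt]
    have : internalEnergy p 0 = 0 := by simp [internalEnergy]
    rw [this]
    exact tendsto_internalEnergy_zero hp hp0
  · have hc : ContinuousAt (fun s => p s / s ^ 2) r :=
      hp.continuousAt.div (by fun_prop) (by positivity)
    have hm : StronglyMeasurableAtFilter (fun s => p s / s ^ 2) (𝓝 r) volume :=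
      (hp.measurable.div (by fun_prop)).stronglyMeasurable.stronglyMeasurableAtFilter
    have hd := intervalIntegral.integral_hasDerivAt_right
      (intervalIntegrable_div_sq hp one_pos h) hm hc
    refine (continuousAt_id.mul hd.continuousAt).congr ?_
    filter_upwards [Ioi_mem_nhds h] with s hs
    rw [internalEnergy, if_pos (show 0 < s from hs)]
    rfl

/-! ### The jump relations -/

/-- The contribution of the internal energy to the jump of the energy flux, where `α` and `β` are
the normal components `n_t + u_n` of the space-time velocity on the two sides. -/
lemma internalEnergy_jump {p : ℝ → ℝ} (hp : Continuous p) {r s α β : ℝ}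
    (hr : 0 ≤ r) (hs : 0 ≤ s) (hmass : r * α = s * β) :
    internalEnergy p r * α - internalEnergy p s * β
      = (α - β) * (bigPi p r s - (p r + p s) / 2) := by
  have hzero : internalEnergy p 0 = 0 := by simp [internalEnergy]
  rcases hr.eq_or_lt with rfl | hr0
  · have hPi : bigPi p 0 s = (p 0 + p s) / 2 := by simp [bigPi]
    rw [hPi, hzero, sub_self, mul_zero, zero_mul, zero_sub, neg_eq_zero]
    rcases hs.eq_or_lt with rfl | hs0
    · rw [hzero, zero_mul]
    · have : β = 0 := by
        rw [zero_mul] at hmass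
        exact (mul_eq_zero.1 hmass.symm).resolve_left hs0.ne'
      rw [this, mul_zero]
  rcases hs.eq_or_lt with rfl | hs0
  · have hPi : bigPi p r 0 = (p r + p 0) / 2 := by simp [bigPi]
    have : α = 0 := by
      rw [zero_mul] at hmass
      exact (mul_eq_zero.1 hmass).resolve_left hr0.ne'
    rw [hPi, hzero, this]; ring
  by_cases hrs : r = s
  · subst hrs
    have : α = β := mul_left_cancel₀ hr0.ne' hmass
    rw [this]; ring
  · have hPi : bigPi p r s = (p r + p s) / 2 - r * s / (r - s) * ∫ t in s..r, p t / t ^ 2 := by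
      rw [bigPi, if_pos ⟨hr0, hs0, hrs⟩]
    have hI : ∫ t in s..r, p t / t ^ 2
        = (∫ t in (1 : ℝ)..r, p t / t ^ 2) - ∫ t in (1 : ℝ)..s, p t / t ^ 2 :=
      (intervalIntegral.integral_interval_sub_left (intervalIntegrable_div_sq hp one_pos hr0)
        (intervalIntegrable_div_sq hp one_pos hs0)).symm
    rw [hPi, hI, internalEnergy, internalEnergy, if_pos hr0, if_pos hs0]
    have hsub : r - s ≠ 0 := sub_ne_zero.2 hrs
    -- the mass flux `r α = s β` equals `-(α - β) r s / (r - s)`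
    have hm : (α - β) * (r * s / (r - s)) = -(r * α) := by
      rw [mul_div_assoc', div_eq_iff hsub]
      linear_combination r * hmass
    generalize (∫ t in (1 : ℝ)..r, p t / t ^ 2) = A
    generalize (∫ t in (1 : ℝ)..s, p t / t ^ 2) = B
    linear_combination B * hmass + (A - B) * hm

/-- The jump of the energy flux, computed from the continuity of the mass and momentum fluxes. -/
lemma energy_jump {d : ℕ} {p : ℝ → ℝ} (hp : Continuous p) {r s τ : ℝ}
    (hr : 0 ≤ r) (hs : 0 ≤ s) {U V ν : Space d}
    (hmass : r * (τ + ⟪U, ν⟫_ℝ) = s * (τ + ⟪V, ν⟫_ℝ))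
    (hmom : ∀ i, r * U i * (τ + ⟪U, ν⟫_ℝ) + p r * ν i
      = s * V i * (τ + ⟪V, ν⟫_ℝ) + p s * ν i) :
    (energyDensity p r U * (τ + ⟪U, ν⟫_ℝ) + p r * ⟪U, ν⟫_ℝ)
        - (energyDensity p s V * (τ + ⟪V, ν⟫_ℝ) + p s * ⟪V, ν⟫_ℝ)
      = (⟪U, ν⟫_ℝ - ⟪V, ν⟫_ℝ) * bigPi p r s := by
  have hint := internalEnergy_jump hp hr hs hmass
  set m := r * (τ + ⟪U, ν⟫_ℝ) with hm
  have hvec : m • (U - V) = (p s - p r) • ν := by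
    ext i
    simp only [PiLp.smul_apply, PiLp.sub_apply, smul_eq_mul]
    linear_combination hmom i - V i * hmass
  have hdot := congrArg (fun w : Space d => ⟪w, U + V⟫_ℝ) hvec
  simp only [inner_smul_left, conj_trivial, inner_sub_left, inner_add_right,
    real_inner_self_eq_norm_sq, real_inner_comm U V, real_inner_comm U ν,
    real_inner_comm V ν] at hdot
  rw [energyDensity, energyDensity]
  linear_combination hint + hdot / 2 + ‖V‖ ^ 2 / 2 * hmass

/-! ### The balance laws of the Euler system -/

lemma fderiv_stack {d : ℕ} (φ : SpaceTime d → ℝ) (z : SpaceTime d) (c : ℝ) (w : Space d) :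
    fderiv ℝ φ z (stack c w) = c * timeDeriv φ z + ⟪w, spaceGrad φ z⟫_ℝ := by
  have h : stack c w = c • EuclideanSpace.single 0 (1 : ℝ)
      + ∑ i, w i • EuclideanSpace.single (Fin.succ i) (1 : ℝ) := by
    ext j
    refine Fin.cases ?_ (fun k => ?_) j
    · simp [Fin.succ_ne_zero]
    · simp [Pi.single_apply]
  rw [h, map_add, map_sum, map_smul]
  simp only [map_smul, smul_eq_mul, timeDeriv, spaceGrad, PiLp.inner_apply]
  simp [mul_comm]

/-- The energy flux in space-time, as a function of the density and the velocity. -/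
def energyFlux {d : ℕ} (p : ℝ → ℝ) (w : ℝ × Space d) : SpaceTime d :=
  stack (energyDensity p w.1 w.2) ((energyDensity p w.1 w.2 + p w.1) • w.2)

/-- The flux in space-time of the `i`-th component of momentum. -/
def momentumFlux {d : ℕ} (p : ℝ → ℝ) (i : Fin d) (w : ℝ × Space d) : SpaceTime d :=
  stack (w.1 * w.2 i) ((w.1 * w.2 i) • w.2 + p w.1 • EuclideanSpace.single i 1)

/-- The mass flux in space-time. -/
def massFlux {d : ℕ} (w : ℝ × Space d) : SpaceTime d := stack w.1 (w.1 • w.2)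

lemma continuous_energyFlux {d : ℕ} {p : ℝ → ℝ} (hp : Continuous p) (hp0 : p 0 = 0) :
    Continuous (energyFlux (d := d) p) := by
  have hP := continuous_internalEnergy hp hp0
  have hE : Continuous fun w : ℝ × Space d => energyDensity p w.1 w.2 := by
    unfold energyDensity; fun_prop
  exact continuous_stack.comp (hE.prodMk (by fun_prop))

lemma continuous_momentumFlux {d : ℕ} {p : ℝ → ℝ} (hp : Continuous p) (i : Fin d) :
    Continuous (momentumFlux p i) :=
  continuous_stack.comp (Continuous.prodMk (by fun_prop) (by fun_prop))

lemma continuous_massFlux {d : ℕ} : Continuous (massFlux (d := d)) := by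
  have h : Continuous fun w : ℝ × Space d => w.1 • w.2 := by fun_prop
  exact continuous_stack.comp (continuous_fst.prodMk h)

lemma inner_energyFlux {d : ℕ} (p : ℝ → ℝ) (w : ℝ × Space d) (n : SpaceTime d) :
    ⟪energyFlux p w, n⟫_ℝ = energyDensity p w.1 w.2 * (n 0 + ⟪w.2, spacePart n⟫_ℝ)
      + p w.1 * ⟪w.2, spacePart n⟫_ℝ := by
  rw [energyFlux, inner_eq_coord]
  simp only [stack_zero, spacePart_stack, inner_smul_left, conj_trivial]
  ring

lemma inner_momentumFlux {d : ℕ} (p : ℝ → ℝ) (i : Fin d) (w : ℝ × Space d) (n : SpaceTime d) :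
    ⟪momentumFlux p i w, n⟫_ℝ = w.1 * w.2 i * (n 0 + ⟪w.2, spacePart n⟫_ℝ)
      + p w.1 * spacePart n i := by
  rw [momentumFlux, inner_eq_coord]
  simp only [stack_zero, spacePart_stack, inner_add_left, inner_smul_left, conj_trivial,
    EuclideanSpace.inner_single_left, one_mul]
  ring

lemma inner_massFlux {d : ℕ} (w : ℝ × Space d) (n : SpaceTime d) :
    ⟪massFlux w, n⟫_ℝ = w.1 * (n 0 + ⟪w.2, spacePart n⟫_ℝ) := by
  rw [massFlux, inner_eq_coord]
  simp only [stack_zero, spacePart_stack, inner_smul_left, conj_trivial]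
  ring

lemma isOpen_domain {d : ℕ} (T : ℝ) {Ω : Set (Space d)} (hΩ : IsOpen Ω) :
    IsOpen (domain T Ω) := by
  have h0 : Continuous fun z : SpaceTime d => z 0 := by fun_prop
  exact (isOpen_lt continuous_const h0).inter
    ((isOpen_lt h0 continuous_const).inter (hΩ.preimage continuous_spacePart))

section Euler

variable {d : ℕ} {Q : Set (SpaceTime d)} {p : ℝ → ℝ} {ρ ρ' : SpaceTime d → ℝ}
  {u u' f : SpaceTime d → Space d}

/-- The definition of the dissipation as a balance law; `ρ` and `u` may be replaced by other
representatives. -/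
lemma isBalance_energy (D : SignedRadonMeasure Q) (hD : D.Represents (dissipation Q p ρ u f))
    (hρ : ρ =ᵐ[volume.restrict Q] ρ') (hu : u =ᵐ[volume.restrict Q] u') :
    IsBalance Q D.pos D.neg (fun z => energyFlux p (ρ' z, u' z))
      (fun z => ρ' z * ⟪f z, u' z⟫_ℝ) := by
  intro φ hφ
  rw [hD φ hφ, dissipation]
  refine integral_congr_ae ?_
  filter_upwards [hρ, hu] with z h1 h2
  simp only [energyFlux, fderiv_stack, inner_smul_left, conj_trivial, h1, h2]

lemma isBalance_momentum (h : IsWeakSolution Q p ρ u f)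
    (hρ : ρ =ᵐ[volume.restrict Q] ρ') (hu : u =ᵐ[volume.restrict Q] u') (i : Fin d) :
    IsBalance Q 0 0 (fun z => momentumFlux p i (ρ' z, u' z)) (fun z => ρ' z * f z i) := by
  intro φ hφ
  simp only [integral_zero_measure, sub_self]
  rw [← h.momentum φ hφ i]
  refine integral_congr_ae ?_
  filter_upwards [hρ, hu] with z h1 h2
  simp only [momentumFlux, fderiv_stack, inner_add_left, inner_smul_left, conj_trivial, h1, h2,
    EuclideanSpace.inner_single_left, one_mul]
  ring

lemma isBalance_mass (h : IsWeakSolution Q p ρ u f)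
    (hρ : ρ =ᵐ[volume.restrict Q] ρ') (hu : u =ᵐ[volume.restrict Q] u') :
    IsBalance Q 0 0 (fun z => massFlux (ρ' z, u' z)) 0 := by
  intro φ hφ
  simp only [integral_zero_measure, sub_self]
  rw [← h.continuity φ hφ]
  refine integral_congr_ae ?_
  filter_upwards [hρ, hu] with z h1 h2
  simp only [massFlux, fderiv_stack, inner_smul_left, conj_trivial, h1, h2, Pi.zero_apply,
    zero_mul, add_zero]

lemma integrableOn_mul_inner {v : SpaceTime d → Space d} {M M' : ℝ}
    (hf : MemLp f 1 (volume.restrict Q)) (hρm : Measurable ρ) (hρM : ∀ z, ‖ρ z‖ ≤ M)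
    (hvm : Measurable v) (hvM : ∀ z, ‖v z‖ ≤ M') :
    IntegrableOn (fun z => ρ z * ⟪f z, v z⟫_ℝ) Q := by
  have hfi : Integrable f (volume.restrict Q) := memLp_one_iff_integrable.1 hf
  have hM : 0 ≤ M := (norm_nonneg _).trans (hρM 0)
  refine (hfi.norm.const_mul (M * M')).mono'
    (hρm.aestronglyMeasurable.mul (hfi.1.inner hvm.aestronglyMeasurable))
    (Eventually.of_forall fun z => ?_)
  rw [norm_mul]
  calc ‖ρ z‖ * ‖⟪f z, v z⟫_ℝ‖ ≤ M * (‖f z‖ * M') := by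
        gcongr
        · exact hρM z
        · exact (norm_inner_le_norm _ _).trans (by gcongr; exact hvM z)
    _ = M * M' * ‖f z‖ := by ring

end Euler

lemma exists_bound_comp {X V W : Type*} [NormedAddCommGroup V] [ProperSpace V]
    [NormedAddCommGroup W] {Φ : V → W} (hΦ : Continuous Φ) {w : X → V} {M : ℝ}
    (hw : ∀ z, ‖w z‖ ≤ M) : ∃ M', ∀ z, ‖Φ (w z)‖ ≤ M' := by
  obtain ⟨C, hC⟩ := (isCompact_closedBall (0 : V) M).exists_bound_of_continuousOn hΦ.continuousOn
  exact ⟨C, fun z => hC _ (by simpa using hw z)⟩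

lemma SignedRadonMeasure.RestrictEq.congr_ae {d : ℕ} {Q S : Set (SpaceTime d)}
    {μ : SignedRadonMeasure Q} {g g' : SpaceTime d → ℝ} (hS : NullMeasurableSet S μHE[d])
    (h : μ.RestrictEq S g) (hg : ∀ᵐ x ∂μHE[d], x ∈ S → g x = g' x) : μ.RestrictEq S g' := by
  intro B K hB hK hKQ hBK
  obtain ⟨h1, h2⟩ := h B K hB hK hKQ hBK
  have hae : g =ᵐ[(μHE[d] : Measure (SpaceTime d)).restrict (B ∩ S)] g' := by
    refine (ae_restrict_iff'₀ (hB.nullMeasurableSet.inter hS)).2 ?_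
    filter_upwards [hg] with x hx hxB using hx hxB.2
  exact ⟨h1.congr_fun_ae hae, by rw [h2]; exact integral_congr_ae hae⟩

/-- The dissipation on a rectifiable set, in terms of any one-sided traces. -/
lemma restrictEq_of_areTraces {d : ℕ} {Q : Set (SpaceTime d)} (hQ : IsOpen Q) {p : ℝ → ℝ}
    (hp : Continuous p) (hp0 : p 0 = 0) {ρ : SpaceTime d → ℝ} {u f : SpaceTime d → Space d}
    (hρ : MemLp ρ ⊤ (volume.restrict Q)) (hu : MemLp u ⊤ (volume.restrict Q))
    (hf : MemLp f 1 (volume.restrict Q)) (hsol : IsWeakSolution Q p ρ u f)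
    (D : SignedRadonMeasure Q) (hD : D.Represents (dissipation Q p ρ u f))
    {S : Set (SpaceTime d)} (hSQ : S ⊆ Q) (hS : IsRectifiableSet S)
    {n : SpaceTime d → SpaceTime d} (hn : ∀ᵐ x ∂μHE[d], x ∈ S → ‖n x‖ = 1)
    {ρp ρm : SpaceTime d → ℝ} {up um : SpaceTime d → Space d}
    (hρt : AreTraces S n ρ ρp ρm) (hut : AreTraces S n u up um) :
    D.RestrictEq S fun x => -(⟪up x, spacePart (n x)⟫_ℝ - ⟪um x, spacePart (n x)⟫_ℝ)
      * bigPi p (ρp x) (ρm x) := by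
  obtain ⟨ρ₀, M, hρ₀m, hρ₀M, hρ₀⟩ := exists_bounded_measurable_rep hρ
  obtain ⟨u', M', hum, huM, hu'⟩ := exists_bounded_measurable_rep hu
  -- a bounded representative of the density that is nonnegative everywhere
  set ρ' : SpaceTime d → ℝ := fun z => max 0 (ρ₀ z) with hρ'def
  have hρm : Measurable ρ' := measurable_const.max hρ₀m
  have hρnn : ∀ z, 0 ≤ ρ' z := fun z => le_max_left _ _
  have hρM : ∀ z, ‖ρ' z‖ ≤ M := fun z => by
    rw [Real.norm_of_nonneg (hρnn z)]
    exact max_le ((norm_nonneg _).trans (hρ₀M z)) ((le_abs_self _).trans (hρ₀M z))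
  have hρ' : ρ =ᵐ[volume.restrict Q] ρ' := by
    filter_upwards [hρ₀, hsol.density_nonneg] with z h1 h2
    rw [hρ'def]
    dsimp only
    rw [← h1, max_eq_right h2]
  set w : SpaceTime d → ℝ × Space d := fun z => (ρ' z, u' z) with hw
  have hwm : Measurable w := hρm.prodMk hum
  have hwM : ∀ z, ‖w z‖ ≤ max M M' := fun z => max_le_max (hρM z) (huM z)
  have hwt : AreTraces S n w (fun x => (ρp x, up x)) (fun x => (ρm x, um x)) := by
    filter_upwards [hρt.congr_ae hQ hSQ hρ', hut.congr_ae hQ hSQ hu'] with x h1 h2 hxS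
    have h3 := (h1 hxS).prodMk hρm (measurable_jumpProfile _ _ _) (h2 hxS)
    have h4 : (fun z => (jumpProfile (n x) (ρp x) (ρm x) z, jumpProfile (n x) (up x) (um x) z))
        = jumpProfile (n x) (ρp x, up x) (ρm x, um x) := by
      ext1 z; unfold jumpProfile; split_ifs <;> rfl
    rwa [h4] at h3
  have hEc := continuous_energyFlux (d := d) hp hp0
  have hMc := fun i : Fin d => continuous_momentumFlux hp i
  have hRc := continuous_massFlux (d := d)
  obtain ⟨ME, hME⟩ := exists_bound_comp hEc hwM
  obtain ⟨MR, hMR⟩ := exists_bound_comp hRc hwM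
  have henergy := restrictEq_of_isBalance hQ D (isBalance_energy D hD hρ' hu')
    (hEc.measurable.comp hwm) hME (integrableOn_mul_inner hf hρm hρM hum huM) hS hn
    (Zp := fun x => energyFlux p (ρp x, up x)) (Zm := fun x => energyFlux p (ρm x, um x)) (by
      filter_upwards [hwt] with x hx hxS using (hx hxS).comp_continuous hwM hEc)
  have hmass := ae_inner_trace_sub_eq_zero hQ (isBalance_mass hsol hρ' hu')
    (hRc.measurable.comp hwm) hMR integrableOn_zero hSQ hS
  have hmom : ∀ i : Fin d, ∀ᵐ x ∂μHE[d], x ∈ S → ∀ n a b : SpaceTime d, ‖n‖ = 1 →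
      HasBlowUp (fun z => momentumFlux p i (w z)) x (jumpProfile n a b) → ⟪a - b, n⟫_ℝ = 0 := by
    intro i
    obtain ⟨MM, hMM⟩ := exists_bound_comp (hMc i) hwM
    refine ae_inner_trace_sub_eq_zero hQ (isBalance_momentum hsol hρ' hu' i)
      ((hMc i).measurable.comp hwm) hMM ?_ hSQ hS
    have := integrableOn_mul_inner hf hρm hρM
      (v := fun _ => EuclideanSpace.single i 1) measurable_const (fun _ => le_rfl)
    simpa [EuclideanSpace.inner_single_right] using this
  refine henergy.congr_ae hS.nullMeasurable ?_
  filter_upwards [hwt, hn, hmass, ae_all_iff.2 hmom] with x hx hnx hmassx hmomx hxS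
  have hbl := hx hxS
  have hn1 := hnx hxS
  have hn0 : n x ≠ 0 := fun h => by rw [h, norm_zero] at hn1; norm_num at hn1
  obtain ⟨hr, hs⟩ := hbl.mem_of_isClosed hn0 (C := {q : ℝ × Space d | 0 ≤ q.1})
    (isClosed_le continuous_const continuous_fst) (fun z => hρnn z)
  have h1 := hmassx hxS (n x) _ _ hn1 (hbl.comp_continuous hwM hRc)
  have h2 := fun i => hmomx i hxS (n x) _ _ hn1 (hbl.comp_continuous hwM (hMc i))
  rw [inner_sub_left, inner_massFlux, inner_massFlux, sub_eq_zero] at h1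
  simp only [inner_sub_left, inner_momentumFlux, sub_eq_zero] at h2
  have h3 := energy_jump hp hr hs h1 h2
  rw [inner_sub_left, inner_energyFlux, inner_energyFlux, h3, neg_mul]

end CompressibleEuler

end

theorem mainTheorem2 (d : ℕ) (T : ℝ) (Ω : Set (CompressibleEuler.Space d)) (hΩ : IsOpen Ω)
    (p : ℝ → ℝ) (hp : Continuous p) (hp0 : p 0 = 0)
    (ρ : CompressibleEuler.SpaceTime d → ℝ)
    (u f : CompressibleEuler.SpaceTime d → CompressibleEuler.Space d)
    (hρ : MemLp ρ ⊤ (volume.restrict (CompressibleEuler.domain T Ω)))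
    (hu : MemLp u ⊤ (volume.restrict (CompressibleEuler.domain T Ω)))
    (hf : MemLp f 1 (volume.restrict (CompressibleEuler.domain T Ω)))
    (hsol : CompressibleEuler.IsWeakSolution (CompressibleEuler.domain T Ω) p ρ u f)
    (D : CompressibleEuler.SignedRadonMeasure (CompressibleEuler.domain T Ω))
    (hD : D.Represents (CompressibleEuler.dissipation (CompressibleEuler.domain T Ω) p ρ u f))
    (S : Set (CompressibleEuler.SpaceTime d)) (hSsub : S ⊆ CompressibleEuler.domain T Ω)
    (hS : CompressibleEuler.IsRectifiableSet S)
    (n : CompressibleEuler.SpaceTime d → CompressibleEuler.SpaceTime d)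
    (hn : CompressibleEuler.IsUnitNormal S n)
    (hρS : CompressibleEuler.HasBilateralTraces ρ S)
    (huS : CompressibleEuler.HasBilateralTracesVec u S) :
    (∃ (ρp ρm : CompressibleEuler.SpaceTime d → ℝ)
        (up um : CompressibleEuler.SpaceTime d → CompressibleEuler.Space d),
      CompressibleEuler.AreTraces S n ρ ρp ρm ∧ CompressibleEuler.AreTraces S n u up um) ∧
    ∀ (ρp ρm : CompressibleEuler.SpaceTime d → ℝ)
        (up um : CompressibleEuler.SpaceTime d → CompressibleEuler.Space d),
      CompressibleEuler.AreTraces S n ρ ρp ρm → CompressibleEuler.AreTraces S n u up um →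
      D.RestrictEq S fun x =>
        -(inner ℝ (up x) (CompressibleEuler.spacePart (n x))
            - inner ℝ (um x) (CompressibleEuler.spacePart (n x)))
          * CompressibleEuler.bigPi p (ρp x) (ρm x) := by
  have hQ := CompressibleEuler.isOpen_domain T hΩ
  refine ⟨?_, fun ρp ρm up um hρt hut =>
    CompressibleEuler.restrictEq_of_areTraces hQ hp hp0 hρ hu hf hsol D hD hSsub hS
      hn.norm_eq_one hρt hut⟩
  obtain ⟨ρp, ρm, hρt⟩ := hρS.exists_traces hQ hSsub hS hn hρ
  obtain ⟨up, um, hut⟩ := huS.exists_traces hQ hSsub hS hn hu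
  exact ⟨ρp, ρm, up, um, hρt, hut⟩
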